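/- Let $M$ be a complete (connected, second countable, smooth) Riemannian manifold of dimension $N$, and let $H$ and $G$ be separable complex Hilbert spaces. Let $T^*_xM$ be the complexified cotangent space with the inner product induced by the metric. Let $C^1_0(M,H)$ be the space of $C^1$-maps $s:M\to H$ such that for every $\varepsilon>0$ there is a compact $K\subseteq M$ with $\|s(x)\|_H+\|ds(x)\|_{H\otimes T_x^*M}<\varepsilon$ for $x\notin K$, and put $C^1_0(M)=C^1_0(M,\mathbb C)$. It is a right $C^1_0(M)$-module, with hermitian form $\langle s,t\rangle(x)=\langle s(x),t(x)\rangle_H\in C^1_0(M)$ and with the norm on finite matrices $s=(s_{ij})$ over it $$\|s\|_1=\sup_{x\in M}\Big\|\big(s_{ij}(x),ds_{ij}(x)\big)_{i,j}\Big\|,$$ where a matrix over the Hilbert space $V=H\oplus (H\otimes T_x^*M)$ is normed as an operator $\mathbb C^n\to V^m$. A morphism $T:C^1_0(M,H)\to C^1_0(M,G)$ (of operator $*$-modules) is a $C^1_0(M)$-linear, completely bounded map for which there is a $C^1_0(M)$-linear, completely bounded $T^*:C^1_0(M,G)\to C^1_0(M,H)$ with $\langle Ts,t\rangle=\langle s,T^*t\rangle$;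 $\|T\|_{\rm cb}=\sup_n\|T_n\|$, where $T_n$ is the entrywise map on $n\times n$ matrices. A map $\alpha:M\to L(H,G)$ is $*$-strongly differentiable if $x\mapsto\alpha(x)\xi$ and $x\mapsto\alpha(x)^*\eta$ are $C^1$ for all $\xi\in H$, $\eta\in G$; its strong derivative is $d\alpha(x):H\to G\otimes T_x^*M$, $\xi\mapsto d(\alpha(\cdot)\xi)(x)$. Let $C^1_b(M,L(H,G))$ be the space of $*$-strongly differentiable $\alpha$ with $\sup_{x}(\|\alpha(x)\|+\|d\alpha(x)\|)<\infty$. For $*$-strongly differentiable $\alpha$ this condition is equivalent to the finiteness of $$\|\alpha\|_1=\sup_{x\in M}\left\|\begin{pmatrix}\alpha(x)&0\\ d\alpha(x)&\alpha(x)\otimes 1\end{pmatrix}: H\oplus (H\otimes T_x^*M)\to G\oplus (G\otimes T_x^*M)\right\| .$$ Then $\Phi(\alpha)(s)(x)=\alpha(x)s(x)$ defines a bijection $\Phi$ from $C^1_b(M,L(H,G))$ onto the set of morphisms $C^1_0(M,H)\to C^1_0(M,G)$. For every $\alpha\in C^1_b(M,L(H,G))$ the map $\alpha^*:x\mapsto\alpha(x)^*$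 lies in $C^1_b(M,L(G,H))$, the adjoint of $\Phi(\alpha)$ is unique, $\Phi(\alpha)^*=\Phi(\alpha^*)$, and $$\|\Phi(\alpha)\|_{\rm cb}\le\|\alpha\|_1\le 2\,\|\Phi(\alpha)\|_{\rm cb}.$$ In particular, let $C^1_0(M)^\infty$ be the standard module, the completion of the finitely supported sequences in $C^1_0(M)$ in the norm $f\mapsto\sup_n\|(f(1),\dots,f(n))^t\|_1$, with hermitian form $\langle f,g\rangle=\sum_k \overline{f(k)}\,g(k)$ and the matrix norms obtained by viewing each entry as a column. If $(e_k)_{k}$ is an orthonormal basis of $H$ indexed by the natural numbers, then $B(f)=\sum_k f(k)\,e_k$ is a unitary, completely isometric isomorphism of modules $C^1_0(M)^\infty\cong C^1_0(M,H)$, and $\alpha\mapsto B^{-1}\Phi(\alpha)B$ is a bijection from $C^1_b(M,L(H,H))$ onto $\mathrm{End}(C^1_0(M)^\infty)$. -/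

import Mathlib

open Bundle Manifold Topology Filter
open scoped ENNReal ContDiff InnerProductSpace

noncomputable section

set_option linter.unusedSectionVars false

namespace OpStarMod

/-! ### Matrix norms, completely bounded maps, morphisms of hermitian operator modules -/

/-- A matrix norm on a complex vector space `X`: a seminorm, with values in `[0, ∞]`, on the finite
(possibly rectangular) matrices over `X`. -/
class MatrixNorm (X : Type*) [AddCommGroup X] [Module ℂ X] where
  /-- the norm of a finite matrix -/
  mnorm : ∀ {ι κ : Type} [Fintype ι] [Fintype κ], Matrix ι κ X → ℝ≥0∞
  mnorm_add_le : ∀ {ι κ : Type} [Fintype ι] [Fintype κ] (ξ η : Matrix ι κ X),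
    mnorm (ξ + η) ≤ mnorm ξ + mnorm η
  mnorm_smul : ∀ {ι κ : Type} [Fintype ι] [Fintype κ] (c : ℂ) (ξ : Matrix ι κ X),
    mnorm (c • ξ) = ‖c‖ₑ * mnorm ξ

open MatrixNorm

/-- A (hermitian) pairing on `X` with values in `B`. -/
class HermForm (X : Type*) (B : outParam (Type*)) where
  /-- the pairing -/
  form : X → X → B

open HermForm

/-- A right action of `A` on `X`. -/
class RightAction (A X : Type*) where
  /-- the action -/
  act : X → A → X

open RightAction

/-- The completely bounded norm `sup_n ‖T_n‖`, where `T_n : M_n(X) → M_n(Y)` is the entrywise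
application of `T`. -/
def cbNorm {X Y : Type*} [AddCommGroup X] [Module ℂ X] [MatrixNorm X]
    [AddCommGroup Y] [Module ℂ Y] [MatrixNorm Y] (T : X →ₗ[ℂ] Y) : ℝ≥0∞ :=
  ⨆ (n : ℕ) (ξ : Matrix (Fin n) (Fin n) X) (_ : mnorm ξ ≤ 1), mnorm (ξ.map T)

/-- Complete isometries: linear maps which preserve the norms of all matrices. -/
def IsCompleteIsometry {X Y : Type*} [AddCommGroup X] [Module ℂ X] [MatrixNorm X]
    [AddCommGroup Y] [Module ℂ Y] [MatrixNorm Y] (T : X →ₗ[ℂ] Y) : Prop :=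
  ∀ (n : ℕ) (ξ : Matrix (Fin n) (Fin n) X), mnorm (ξ.map T) = mnorm ξ

/-- Morphisms of right operator modules over `A`: completely bounded module maps. -/
def IsModuleMorphism (A : Type*) {X Y : Type*} [AddCommGroup X] [Module ℂ X] [MatrixNorm X]
    [AddCommGroup Y] [Module ℂ Y] [MatrixNorm Y] [RightAction A X] [RightAction A Y]
    (T : X →ₗ[ℂ] Y) : Prop :=
  (∀ (s : X) (a : A), T (act s a) = act (T s) a) ∧ cbNorm T < ⊤

/-- `S` is an adjoint of `T` with respect to the hermitian forms. -/
def IsAdjoint {B X Y : Type*} [AddCommGroup X] [Module ℂ X] [HermForm X B]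
    [AddCommGroup Y] [Module ℂ Y] [HermForm Y B] (T : X →ₗ[ℂ] Y) (S : Y →ₗ[ℂ] X) : Prop :=
  ∀ (s : X) (t : Y), form (T s) t = form s (S t)

/-- Morphisms of hermitian operator modules (in particular of operator `*`-modules) over `A`:
completely bounded module maps which have a completely bounded adjoint module map. -/
def Mor (A X Y : Type*) {B : Type*}
    [AddCommGroup X] [Module ℂ X] [MatrixNorm X] [RightAction A X] [HermForm X B]
    [AddCommGroup Y] [Module ℂ Y] [MatrixNorm Y] [RightAction A Y] [HermForm Y B] : Type _ :=
  {T : X →ₗ[ℂ] Y // IsModuleMorphism A T ∧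
    ∃ S : Y →ₗ[ℂ] X, IsModuleMorphism A S ∧ IsAdjoint T S}

/-! ### The standard sequence space -/

section StandardSequenceSpace

variable {X : Type*} [AddCommGroup X] [Module ℂ X]

/-- The column of length `m` with the entries `f k`, `n ≤ k < m`, and `0` for `k < n`. -/
def segCol (f : ℕ → X) (n m : ℕ) : Matrix (Fin m) Unit X :=
  fun k _ => if n ≤ (k : ℕ) then f k else 0

/-- For matrices `ξ` of sequences: the block matrix `α_n(ξ)`, whose block at `(i, j)` is the column
of the first `n` entries of `ξ i j`. -/
def blockCol {ι κ : Type} (n : ℕ) (ξ : Matrix ι κ (ℕ → X)) : Matrix (ι × Fin n) κ X :=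
  fun p j => ξ p.1 j p.2

theorem segCol_add (f g : ℕ → X) (n m : ℕ) :
    segCol (f + g) n m = segCol f n m + segCol g n m := by
  ext k u
  by_cases h : n ≤ (k : ℕ) <;> simp [segCol, h]

theorem segCol_smul (c : ℂ) (f : ℕ → X) (n m : ℕ) :
    segCol (c • f) n m = c • segCol f n m := by
  ext k u
  by_cases h : n ≤ (k : ℕ) <;> simp [segCol, h]

theorem mnorm_zero [MatrixNorm X] {ι κ : Type} [Fintype ι] [Fintype κ] :
    mnorm (0 : Matrix ι κ X) = 0 := by
  have h := mnorm_smul (0 : ℂ) (0 : Matrix ι κ X)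
  simpa using h

variable (X) in
/-- The standard sequence space `X^∞`: the completion of the space of finitely supported sequences
in the column norm `sup_n ‖(f 0, …, f (n - 1))ᵗ‖`, for complete `X`.  The completion is realised
as a space of sequences: those whose truncations form a Cauchy sequence for this norm. -/
def StdSeq [MatrixNorm X] : Submodule ℂ (ℕ → X) where
  carrier := {f | ∀ ε : ℝ≥0∞, 0 < ε → ∃ n₀ : ℕ, ∀ n m : ℕ, n₀ ≤ n → n ≤ m →
    mnorm (segCol f n m) ≤ ε}
  zero_mem' := by
    intro ε hε
    refine ⟨0, fun n m _ _ => ?_⟩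
    have : segCol (0 : ℕ → X) n m = 0 := by
      ext k u
      simp [segCol]
    rw [this, mnorm_zero]
    exact zero_le
  add_mem' := by
    intro f g hf hg ε hε
    obtain ⟨a, ha⟩ := hf (ε / 2) (ENNReal.half_pos hε.ne')
    obtain ⟨b, hb⟩ := hg (ε / 2) (ENNReal.half_pos hε.ne')
    refine ⟨max a b, fun n m hn hm => ?_⟩
    rw [segCol_add]
    calc mnorm (segCol f n m + segCol g n m)
        ≤ mnorm (segCol f n m) + mnorm (segCol g n m) := mnorm_add_le _ _
      _ ≤ ε / 2 + ε / 2 := add_le_add (ha n m (le_trans (le_max_left _ _) hn) hm)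
          (hb n m (le_trans (le_max_right _ _) hn) hm)
      _ = ε := ENNReal.add_halves ε
  smul_mem' := by
    intro c f hf ε hε
    by_cases hc : c = 0
    · refine ⟨0, fun n m _ _ => ?_⟩
      rw [segCol_smul, mnorm_smul, hc]
      simp
    · have hc' : ‖c‖ₑ ≠ 0 := by simpa using hc
      obtain ⟨a, ha⟩ := hf (ε / ‖c‖ₑ) (ENNReal.div_pos hε.ne' enorm_ne_top)
      refine ⟨a, fun n m hn hm => ?_⟩
      rw [segCol_smul, mnorm_smul]
      calc ‖c‖ₑ * mnorm (segCol f n m) ≤ ‖c‖ₑ * (ε / ‖c‖ₑ) := by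
            gcongr
            exact ha n m hn hm
        _ = ε := ENNReal.mul_div_cancel hc' enorm_ne_top

/-- The matrix norm `ξ ↦ sup_n ‖α_n(ξ)‖` of the standard sequence space. -/
instance [MatrixNorm X] : MatrixNorm (StdSeq X) where
  mnorm ξ := ⨆ n : ℕ, mnorm (blockCol n (ξ.map (fun f => (f : ℕ → X))))
  mnorm_add_le ξ η := by
    refine iSup_le fun n => le_trans ?_ (add_le_add
      (le_iSup (fun n : ℕ => mnorm (blockCol n (ξ.map (fun f => (f : ℕ → X))))) n)
      (le_iSup (fun n : ℕ => mnorm (blockCol n (η.map (fun f => (f : ℕ → X))))) n))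
    exact mnorm_add_le _ _
  mnorm_smul c ξ := by
    rw [ENNReal.mul_iSup]
    exact iSup_congr fun n => mnorm_smul c _

end StandardSequenceSpace

/-! ### `C¹`-maps vanishing at infinity on a Riemannian manifold -/

section Manifold

variable (N : ℕ) (M : Type*) [TopologicalSpace M] [ChartedSpace (EuclideanSpace ℝ (Fin N)) M]
  [RiemannianBundle (fun x : M => TangentSpace (𝓡 N) x)]
  (E H G : Type*) [NormedAddCommGroup E] [InnerProductSpace ℂ E]
  [NormedAddCommGroup H] [InnerProductSpace ℂ H] [NormedAddCommGroup G] [InnerProductSpace ℂ G]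

variable {M} in
/-- An orthonormal basis of the tangent space at `x`. -/
def frame (x : M) : OrthonormalBasis (Fin N) ℝ (TangentSpace (𝓡 N) x) :=
  haveI : FiniteDimensional ℝ (TangentSpace (𝓡 N) x) :=
    inferInstanceAs (FiniteDimensional ℝ (EuclideanSpace ℝ (Fin N)))
  (stdOrthonormalBasis ℝ (TangentSpace (𝓡 N) x)).reindex
    (finCongr (finrank_euclideanSpace_fin (𝕜 := ℝ) (n := N)))

/-- The Hilbert space `E ⊗ T_x^*M` (complexified cotangent space with the dual metric), written in
the orthonormal basis of `T_x^*M` which is dual to `frame N x`. -/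
abbrev Cot : Type _ := PiLp 2 (fun _ : Fin N => E)

/-- The Hilbert space `E ⊕ (E ⊗ T_x^*M)`. -/
abbrev Jet : Type _ := WithLp 2 (E × Cot N E)

variable {M E} in
/-- The de Rham derivative `(df)(x) ∈ E ⊗ T_x^*M`. -/
def deRham (f : M → E) (x : M) : Cot N E :=
  WithLp.toLp 2 (fun i => (mfderiv (𝓡 N) 𝓘(ℝ, E) f x (frame N x i) : E))

variable {M E} in
/-- The pair `(f(x), (df)(x)) ∈ E ⊕ (E ⊗ T_x^*M)`. -/
def jet (f : M → E) (x : M) : Jet N E := WithLp.toLp 2 (f x, deRham N f x)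

section calculus

variable {N M E}

theorem deRham_eq {f : M → E} {x : M} {f' : TangentSpace (𝓡 N) x →L[ℝ] E}
    (hf : HasMFDerivAt (𝓡 N) 𝓘(ℝ, E) f x f') :
    deRham N f x = WithLp.toLp 2 (fun i => f' (frame N x i)) := by
  unfold deRham
  rw [hf.mfderiv]
  rfl

theorem hasMFDerivAt_of {f : M → E} (hf : ContMDiff (𝓡 N) 𝓘(ℝ, E) 1 f) (x : M) :
    HasMFDerivAt (𝓡 N) 𝓘(ℝ, E) f x (mfderiv (𝓡 N) 𝓘(ℝ, E) f x) :=
  (hf.mdifferentiableAt one_ne_zero).hasMFDerivAt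

theorem deRham_add {f g : M → E} (hf : ContMDiff (𝓡 N) 𝓘(ℝ, E) 1 f)
    (hg : ContMDiff (𝓡 N) 𝓘(ℝ, E) 1 g) (x : M) :
    deRham N (f + g) x = deRham N f x + deRham N g x := by
  rw [deRham_eq ((hasMFDerivAt_of hf x).add (hasMFDerivAt_of hg x))]
  rfl

theorem deRham_smul_fun {a : M → ℂ} {f : M → E} (ha : ContMDiff (𝓡 N) 𝓘(ℝ, ℂ) 1 a)
    (hf : ContMDiff (𝓡 N) 𝓘(ℝ, E) 1 f) (x : M) :
    deRham N (fun y => a y • f y) x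
      = a x • deRham N f x + WithLp.toLp 2 (fun i => deRham N a x i • f x) := by
  have h1 := hasMFDerivAt_of ha x
  have h2 := hasMFDerivAt_of hf x
  have h : HasMFDerivAt (𝓡 N) 𝓘(ℝ, E) (fun y => a y • f y) x
      ((a x • (show TangentSpace (𝓡 N) x →L[ℝ] E from mfderiv (𝓡 N) 𝓘(ℝ, E) f x) +
        (show TangentSpace (𝓡 N) x →L[ℝ] ℂ from mfderiv (𝓡 N) 𝓘(ℝ, ℂ) a x).smulRight (f x) :
        TangentSpace (𝓡 N) x →L[ℝ] E)) := by
    refine ⟨h1.1.smul h2.1, ?_⟩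
    have h3 := h1.2
    have h4 := h2.2
    simp only [writtenInExtChartAt, extChartAt_model_space_eq_id, PartialEquiv.refl_coe,
      Function.id_comp] at h3 h4 ⊢
    have e : (extChartAt (𝓡 N) x).symm (extChartAt (𝓡 N) x x) = x := extChartAt_to_inv x
    have h5 := h3.smul h4
    simp only [Function.comp_apply, e] at h5
    exact h5
  rw [deRham_eq h]
  rfl

theorem contMDiff_smul_fun {a : M → ℂ} {f : M → E} (ha : ContMDiff (𝓡 N) 𝓘(ℝ, ℂ) 1 a)
    (hf : ContMDiff (𝓡 N) 𝓘(ℝ, E) 1 f) : ContMDiff (𝓡 N) 𝓘(ℝ, E) 1 (fun y => a y • f y) := by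
  have h : ContDiff ℝ 1 (fun p : ℂ × E => p.1 • p.2) := contDiff_fst.smul contDiff_snd
  exact h.contMDiff.comp (ha.prodMk_space hf)

theorem deRham_const_smul (c : ℂ) {f : M → E} (hf : ContMDiff (𝓡 N) 𝓘(ℝ, E) 1 f) (x : M) :
    deRham N (c • f) x = c • deRham N f x := by
  have h := deRham_smul_fun (N := N) (a := fun _ : M => c) contMDiff_const hf x
  have h0 : deRham N (fun _ : M => c) x = 0 := by
    rw [deRham_eq (hasMFDerivAt_const c x)]
    rfl
  rw [h0] at h
  refine h.trans ?_
  ext i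
  simp

end calculus

/-- The space `C¹₀(M, E)` of `C¹`-maps `M → E` which vanish at infinity together with their
derivative.  For `E = ℂ` this is the `*`-algebra `C¹₀(M)`. -/
def C10 : Submodule ℂ (M → E) where
  carrier := {f | ContMDiff (𝓡 N) 𝓘(ℝ, E) 1 f ∧ ∀ ε : ℝ, 0 < ε →
    ∃ K : Set M, IsCompact K ∧ ∀ x ∉ K, ‖f x‖ + ‖deRham N f x‖ < ε}
  zero_mem' := by
    refine ⟨contMDiff_const, fun ε hε => ⟨∅, isCompact_empty, fun x _ => ?_⟩⟩
    have h0 : deRham N (0 : M → E) x = 0 := by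
      have := deRham_eq (N := N) (hasMFDerivAt_const (I := 𝓡 N) (I' := 𝓘(ℝ, E)) (0 : E) x)
      exact this
    simpa [h0] using hε
  add_mem' := by
    rintro f g ⟨hf, hf'⟩ ⟨hg, hg'⟩
    refine ⟨hf.add hg, fun ε hε => ?_⟩
    obtain ⟨K, hK, h1⟩ := hf' (ε / 2) (half_pos hε)
    obtain ⟨L, hL, h2⟩ := hg' (ε / 2) (half_pos hε)
    refine ⟨K ∪ L, hK.union hL, fun x hx => ?_⟩
    rw [Set.mem_union, not_or] at hx
    rw [deRham_add hf hg]
    have e1 := norm_add_le (f x) (g x)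
    have e2 := norm_add_le (deRham N f x) (deRham N g x)
    have e3 := h1 x hx.1
    have e4 := h2 x hx.2
    simp only [Pi.add_apply]
    linarith
  smul_mem' := by
    rintro c f ⟨hf, hf'⟩
    refine ⟨contMDiff_smul_fun contMDiff_const hf, fun ε hε => ?_⟩
    have hc : 0 < ‖c‖ + 1 := by positivity
    obtain ⟨K, hK, h1⟩ := hf' (ε / (‖c‖ + 1)) (div_pos hε hc)
    refine ⟨K, hK, fun x hx => ?_⟩
    have e := h1 x hx
    rw [lt_div_iff₀ hc] at e
    rw [deRham_const_smul c hf, Pi.smul_apply, norm_smul, norm_smul]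
    nlinarith [norm_nonneg (f x), norm_nonneg (deRham N f x)]

variable {N M E H G}

/-- The value of `(s, ds)` at `x`, as a linear function of `s ∈ C¹₀(M, E)`. -/
def jetAt (x : M) : C10 N M E →ₗ[ℂ] Jet N E where
  toFun s := jet N (s : M → E) x
  map_add' s t := by
    have h := deRham_add s.2.1 t.2.1 x
    simp only [jet, Submodule.coe_add, h]
    rfl
  map_smul' c s := by
    have h := deRham_const_smul c s.2.1 x
    simp only [jet, Submodule.coe_smul, h]
    rfl

/-- A finite matrix `ξ` of vectors of a Hilbert space `V`, regarded as an operator `ℂ^κ → V^ι`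
(that is, `V` is identified with the operators `ℂ → V`). -/
def matOp {V : Type*} [NormedAddCommGroup V] [InnerProductSpace ℂ V] {ι κ : Type} [Fintype ι]
    [Fintype κ] (ξ : Matrix ι κ V) (v : EuclideanSpace ℂ κ) : PiLp 2 (fun _ : ι => V) :=
  WithLp.toLp 2 (fun i => ∑ j, v j • ξ i j)

/-- The norm of a finite matrix of vectors of a Hilbert space: its operator norm. -/
def vecNorm {V : Type*} [NormedAddCommGroup V] [InnerProductSpace ℂ V] {ι κ : Type} [Fintype ι]
    [Fintype κ] (ξ : Matrix ι κ V) : ℝ≥0∞ :=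
  ⨆ (v : EuclideanSpace ℂ κ) (_ : ‖v‖ ≤ 1), ‖matOp ξ v‖ₑ

theorem vecNorm_add_le {V : Type*} [NormedAddCommGroup V] [InnerProductSpace ℂ V] {ι κ : Type}
    [Fintype ι] [Fintype κ] (ξ η : Matrix ι κ V) : vecNorm (ξ + η) ≤ vecNorm ξ + vecNorm η := by
  refine iSup₂_le fun v hv => ?_
  have h : matOp (ξ + η) v = matOp ξ v + matOp η v := by
    ext i
    simp [matOp, Finset.sum_add_distrib]
  rw [h]
  exact (enorm_add_le _ _).trans (add_le_add
    (le_iSup₂ (f := fun (v : EuclideanSpace ℂ κ) (_ : ‖v‖ ≤ 1) => ‖matOp ξ v‖ₑ) v hv)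
    (le_iSup₂ (f := fun (v : EuclideanSpace ℂ κ) (_ : ‖v‖ ≤ 1) => ‖matOp η v‖ₑ) v hv))

theorem vecNorm_smul {V : Type*} [NormedAddCommGroup V] [InnerProductSpace ℂ V] {ι κ : Type}
    [Fintype ι] [Fintype κ] (c : ℂ) (ξ : Matrix ι κ V) : vecNorm (c • ξ) = ‖c‖ₑ * vecNorm ξ := by
  unfold vecNorm
  simp_rw [ENNReal.mul_iSup]
  refine iSup_congr fun v => iSup_congr fun hv => ?_
  have h : matOp (c • ξ) v = c • matOp ξ v := by
    ext i
    change ∑ j, v j • (c • ξ i j) = c • ∑ j, v j • ξ i j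
    rw [Finset.smul_sum]
    exact Finset.sum_congr rfl fun j _ => smul_comm _ _ _
  rw [h, enorm_smul]

/-- The matrix norm `‖s‖₁ = sup_x ‖(s(x), (ds)(x))‖` of `C¹₀(M, E)`, where `(s(x), (ds)(x))` is
a matrix over the Hilbert space `E ⊕ (E ⊗ T_x^*M)`. -/
instance : MatrixNorm (C10 N M E) where
  mnorm s := ⨆ x : M, vecNorm (s.map (jetAt x))
  mnorm_add_le s t := by
    refine iSup_le fun x => le_trans ?_ (add_le_add
      (le_iSup (fun x : M => vecNorm (s.map (jetAt x))) x)
      (le_iSup (fun x : M => vecNorm (t.map (jetAt x))) x))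
    have h : (s + t).map (jetAt x) = s.map (jetAt x) + t.map (jetAt x) :=
      Matrix.map_add _ (map_add (jetAt x)) s t
    rw [h]
    exact vecNorm_add_le _ _
  mnorm_smul c s := by
    rw [ENNReal.mul_iSup]
    refine iSup_congr fun x => ?_
    have h : (c • s).map (jetAt x) = c • s.map (jetAt x) :=
      Matrix.map_smul _ c (map_smul (jetAt x) c) s
    rw [h]
    exact vecNorm_smul _ _

/-- The hermitian form `⟨s, t⟩ : x ↦ ⟨s(x), t(x)⟩`, an element of `C¹₀(M)` which is regarded
as a function. -/
instance : HermForm (C10 N M E) (M → ℂ) where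
  form s t := fun x => inner ℂ (s.1 x) (t.1 x)

theorem norm_deRham_smul_le {a : M → ℂ} {f : M → E} (ha : ContMDiff (𝓡 N) 𝓘(ℝ, ℂ) 1 a)
    (hf : ContMDiff (𝓡 N) 𝓘(ℝ, E) 1 f) (x : M) :
    ‖deRham N (fun y => a y • f y) x‖ ≤ ‖a x‖ * ‖deRham N f x‖ + ‖deRham N a x‖ * ‖f x‖ := by
  rw [deRham_smul_fun ha hf]
  refine (norm_add_le _ _).trans ?_
  rw [norm_smul]
  gcongr
  rw [PiLp.norm_eq_of_L2, PiLp.norm_eq_of_L2]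
  rw [← Real.sqrt_sq (norm_nonneg (f x)), ← Real.sqrt_mul (by positivity)]
  apply Real.sqrt_le_sqrt
  rw [Finset.sum_mul]
  simp [norm_smul, mul_pow]

/-- The action of `C¹₀(M)` on `C¹₀(M, E)` by pointwise multiplication. -/
instance : RightAction (C10 N M ℂ) (C10 N M E) where
  act s a := ⟨fun x => a.1 x • s.1 x, contMDiff_smul_fun a.2.1 s.2.1, fun ε hε => by
    obtain ⟨K, hK, h1⟩ := a.2.2 (min 1 ε) (lt_min one_pos hε)
    obtain ⟨L, hL, h2⟩ := s.2.2 (1 / 2) (by norm_num)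
    refine ⟨K ∪ L, hK.union hL, fun x hx => ?_⟩
    rw [Set.mem_union, not_or] at hx
    have e1 := h1 x hx.1
    have e2 := h2 x hx.2
    have e3 := norm_deRham_smul_le a.2.1 s.2.1 x
    have e4 := (lt_min_iff.1 e1).2
    have p1 := norm_nonneg (a.1 x)
    have p2 := norm_nonneg (s.1 x)
    have p3 := norm_nonneg (deRham N a.1 x)
    have p4 := norm_nonneg (deRham N s.1 x)
    rw [norm_smul]
    nlinarith⟩

/-- The derivative of a `C¹`-map is locally bounded in the Riemannian norm. -/
theorem deRham_locally_bounded [IsManifold (𝓡 N) ∞ M]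
    [IsContMDiffRiemannianBundle (𝓡 N) ∞ (EuclideanSpace ℝ (Fin N))
      (fun x : M => TangentSpace (𝓡 N) x)]
    {f : M → E} (hf : ContMDiff (𝓡 N) 𝓘(ℝ, E) 1 f) (x : M) :
    ∃ C : ℝ, ∀ᶠ y in 𝓝 x, ‖f y‖ + ‖deRham N f y‖ ≤ C := by
  have : IsContinuousRiemannianBundle (EuclideanSpace ℝ (Fin N))
      (fun x : M => TangentSpace (𝓡 N) x) := by
    obtain ⟨g, hg, hg'⟩ := IsContMDiffRiemannianBundle.exists_contMDiff (IB := 𝓡 N) (n := ∞)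
      (F := EuclideanSpace ℝ (Fin N)) (E := fun x : M => TangentSpace (𝓡 N) x)
    exact ⟨g, hg.continuous, hg'⟩
  obtain ⟨C, hC0, hC⟩ := eventually_norm_trivializationAt_lt (EuclideanSpace ℝ (Fin N))
    (fun x : M => TangentSpace (𝓡 N) x) x
  set φ := extChartAt (𝓡 N) x with hφ
  set g : EuclideanSpace ℝ (Fin N) → E := f ∘ φ.symm with hg
  have hg1 : ContDiffOn ℝ 1 g φ.target := by
    rw [← contMDiffOn_iff_contDiffOn]
    exact hf.comp_contMDiffOn (contMDiffOn_extChartAt_symm x)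
  have hopen : IsOpen φ.target := isOpen_extChartAt_target x
  have hcont : ContinuousAt (fun y => ‖fderiv ℝ g (φ y)‖) x := by
    have h1 : ContinuousOn (fderiv ℝ g) φ.target :=
      hg1.continuousOn_fderiv_of_isOpen hopen le_rfl
    have h2 : ContinuousAt (fderiv ℝ g) (φ x) :=
      h1.continuousAt (hopen.mem_nhds (mem_extChartAt_target x))
    exact (ContinuousAt.comp (f := φ) h2 (continuousAt_extChartAt x)).norm
  have hcont' : ContinuousAt (fun y => ‖f y‖) x := hf.continuous.norm.continuousAt
  have hb1 := hcont.eventually (gt_mem_nhds (lt_add_one (‖fderiv ℝ g (φ x)‖)))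
  have hb2 := hcont'.eventually (gt_mem_nhds (lt_add_one (‖f x‖)))
  refine ⟨(‖f x‖ + 1) + √(∑ _i : Fin N, ((‖fderiv ℝ g (φ x)‖ + 1) * C) ^ 2), ?_⟩
  filter_upwards [hC, hb1, hb2, chart_source_mem_nhds (EuclideanSpace ℝ (Fin N)) x]
    with y h1 h2 h3 hy
  have hy' : y ∈ φ.source := by rwa [hφ, extChartAt_source]
  have hd : HasMFDerivAt (𝓡 N) 𝓘(ℝ, E) f y
      ((fderiv ℝ g (φ y)).comp (mfderiv (𝓡 N) 𝓘(ℝ, EuclideanSpace ℝ (Fin N)) φ y)) := by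
    have e1 : HasMFDerivAt 𝓘(ℝ, EuclideanSpace ℝ (Fin N)) 𝓘(ℝ, E) g (φ y) (fderiv ℝ g (φ y)) :=
      ((hg1.contDiffAt (hopen.mem_nhds (φ.map_source hy'))).differentiableAt
        one_ne_zero).hasFDerivAt.hasMFDerivAt
    have e2 := (mdifferentiableAt_extChartAt (I := 𝓡 N) (x := x) hy).hasMFDerivAt
    refine (e1.comp y e2).congr_of_eventuallyEq ?_
    filter_upwards [(isOpen_extChartAt_source (I := 𝓡 N) x).mem_nhds hy'] with z hz
    simp only [hg, Function.comp_apply]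
    exact congrArg f (φ.left_inv hz).symm
  rw [deRham_eq hd]
  refine add_le_add h3.le ?_
  rw [PiLp.norm_eq_of_L2]
  refine Real.sqrt_le_sqrt (Finset.sum_le_sum fun i _ => ?_)
  refine pow_le_pow_left₀ (norm_nonneg _) ?_ 2
  have e3 : ‖(trivializationAt (EuclideanSpace ℝ (Fin N)) (fun x : M => TangentSpace (𝓡 N) x)
      x).continuousLinearMapAt ℝ y (frame N y i)‖ ≤ C := by
    refine ((ContinuousLinearMap.le_opNorm _ _).trans ?_)
    rw [(frame N y).orthonormal.1 i, mul_one]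
    exact h1.le
  rw [TangentBundle.continuousLinearMapAt_trivializationAt hy] at e3
  exact ((fderiv ℝ g (φ y)).le_opNorm _).trans
    (mul_le_mul h2.le e3 (norm_nonneg _) (by positivity))

theorem C10_bounded [IsManifold (𝓡 N) ∞ M]
    [IsContMDiffRiemannianBundle (𝓡 N) ∞ (EuclideanSpace ℝ (Fin N))
      (fun x : M => TangentSpace (𝓡 N) x)]
    (s : C10 N M E) : ∃ C : ℝ, 0 ≤ C ∧ ∀ x, ‖s.1 x‖ + ‖deRham N s.1 x‖ ≤ C := by
  obtain ⟨K, hK, h⟩ := s.2.2 1 one_pos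
  have hloc : ∀ x ∈ K, ∃ t ∈ 𝓝[K] x, ∃ C : ℝ, ∀ y ∈ t, ‖s.1 y‖ + ‖deRham N s.1 y‖ ≤ C := by
    intro x _
    obtain ⟨C, hC⟩ := deRham_locally_bounded s.2.1 x
    exact ⟨_, mem_nhdsWithin_of_mem_nhds hC, C, fun y hy => hy⟩
  obtain ⟨C, hC⟩ : ∃ C : ℝ, ∀ y ∈ K, ‖s.1 y‖ + ‖deRham N s.1 y‖ ≤ C := by
    refine hK.induction_on (p := fun t => ∃ C : ℝ, ∀ y ∈ t, ‖s.1 y‖ + ‖deRham N s.1 y‖ ≤ C)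
      ⟨0, fun y hy => hy.elim⟩ ?_ ?_ hloc
    · rintro a b hab ⟨C, hC⟩
      exact ⟨C, fun y hy => hC y (hab hy)⟩
    · rintro a b ⟨C, hC⟩ ⟨D, hD⟩
      refine ⟨max C D, fun y hy => ?_⟩
      rcases hy with hy | hy
      · exact (hC y hy).trans (le_max_left _ _)
      · exact (hD y hy).trans (le_max_right _ _)
  refine ⟨max C 1, le_max_of_le_right zero_le_one, fun x => ?_⟩
  by_cases hx : x ∈ K
  · exact (hC x hx).trans (le_max_left _ _)
  · exact (h x hx).le.trans (le_max_right _ _)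

theorem norm_jetAt_smul_le (a : C10 N M ℂ) (s : C10 N M E) (x : M) {C : ℝ}
    (hC : ‖a.1 x‖ + ‖deRham N a.1 x‖ ≤ C) :
    ‖jetAt x (act s a)‖ ≤ 2 * C * ‖jetAt x s‖ := by
  have h1 : ‖s.1 x‖ ≤ ‖jetAt x s‖ := WithLp.norm_fst_le _ (jetAt x s)
  have h2 : ‖deRham N s.1 x‖ ≤ ‖jetAt x s‖ := WithLp.norm_snd_le _ (jetAt x s)
  have h3 := norm_deRham_smul_le a.2.1 s.2.1 x
  have h4 : ‖a.1 x • s.1 x‖ = ‖a.1 x‖ * ‖s.1 x‖ := norm_smul _ _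
  have h5 : ‖jetAt x (act s a)‖ ≤ ‖a.1 x • s.1 x‖ + ‖deRham N (fun y => a.1 y • s.1 y) x‖ := by
    rw [WithLp.prod_norm_eq_of_L2]
    refine (Real.sqrt_le_left (by positivity)).2 ?_
    change ‖a.1 x • s.1 x‖ ^ 2 + ‖deRham N (fun y => a.1 y • s.1 y) x‖ ^ 2 ≤ _
    nlinarith [norm_nonneg (a.1 x • s.1 x), norm_nonneg (deRham N (fun y => a.1 y • s.1 y) x)]
  have p1 := norm_nonneg (a.1 x)
  have p2 := norm_nonneg (s.1 x)
  have p3 := norm_nonneg (deRham N a.1 x)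
  have p4 := norm_nonneg (deRham N s.1 x)
  have q1 := mul_le_mul_of_nonneg_left h1 p1
  have q2 := mul_le_mul_of_nonneg_left h2 p1
  have q3 := mul_le_mul_of_nonneg_left h1 p3
  have q4 := mul_le_mul_of_nonneg_right hC (norm_nonneg (jetAt x s))
  have q5 := mul_nonneg p3 (norm_nonneg (jetAt x s))
  nlinarith

theorem vecNorm_col_le {V : Type*} [NormedAddCommGroup V] [InnerProductSpace ℂ V] {m : ℕ}
    (ξ η : Matrix (Fin m) Unit V) {C : ℝ} (hC : 0 ≤ C)
    (h : ∀ k u, ‖ξ k u‖ ≤ C * ‖η k u‖) : vecNorm ξ ≤ ENNReal.ofReal C * vecNorm η := by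
  refine iSup₂_le fun v hv => ?_
  have h1 : ‖matOp ξ v‖ ≤ C * ‖matOp η v‖ := by
    rw [PiLp.norm_eq_of_L2, PiLp.norm_eq_of_L2]
    nth_rewrite 1 [← Real.sqrt_sq hC]
    rw [← Real.sqrt_mul (by positivity)]
    refine Real.sqrt_le_sqrt ?_
    rw [Finset.mul_sum]
    refine Finset.sum_le_sum fun k _ => ?_
    rw [← mul_pow]
    refine pow_le_pow_left₀ (norm_nonneg _) ?_ 2
    have e := mul_le_mul_of_nonneg_left (h k ()) (norm_nonneg (v ()))
    simp only [matOp, Finset.univ_unique, Finset.sum_singleton, norm_smul]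
    calc _ ≤ ‖v ()‖ * (C * ‖η k ()‖) := e
      _ = _ := by
        rw [PUnit.default_eq_unit]
        ring
  calc ‖matOp ξ v‖ₑ = ENNReal.ofReal ‖matOp ξ v‖ := (ofReal_norm _).symm
    _ ≤ ENNReal.ofReal (C * ‖matOp η v‖) := ENNReal.ofReal_le_ofReal h1
    _ = ENNReal.ofReal C * ‖matOp η v‖ₑ := by rw [ENNReal.ofReal_mul hC, ofReal_norm]
    _ ≤ ENNReal.ofReal C * vecNorm η := by
      gcongr
      exact le_iSup₂ (f := fun (v : EuclideanSpace ℂ Unit) (_ : ‖v‖ ≤ 1) => ‖matOp η v‖ₑ) v hv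

/-- The action of `C¹₀(M)` on the standard module `C¹₀(M)^∞`: `(f · a)(k) = f(k) · a`. -/
instance [IsManifold (𝓡 N) ∞ M]
    [IsContMDiffRiemannianBundle (𝓡 N) ∞ (EuclideanSpace ℝ (Fin N))
      (fun x : M => TangentSpace (𝓡 N) x)] :
    RightAction (C10 N M ℂ) (StdSeq (C10 N M ℂ)) where
  act f a := ⟨fun k => act (f.1 k) a, by
    obtain ⟨C, hC0, hC⟩ := C10_bounded a
    set D : ℝ := 2 * C + 1 with hD
    have hD0 : 0 < D := by positivity
    have hDe : ENNReal.ofReal D ≠ 0 := by simpa using hD0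
    intro ε hε
    obtain ⟨n₀, hn₀⟩ := f.2 (ε / ENNReal.ofReal D) (ENNReal.div_pos hε.ne' ENNReal.ofReal_ne_top)
    refine ⟨n₀, fun n m hn hm => iSup_le fun x => ?_⟩
    have h1 : vecNorm ((segCol (fun k => act (f.1 k) a) n m).map (jetAt x)) ≤
        ENNReal.ofReal D * vecNorm ((segCol f.1 n m).map (jetAt x)) := by
      refine vecNorm_col_le _ _ hD0.le fun k u => ?_
      by_cases hk : n ≤ (k : ℕ)
      · simp only [segCol, Matrix.map_apply, hk, if_true]
        refine (norm_jetAt_smul_le a (f.1 k) x (hC x)).trans ?_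
        exact mul_le_mul_of_nonneg_right (by linarith) (norm_nonneg _)
      · simp [segCol, hk]
    refine h1.trans ?_
    calc ENNReal.ofReal D * vecNorm ((segCol f.1 n m).map (jetAt x))
        ≤ ENNReal.ofReal D * (ε / ENNReal.ofReal D) := by
          gcongr
          exact (le_iSup (fun x : M => vecNorm ((segCol f.1 n m).map (jetAt x))) x).trans
            (hn₀ n m hn hm)
      _ = ε := ENNReal.mul_div_cancel hDe ENNReal.ofReal_ne_top⟩

/-- The hermitian form `⟨f, g⟩ = Σ_k f(k)^* g(k)` of `C¹₀(M)^∞`, an element of `C¹₀(M)` which is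
regarded as a function. -/
instance : HermForm (StdSeq (C10 N M ℂ)) (M → ℂ) where
  form f g := fun x => ∑' k : ℕ, (starRingEnd ℂ) ((f.1 k).1 x) * (g.1 k).1 x

/-! ### `*`-strongly differentiable operator valued maps -/

/-- A map `α : M → L(H, G)` is strongly differentiable when `x ↦ α(x)ξ` is `C¹` for all `ξ`. -/
def StronglyDiff (α : M → (H →L[ℂ] G)) : Prop :=
  ∀ ξ : H, ContMDiff (𝓡 N) 𝓘(ℝ, G) 1 (fun x => α x ξ)

/-- A map is `*`-strongly differentiable when it and its adjoint are strongly differentiable. -/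
def StarStronglyDiff [CompleteSpace H] [CompleteSpace G] (α : M → (H →L[ℂ] G)) : Prop :=
  StronglyDiff (N := N) α ∧ StronglyDiff (N := N) (fun x => ContinuousLinearMap.adjoint (α x))

/-- The strong de Rham derivative `(dα)(x) : H → G ⊗ T_x^*M`, `ξ ↦ d(α(·)ξ)(x)`. -/
def strongDeRham (α : M → (H →L[ℂ] G)) (x : M) (ξ : H) : Cot N G :=
  deRham N (fun y => α y ξ) x

/-- The operator `T ⊗ 1 : H ⊗ T_x^*M → G ⊗ T_x^*M`. -/
def ampCot (T : H →L[ℂ] G) (η : Cot N H) : Cot N G := WithLp.toLp 2 (fun i => T (η i))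

/-- The operator `π(α)(x) = (α(x), 0; (dα)(x), α(x) ⊗ 1)` from `H ⊕ (H ⊗ T_x^*M)` to
`G ⊕ (G ⊗ T_x^*M)`. -/
def piOp (α : M → (H →L[ℂ] G)) (x : M) (v : Jet N H) : Jet N G :=
  WithLp.toLp 2 (α x v.fst, strongDeRham α x v.fst + ampCot (α x) v.snd)

variable (N) in
/-- The norm `‖α‖₁ = sup_x ‖π(α)(x)‖`. -/
def oneNorm (α : M → (H →L[ℂ] G)) : ℝ≥0∞ :=
  ⨆ (x : M) (v : Jet N H) (_ : ‖v‖ ≤ 1), ‖piOp α x v‖ₑ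

variable (N) in
/-- The quantity `sup_x (‖α(x)‖ + ‖(dα)(x)‖)`, with operator norms. -/
def supNorm (α : M → (H →L[ℂ] G)) : ℝ≥0∞ :=
  ⨆ x : M, (‖α x‖ₑ + ⨆ (ξ : H) (_ : ‖ξ‖ ≤ 1), ‖strongDeRham (N := N) α x ξ‖ₑ)

variable (N M H G) in
/-- The space `C¹_b(M, L(H, G))` of `*`-strongly differentiable maps `α : M → L(H, G)` with
`sup_x (‖α(x)‖ + ‖(dα)(x)‖) < ∞`. -/
def C1b [CompleteSpace H] [CompleteSpace G] : Type _ :=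
  {α : M → (H →L[ℂ] G) // StarStronglyDiff (N := N) α ∧ supNorm N α < ⊤}

end Manifold

end OpStarMod

end

/-! From symbols to morphisms. A strongly differentiable `α` need not be differentiable in operator
norm, but a uniform bound on `dα` makes it locally Lipschitz in operator norm, by the mean value
inequality in a chart. Hence `(x, ξ) ↦ α(x)ξ` has continuous partial derivatives, the product rule
holds, and the jet of `αs` at `x` is `π(α)(x)` applied to the jet of `s`
(`JetBoundedBy.contMDiff_apply`). Matrix norms are computed pointwise on jets, so the cb-norm is at
most `sup_x ‖π(α)(x)‖`. A bound on `dα` gives one on `dα*` by pairing a derivative of `α*η` with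
itself (`JetBoundedBy.adjoint`).

From morphisms to symbols. If `T` has an adjoint, testing `⟨Ts, t⟩ = ⟨s, T*t⟩` with `t = χ ·
(Ts)(x)` shows that `(Ts)(x)` depends only on `s(x)`, which yields `α(x)`; the symbol of `T*` is
then `α(x)*`. To bound `α` and `dα` at `x` by the norm of `T`, apply `T` to `χξ`, where `χ(x) = 1`,
`0 ≤ χ ≤ 1 + ε` and `|dχ| ≤ ε`. As `ε → 0` this bounds the first column `(α, dα)` of `π(α)(x)` by
the cb-norm; the second column `(0, α ⊗ 1)` has the same bound, whence the factor 2.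

Completeness of `M` enters through these cutoffs (`exists_cutoff`), obtained without smoothing the
distance function. Let `R(y)` be the supremum at `y` of all nonnegative compactly supported
`C¹`-functions with gradient at most 1 ("tents"). If `R` were finite somewhere, Ekeland's principle
would give a point `p` away from which `R` decreases at most at a small linear rate. A steeper cone
of gradient at most 1 around `p` could then be glued into a tent, giving a tent higher than `R(p)`
at `p`. So there are arbitrarily high tents, and rescaled and truncated ones are the cutoffs.

The standard module. Parseval's identity on jets makes the coordinate map isometric on matrices.
Coordinates of `s` form an element of the completion because the tail projections tend to zero
uniformly on the jets of `s`; surjectivity follows from completeness of `C¹₀(M, H)`. Conjugation by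
this unitary transports the bijection. -/

noncomputable section

set_option linter.unusedSectionVars false

namespace OpStarMod

/-! ### Derivatives in charts and in orthonormal frames -/

section Charts

variable {N : ℕ} {M : Type*} [TopologicalSpace M] [ChartedSpace (EuclideanSpace ℝ (Fin N)) M]
  [RiemannianBundle (fun x : M => TangentSpace (𝓡 N) x)]
  {E : Type*} [NormedAddCommGroup E] [InnerProductSpace ℂ E]

/-- Evaluation of a linear map on the orthonormal frame at `q`. -/
def frameVec {q : M} (L : TangentSpace (𝓡 N) q →L[ℝ] E) : Cot N E :=
  WithLp.toLp 2 (fun i => L (frame N q i))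

/-- Expand `v` in the orthonormal frame and apply Cauchy–Schwarz: the Hilbert–Schmidt norm dominates
the operator norm. -/
theorem norm_apply_le_frameVec {q : M} (L : TangentSpace (𝓡 N) q →L[ℝ] E)
    (v : TangentSpace (𝓡 N) q) : ‖L v‖ ≤ ‖v‖ * ‖frameVec L‖ := by
  have h : L v = ∑ i, (inner ℝ (frame N q i) v) • L (frame N q i) := by
    conv_lhs => rw [← (frame N q).sum_repr' v]
    rw [map_sum]
    exact Finset.sum_congr rfl fun i _ => by rw [map_smul]
  rw [h]
  refine (norm_sum_le _ _).trans ?_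
  simp_rw [norm_smul]
  refine (Real.sum_mul_le_sqrt_mul_sqrt _ _ _).trans (le_of_eq ?_)
  rw [PiLp.norm_eq_of_L2]
  congr 1
  rw [(frame N q).sum_sq_norm_inner_right v, Real.sqrt_sq (norm_nonneg _)]

/-- Converse comparison: `N` unit vectors, each contributing at most `C ^ 2`. -/
theorem frameVec_le_of_bound {q : M} (L : TangentSpace (𝓡 N) q →L[ℝ] E) {C : ℝ} (hC : 0 ≤ C)
    (h : ∀ v, ‖L v‖ ≤ C * ‖v‖) : ‖frameVec L‖ ≤ √N * C := by
  rw [PiLp.norm_eq_of_L2, Real.sqrt_le_left (by positivity), mul_pow, Real.sq_sqrt (by positivity)]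
  calc ∑ i, ‖frameVec L i‖ ^ 2 ≤ ∑ _i : Fin N, C ^ 2 := by
        refine Finset.sum_le_sum fun i _ => pow_le_pow_left₀ (norm_nonneg _) ?_ 2
        have := h (frame N q i)
        rwa [(frame N q).orthonormal.1 i, mul_one] at this
    _ = N * C ^ 2 := by simp

variable [IsManifold (𝓡 N) ∞ M]

/-- A function is differentiable on a manifold when its local expression is. -/
theorem hasMFDerivAt_of_chart {F : Type*} [NormedAddCommGroup F] [NormedSpace ℝ F] {p q : M}
    (hq : q ∈ (chartAt (EuclideanSpace ℝ (Fin N)) p).source) {f : M → F}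
    {L : EuclideanSpace ℝ (Fin N) →L[ℝ] F}
    (h : HasFDerivAt (f ∘ (extChartAt (𝓡 N) p).symm) L (extChartAt (𝓡 N) p q)) :
    HasMFDerivAt (𝓡 N) 𝓘(ℝ, F) f q
      (L.comp (mfderiv (𝓡 N) 𝓘(ℝ, EuclideanSpace ℝ (Fin N)) (extChartAt (𝓡 N) p) q)) := by
  have e2 := (mdifferentiableAt_extChartAt (I := 𝓡 N) (x := p) hq).hasMFDerivAt
  have hq' : q ∈ (extChartAt (𝓡 N) p).source := by rwa [extChartAt_source]
  refine (h.hasMFDerivAt.comp q e2).congr_of_eventuallyEq ?_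
  filter_upwards [(isOpen_extChartAt_source (I := 𝓡 N) p).mem_nhds hq'] with z hz
  exact congrArg f ((extChartAt (𝓡 N) p).left_inv hz).symm

theorem contDiffOn_chart {F : Type*} [NormedAddCommGroup F] [NormedSpace ℝ F] {f : M → F}
    (hf : ContMDiff (𝓡 N) 𝓘(ℝ, F) 1 f) (p : M) :
    ContDiffOn ℝ 1 (f ∘ (extChartAt (𝓡 N) p).symm) (extChartAt (𝓡 N) p).target := by
  rw [← contMDiffOn_iff_contDiffOn]
  exact hf.comp_contMDiffOn (contMDiffOn_extChartAt_symm p)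

theorem hasFDerivAt_chart {F : Type*} [NormedAddCommGroup F] [NormedSpace ℝ F] {f : M → F}
    (hf : ContMDiff (𝓡 N) 𝓘(ℝ, F) 1 f) {p : M} {z : EuclideanSpace ℝ (Fin N)}
    (hz : z ∈ (extChartAt (𝓡 N) p).target) :
    HasFDerivAt (f ∘ (extChartAt (𝓡 N) p).symm)
      (fderiv ℝ (f ∘ (extChartAt (𝓡 N) p).symm) z) z :=
  (((contDiffOn_chart hf p).contDiffAt ((isOpen_extChartAt_target p).mem_nhds hz)).differentiableAt
    one_ne_zero).hasFDerivAt

theorem contMDiffAt_of_chart {F : Type*} [NormedAddCommGroup F] [NormedSpace ℝ F] {f : M → F}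
    {p : M} (h : ContDiffAt ℝ 1 (f ∘ (extChartAt (𝓡 N) p).symm) (extChartAt (𝓡 N) p p)) :
    ContMDiffAt (𝓡 N) 𝓘(ℝ, F) 1 f p := by
  have h1 : ContMDiffAt (𝓡 N) 𝓘(ℝ, EuclideanSpace ℝ (Fin N)) 1 (extChartAt (𝓡 N) p) p :=
    contMDiffAt_extChartAt
  refine (h.contMDiffAt.comp p h1).congr_of_eventuallyEq ?_
  filter_upwards [extChartAt_source_mem_nhds (I := 𝓡 N) p] with z hz
  exact congrArg f ((extChartAt (𝓡 N) p).left_inv hz).symm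

theorem deRham_eq_chart {f : M → E} {p q : M}
    (hq : q ∈ (chartAt (EuclideanSpace ℝ (Fin N)) p).source)
    {L : EuclideanSpace ℝ (Fin N) →L[ℝ] E}
    (h : HasFDerivAt (f ∘ (extChartAt (𝓡 N) p).symm) L (extChartAt (𝓡 N) p q)) :
    deRham N f q = frameVec (q := q)
      (L.comp (mfderiv (𝓡 N) 𝓘(ℝ, EuclideanSpace ℝ (Fin N)) (extChartAt (𝓡 N) p) q)) :=
  deRham_eq (hasMFDerivAt_of_chart hq h)

variable [IsContMDiffRiemannianBundle (𝓡 N) ∞ (EuclideanSpace ℝ (Fin N))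
      (fun x : M => TangentSpace (𝓡 N) x)]

variable (N M) in
theorem isContinuousRiemannianBundle_tangent : IsContinuousRiemannianBundle (EuclideanSpace ℝ (Fin N))
      (fun x : M => TangentSpace (𝓡 N) x) := by
  obtain ⟨g, hg, hg'⟩ := IsContMDiffRiemannianBundle.exists_contMDiff (IB := 𝓡 N) (n := ∞)
      (F := EuclideanSpace ℝ (Fin N)) (E := fun x : M => TangentSpace (𝓡 N) x)
  exact ⟨g, hg.continuous, hg'⟩

variable (E) in
/-- In a chart, the derivative is comparable with its expression in the orthonormal frames. -/
theorem frameVec_comparable (p : M) : ∃ C : ℝ, 0 < C ∧ ∀ᶠ q in 𝓝 p,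
    q ∈ (chartAt (EuclideanSpace ℝ (Fin N)) p).source ∧
    ∀ L : EuclideanSpace ℝ (Fin N) →L[ℝ] E,
      ‖frameVec (q := q) (L.comp (mfderiv (𝓡 N) 𝓘(ℝ, EuclideanSpace ℝ (Fin N))
        (extChartAt (𝓡 N) p) q))‖ ≤ C * ‖L‖ ∧
      ‖L‖ ≤ C * ‖frameVec (q := q) (L.comp (mfderiv (𝓡 N) 𝓘(ℝ, EuclideanSpace ℝ (Fin N))
        (extChartAt (𝓡 N) p) q))‖ := by
  have := isContinuousRiemannianBundle_tangent N M
  obtain ⟨C, hC0, hC⟩ := eventually_norm_trivializationAt_lt (EuclideanSpace ℝ (Fin N))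
    (fun x : M => TangentSpace (𝓡 N) x) p
  obtain ⟨D, hD0, hD⟩ := eventually_norm_symmL_trivializationAt_lt (EuclideanSpace ℝ (Fin N))
    (fun x : M => TangentSpace (𝓡 N) x) p
  -- `C` bounds the trivialization and `D` its inverse near `p`; the sum serves both inequalities.
  refine ⟨√N * C + D, by positivity, ?_⟩
  filter_upwards [hC, hD, chart_source_mem_nhds (EuclideanSpace ℝ (Fin N)) p] with q h1 h2 hq
  refine ⟨hq, fun L => ⟨?_, ?_⟩⟩
  · rw [← TangentBundle.continuousLinearMapAt_trivializationAt hq]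
    refine (frameVec_le_of_bound (C := C * ‖L‖) _ (by positivity) fun v => ?_).trans ?_
    · refine (L.le_opNorm _).trans ?_
      have := ((trivializationAt (EuclideanSpace ℝ (Fin N)) (fun x : M => TangentSpace (𝓡 N) x)
        p).continuousLinearMapAt ℝ q).le_of_opNorm_le h1.le v
      calc _ ≤ ‖L‖ * (C * ‖v‖) := mul_le_mul_of_nonneg_left this (norm_nonneg _)
        _ = _ := by ring
    · nlinarith [norm_nonneg L, mul_nonneg hD0.le (norm_nonneg L)]
  · rw [← TangentBundle.continuousLinearMapAt_trivializationAt hq]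
    set T := trivializationAt (EuclideanSpace ℝ (Fin N)) (fun x : M => TangentSpace (𝓡 N) x) p
    set V := ‖frameVec (q := q) (L.comp (T.continuousLinearMapAt ℝ q))‖ with hV
    have hV0 : 0 ≤ V := norm_nonneg _
    refine L.opNorm_le_bound (by positivity) fun v => ?_
    have hb : q ∈ T.baseSet := by
      simpa [T, TangentBundle.trivializationAt_baseSet] using hq
    have e1 : T.continuousLinearMapAt ℝ q (T.symmL ℝ q v) = v :=
      T.continuousLinearMapAt_symmL hb v
    have e2 := norm_apply_le_frameVec (q := q) (L.comp (T.continuousLinearMapAt ℝ q))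
      (T.symmL ℝ q v)
    have e3 : ‖T.symmL ℝ q v‖ ≤ D * ‖v‖ := (T.symmL ℝ q).le_of_opNorm_le h2.le v
    have e4 : (L.comp (T.continuousLinearMapAt ℝ q)) (T.symmL ℝ q v) = L v := congrArg L e1
    rw [e4] at e2
    calc ‖L v‖ ≤ ‖T.symmL ℝ q v‖ * V := e2
      _ ≤ (D * ‖v‖) * V := mul_le_mul_of_nonneg_right e3 hV0
      _ ≤ _ := by
        have : 0 ≤ √N * C * (‖v‖ * V) := by positivity
        nlinarith

end Charts

end OpStarMod

namespace OpStarMod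

/-! ### Operator norms of matrices over Hilbert spaces -/

section Homogeneity

variable {V W : Type*} [NormedAddCommGroup V] [InnerProductSpace ℂ V]
  [NormedAddCommGroup W] [InnerProductSpace ℂ W]

/-- Normalise `v`. Continuity of `p` is not assumed and the supremum may be infinite, so `v = 0` is
treated apart. -/
theorem enorm_le_iSup_mul (p : V →ₗ[ℂ] W) (v : V) :
    ‖p v‖ₑ ≤ (⨆ (u : V) (_ : ‖u‖ ≤ 1), ‖p u‖ₑ) * ‖v‖ₑ := by
  by_cases hv : v = 0
  · simp [hv]
  have hn : ‖v‖ ≠ 0 := by simpa using hv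
  have hc : ((‖v‖ : ℂ)) ≠ 0 := by exact_mod_cast hn
  set u : V := (‖v‖ : ℂ)⁻¹ • v with hu
  have hu1 : ‖u‖ ≤ 1 := by
    rw [hu, norm_smul, norm_inv, Complex.norm_real, norm_norm, inv_mul_cancel₀ hn]
  have hv' : v = (‖v‖ : ℂ) • u := by rw [hu, smul_smul, mul_inv_cancel₀ hc, one_smul]
  have h1 : ‖p v‖ₑ = ‖v‖ₑ * ‖p u‖ₑ := by
    conv_lhs => rw [hv', map_smul, enorm_smul]
    congr 1
    rw [← ofReal_norm, ← ofReal_norm, Complex.norm_real, norm_norm]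
  rw [h1, mul_comm]
  gcongr
  exact le_iSup₂ (f := fun (u : V) (_ : ‖u‖ ≤ 1) => ‖p u‖ₑ) u hu1

theorem matOp_map {ι κ : Type} [Fintype ι] [Fintype κ] (T : V →ₗ[ℂ] W) (ξ : Matrix ι κ V)
    (v : EuclideanSpace ℂ κ) :
    matOp (ξ.map T) v = WithLp.toLp 2 (fun i => T (matOp ξ v i)) := by
  ext i
  simp [matOp, map_sum]

/-- Applying `T` to every entry composes the matrix operator with the diagonal operator `T ⊕ ⋯ ⊕ T`,
so the constant does not grow with the size of the matrix. This is why pointwise bounds on jets are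
complete bounds. -/
theorem vecNorm_map_le {ι κ : Type} [Fintype ι] [Fintype κ] (T : V →ₗ[ℂ] W) {C : ℝ} (hC : 0 ≤ C)
    (hT : ∀ v, ‖T v‖ ≤ C * ‖v‖) (ξ : Matrix ι κ V) :
    vecNorm (ξ.map T) ≤ ENNReal.ofReal C * vecNorm ξ := by
  refine iSup₂_le fun v hv => ?_
  have h1 : ‖matOp (ξ.map T) v‖ ≤ C * ‖matOp ξ v‖ := by
    rw [matOp_map, PiLp.norm_eq_of_L2, PiLp.norm_eq_of_L2]
    nth_rewrite 1 [← Real.sqrt_sq hC]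
    rw [← Real.sqrt_mul (by positivity)]
    refine Real.sqrt_le_sqrt ?_
    rw [Finset.mul_sum]
    refine Finset.sum_le_sum fun k _ => ?_
    rw [← mul_pow]
    exact pow_le_pow_left₀ (norm_nonneg _) (hT _) 2
  calc ‖matOp (ξ.map T) v‖ₑ = ENNReal.ofReal ‖matOp (ξ.map T) v‖ := (ofReal_norm _).symm
    _ ≤ ENNReal.ofReal (C * ‖matOp ξ v‖) := ENNReal.ofReal_le_ofReal h1
    _ = ENNReal.ofReal C * ‖matOp ξ v‖ₑ := by rw [ENNReal.ofReal_mul hC, ofReal_norm]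
    _ ≤ ENNReal.ofReal C * vecNorm ξ := by
      gcongr
      exact le_iSup₂ (f := fun (v : EuclideanSpace ℂ κ) (_ : ‖v‖ ≤ 1) => ‖matOp ξ v‖ₑ) v hv

theorem matOp_unique {ι κ : Type} [Fintype ι] [Fintype κ] [Unique ι] [Unique κ]
    (ξ : Matrix ι κ V) (v : EuclideanSpace ℂ κ) :
    ‖matOp ξ v‖ = ‖v‖ * ‖ξ default default‖ := by
  rw [PiLp.norm_eq_of_L2, EuclideanSpace.norm_eq]
  simp only [matOp, Fintype.sum_unique, norm_smul]
  rw [Real.sqrt_sq (by positivity), Real.sqrt_sq (norm_nonneg _)]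

theorem vecNorm_unique {ι κ : Type} [Fintype ι] [Fintype κ] [Unique ι] [Unique κ]
    (ξ : Matrix ι κ V) : vecNorm ξ = ‖ξ default default‖ₑ := by
  have key : ∀ v : EuclideanSpace ℂ κ, ‖matOp ξ v‖ₑ = ‖v‖ₑ * ‖ξ default default‖ₑ := fun v => by
    rw [← ofReal_norm, matOp_unique, ENNReal.ofReal_mul (norm_nonneg _), ofReal_norm, ofReal_norm]
  refine le_antisymm (iSup₂_le fun v hv => ?_) ?_
  · rw [key]
    refine mul_le_of_le_one_left zero_le ?_
    rw [← ofReal_norm]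
    exact ENNReal.ofReal_le_one.2 hv
  · classical
    have h1 : ‖(EuclideanSpace.single default 1 : EuclideanSpace ℂ κ)‖ = 1 := by simp
    refine le_trans (le_of_eq ?_) (le_iSup₂
      (f := fun (v : EuclideanSpace ℂ κ) (_ : ‖v‖ ≤ 1) => ‖matOp ξ v‖ₑ)
      (EuclideanSpace.single default 1) h1.le)
    rw [key, ← ofReal_norm (EuclideanSpace.single _ _), h1]
    simp

theorem prodLp_norm_le (v : WithLp 2 (V × W)) : ‖v‖ ≤ ‖v.fst‖ + ‖v.snd‖ := by
  rw [WithLp.prod_norm_eq_of_L2, Real.sqrt_le_left (by positivity)]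
  nlinarith [norm_nonneg v.fst, norm_nonneg v.snd]

end Homogeneity

/-! ### Multiplication by a bounded strongly differentiable symbol -/

section Multiplication

variable {N : ℕ} {M : Type*} [TopologicalSpace M] [ChartedSpace (EuclideanSpace ℝ (Fin N)) M]
  [RiemannianBundle (fun x : M => TangentSpace (𝓡 N) x)]
  {H G : Type*} [NormedAddCommGroup H] [InnerProductSpace ℂ H]
  [NormedAddCommGroup G] [InnerProductSpace ℂ G]

/-- The strong derivative at `x`, as a linear map. -/
def strongDeRhamLin {α : M → (H →L[ℂ] G)} (hα : StronglyDiff (N := N) α) (x : M) :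
    H →ₗ[ℂ] Cot N G where
  toFun := strongDeRham α x
  map_add' ξ η := by
    have h := deRham_add (hα ξ) (hα η) x
    simpa [strongDeRham, Pi.add_def] using h
  map_smul' c ξ := by
    have h := deRham_const_smul c (hα ξ) x
    simpa [strongDeRham, Pi.smul_def] using h

/-- The operator `T ⊗ 1` as a linear map. -/
def ampCotLin (T : H →L[ℂ] G) : Cot N H →ₗ[ℂ] Cot N G where
  toFun := ampCot T
  map_add' ξ η := by ext i; simp [ampCot]
  map_smul' c ξ := by ext i; simp [ampCot]

theorem norm_ampCot_le (T : H →L[ℂ] G) {K : ℝ} (hK : 0 ≤ K) (hT : ∀ ξ, ‖T ξ‖ ≤ K * ‖ξ‖)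
    (η : Cot N H) : ‖ampCot T η‖ ≤ K * ‖η‖ := by
  rw [PiLp.norm_eq_of_L2, PiLp.norm_eq_of_L2]
  nth_rewrite 1 [← Real.sqrt_sq hK]
  rw [← Real.sqrt_mul (by positivity)]
  refine Real.sqrt_le_sqrt ?_
  rw [Finset.mul_sum]
  refine Finset.sum_le_sum fun k _ => ?_
  rw [← mul_pow]
  exact pow_le_pow_left₀ (norm_nonneg _) (hT _) 2

/-- The operator `π(α)(x)` as a linear map. -/
def piLin {α : M → (H →L[ℂ] G)} (hα : StronglyDiff (N := N) α) (x : M) :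
    Jet N H →ₗ[ℂ] Jet N G where
  toFun := piOp α x
  map_add' u v := by
    have h1 := (strongDeRhamLin hα x).map_add u.fst v.fst
    have h2 := (ampCotLin (N := N) (α x)).map_add u.snd v.snd
    change strongDeRham α x (u.fst + v.fst) = strongDeRham α x u.fst + strongDeRham α x v.fst at h1
    change ampCot (α x) (u.snd + v.snd) = ampCot (α x) u.snd + ampCot (α x) v.snd at h2
    have h3 : α x (u.fst + v.fst) = α x u.fst + α x v.fst := map_add _ _ _
    simp only [piOp, WithLp.add_fst, WithLp.add_snd]
    rw [h1, h2, h3, add_add_add_comm]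
    rfl
  map_smul' c v := by
    have h1 := (strongDeRhamLin hα x).map_smul c v.fst
    have h2 := (ampCotLin (N := N) (α x)).map_smul c v.snd
    change strongDeRham α x (c • v.fst) = c • strongDeRham α x v.fst at h1
    change ampCot (α x) (c • v.snd) = c • ampCot (α x) v.snd at h2
    have h3 : α x (c • v.fst) = c • α x v.fst := map_smul _ _ _
    simp only [piOp, WithLp.smul_fst, WithLp.smul_snd]
    rw [h1, h2, h3, ← smul_add]
    rfl

/-- `α` and its strong derivative are bounded by `K`, uniformly on `M`. -/
def JetBoundedBy (N : ℕ) {M : Type*} [TopologicalSpace M]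
    [ChartedSpace (EuclideanSpace ℝ (Fin N)) M]
    [RiemannianBundle (fun x : M => TangentSpace (𝓡 N) x)] {H G : Type*} [NormedAddCommGroup H]
    [InnerProductSpace ℂ H] [NormedAddCommGroup G] [InnerProductSpace ℂ G]
    (α : M → (H →L[ℂ] G)) (K : ℝ) : Prop :=
  0 ≤ K ∧ ∀ x ξ, ‖α x ξ‖ ≤ K * ‖ξ‖ ∧ ‖strongDeRham (N := N) α x ξ‖ ≤ K * ‖ξ‖

theorem norm_le_mul_of_enorm_le {V W : Type*} [NormedAddCommGroup V] [NormedAddCommGroup W]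
    {v : V} {w : W} {C : ℝ≥0∞} (hC : C ≠ ⊤) (h : ‖w‖ₑ ≤ C * ‖v‖ₑ) : ‖w‖ ≤ C.toReal * ‖v‖ := by
  rw [← toReal_enorm, ← toReal_enorm, ← ENNReal.toReal_mul]
  exact ENNReal.toReal_mono (ENNReal.mul_ne_top hC enorm_ne_top) h

theorem exists_jetBoundedBy_of_supNorm {α : M → (H →L[ℂ] G)} (hα : StronglyDiff (N := N) α)
    (h : supNorm N α < ⊤) : ∃ K, JetBoundedBy N α K := by
  refine ⟨(supNorm N α).toReal, ENNReal.toReal_nonneg, fun x ξ => ?_⟩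
  have hx := le_iSup (fun x : M => (‖α x‖ₑ + ⨆ (ξ : H) (_ : ‖ξ‖ ≤ 1),
    ‖strongDeRham (N := N) α x ξ‖ₑ)) x
  change _ ≤ supNorm N α at hx
  constructor <;> refine norm_le_mul_of_enorm_le h.ne ?_
  · refine ((α x).le_opENorm ξ).trans ?_
    gcongr
    exact le_self_add.trans hx
  · refine (enorm_le_iSup_mul (strongDeRhamLin hα x) ξ).trans ?_
    gcongr
    exact le_add_self.trans hx

theorem JetBoundedBy.supNorm_lt_top {α : M → (H →L[ℂ] G)} {K : ℝ} (h : JetBoundedBy N α K) :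
    supNorm N α < ⊤ := by
  refine lt_of_le_of_lt (b := ENNReal.ofReal K + ENNReal.ofReal K) (iSup_le fun x => ?_)
    (by simp)
  refine add_le_add ?_ (iSup₂_le fun ξ hξ => ?_)
  · rw [← ofReal_norm]
    exact ENNReal.ofReal_le_ofReal ((α x).opNorm_le_bound h.1 fun ξ => (h.2 x ξ).1)
  · rw [← ofReal_norm]
    exact ENNReal.ofReal_le_ofReal ((h.2 x ξ).2.trans (mul_le_of_le_one_right h.1 hξ))

/-- Each of the three nonzero entries of the triangular matrix contributes at most `K * ‖v‖`. -/
theorem norm_piOp_le {α : M → (H →L[ℂ] G)} {x : M} {K : ℝ} (hK : 0 ≤ K)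
    (h : ∀ ξ, ‖α x ξ‖ ≤ K * ‖ξ‖ ∧ ‖strongDeRham (N := N) α x ξ‖ ≤ K * ‖ξ‖) (v : Jet N H) :
    ‖piOp α x v‖ ≤ 3 * K * ‖v‖ := by
  have h1 := prodLp_norm_le (piOp α x v)
  have h2 := norm_add_le (strongDeRham (N := N) α x v.fst) (ampCot (α x) v.snd)
  have h3 := norm_ampCot_le (N := N) (α x) hK (fun ξ => (h ξ).1) v.snd
  have h4 := h v.fst
  have h5 := mul_le_mul_of_nonneg_left (WithLp.norm_fst_le _ v) hK
  have h6 := mul_le_mul_of_nonneg_left (WithLp.norm_snd_le _ v) hK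
  change _ ≤ ‖α x v.fst‖ + ‖strongDeRham (N := N) α x v.fst + ampCot (α x) v.snd‖ at h1
  linarith

theorem JetBoundedBy.oneNorm_lt_top {α : M → (H →L[ℂ] G)} {K : ℝ} (h : JetBoundedBy N α K) :
    oneNorm N α < ⊤ := by
  refine lt_of_le_of_lt (b := ENNReal.ofReal (3 * K))
    (iSup_le fun x => iSup₂_le fun v hv => ?_) ENNReal.ofReal_lt_top
  rw [← ofReal_norm]
  have := h.1
  exact ENNReal.ofReal_le_ofReal ((norm_piOp_le h.1 (h.2 x) v).trans
    (mul_le_of_le_one_right (by positivity) hv))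

theorem enorm_piOp_le {α : M → (H →L[ℂ] G)} (hα : StronglyDiff (N := N) α) (x : M) (v : Jet N H) :
    ‖piOp α x v‖ₑ ≤ oneNorm N α * ‖v‖ₑ := by
  refine (enorm_le_iSup_mul (piLin hα x) v).trans ?_
  gcongr
  exact le_iSup (fun x : M => ⨆ (v : Jet N H) (_ : ‖v‖ ≤ 1), ‖piOp α x v‖ₑ) x

theorem piOp_inl {α : M → (H →L[ℂ] G)} (x : M) (ξ : H) :
    piOp α x (WithLp.toLp 2 (ξ, (0 : Cot N H))) = jet N (fun y => α y ξ) x := by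
  have : ampCot (α x) (0 : Cot N H) = 0 := (ampCotLin (N := N) (α x)).map_zero
  simp [piOp, jet, strongDeRham, this]

/-- The restriction of `π(α)(x)` to `H ⊕ 0` is the column `(α(x), dα(x))`, so its norm controls
both. -/
theorem exists_jetBoundedBy_of_oneNorm {α : M → (H →L[ℂ] G)} (hα : StronglyDiff (N := N) α)
    (h : oneNorm N α < ⊤) : ∃ K, JetBoundedBy N α K := by
  refine ⟨(oneNorm N α).toReal, ENNReal.toReal_nonneg, fun x ξ => ?_⟩
  have h1 := norm_le_mul_of_enorm_le h.ne (enorm_piOp_le hα x (WithLp.toLp 2 (ξ, (0 : Cot N H))))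
  rw [piOp_inl] at h1
  have h2 : ‖(WithLp.toLp 2 (ξ, (0 : Cot N H)) : Jet N H)‖ = ‖ξ‖ := by
    rw [WithLp.prod_norm_eq_of_L2]
    simp
  rw [h2] at h1
  exact ⟨(WithLp.norm_fst_le _ (jet N (fun y => α y ξ) x)).trans h1,
    (WithLp.norm_snd_le _ (jet N (fun y => α y ξ) x)).trans h1⟩

theorem supNorm_lt_top_iff_oneNorm_lt_top {α : M → (H →L[ℂ] G)}
    (hα : StronglyDiff (N := N) α) : supNorm N α < ⊤ ↔ oneNorm N α < ⊤ :=
  ⟨fun h => (exists_jetBoundedBy_of_supNorm hα h).elim fun _ hK => hK.oneNorm_lt_top,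
    fun h => (exists_jetBoundedBy_of_oneNorm hα h).elim fun _ hK => hK.supNorm_lt_top⟩

variable [IsManifold (𝓡 N) ∞ M]

theorem hasMFDerivAt_clm_comp {E F : Type*} [NormedAddCommGroup E] [NormedSpace ℝ E]
    [NormedAddCommGroup F] [NormedSpace ℝ F] (L : E →L[ℝ] F) {f : M → E}
    (hf : ContMDiff (𝓡 N) 𝓘(ℝ, E) 1 f) (x : M) :
    HasMFDerivAt (𝓡 N) 𝓘(ℝ, F) (fun y => L (f y)) x
      (L.comp (show TangentSpace (𝓡 N) x →L[ℝ] E from mfderiv (𝓡 N) 𝓘(ℝ, E) f x)) :=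
  L.hasMFDerivAt.comp x (hf.mdifferentiableAt one_ne_zero).hasMFDerivAt

variable [IsContMDiffRiemannianBundle (𝓡 N) ∞ (EuclideanSpace ℝ (Fin N))
      (fun x : M => TangentSpace (𝓡 N) x)]

/-- The local expression of `(y, ξ) ↦ α(y) ξ` is `C¹` in both variables. -/
theorem JetBoundedBy.contDiffAt_apply {α : M → (H →L[ℂ] G)} (hα : StronglyDiff (N := N) α)
    {K : ℝ} (hK : JetBoundedBy N α K) (p : M) (ξ : H) :
    ContDiffAt ℝ 1 (fun u : EuclideanSpace ℝ (Fin N) × H => α ((extChartAt (𝓡 N) p).symm u.1) u.2)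
      (extChartAt (𝓡 N) p p, ξ) ∧
    HasFDerivAt (fun u : EuclideanSpace ℝ (Fin N) × H => α ((extChartAt (𝓡 N) p).symm u.1) u.2)
      ((fderiv ℝ ((fun y => α y ξ) ∘ (extChartAt (𝓡 N) p).symm) (extChartAt (𝓡 N) p p)).coprod
        ((α p).restrictScalars ℝ)) (extChartAt (𝓡 N) p p, ξ) := by
  set φ := extChartAt (𝓡 N) p with hφ
  obtain ⟨C, hC0, hC⟩ := frameVec_comparable (N := N) G p
  have hopen : IsOpen φ.target := isOpen_extChartAt_target p
  -- The bound on `dα` in the frames becomes a bound on the chart derivative, uniform in `z` near `φ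
  -- p` and linear in `‖η‖`.
  have h1 : ∀ᶠ z in 𝓝 (φ p), z ∈ φ.target ∧
      ∀ η : H, ‖fderiv ℝ ((fun y => α y η) ∘ φ.symm) z‖ ≤ C * K * ‖η‖ := by
    have hcont : Tendsto φ.symm (𝓝 (φ p)) (𝓝 p) := by
      have := continuousAt_extChartAt_symm (I := 𝓡 N) p
      rwa [ContinuousAt, extChartAt_to_inv] at this
    filter_upwards [hcont.eventually hC, hopen.mem_nhds (mem_extChartAt_target p)] with z hz hzt
    refine ⟨hzt, fun η => ?_⟩
    have e := (hz.2 (fderiv ℝ ((fun y => α y η) ∘ φ.symm) z)).2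
    have hd := hasFDerivAt_chart (hα η) hzt
    have e2 := deRham_eq_chart (N := N) hz.1 (f := fun y => α y η)
      (L := fderiv ℝ ((fun y => α y η) ∘ φ.symm) z) (by rwa [φ.right_inv hzt])
    rw [← e2] at e
    refine e.trans ?_
    rw [mul_assoc]
    exact mul_le_mul_of_nonneg_left (hK.2 _ η).2 hC0.le
  obtain ⟨r, hr, hball⟩ := Metric.eventually_nhds_iff_ball.1 h1
  set U := Metric.ball (φ p) r with hU
  set f₁ : EuclideanSpace ℝ (Fin N) → H → (EuclideanSpace ℝ (Fin N) →L[ℝ] G) :=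
    fun z η => fderiv ℝ ((fun y => α y η) ∘ φ.symm) z with hf₁
  have hd : ∀ z ∈ U, ∀ η, HasFDerivAt ((fun y => α y η) ∘ φ.symm) (f₁ z η) z := fun z hz η =>
    hasFDerivAt_chart (hα η) (hball z hz).1
  -- `f₁ z` is not a bundled linear map; additivity comes from uniqueness of derivatives.
  have hsub : ∀ z ∈ U, ∀ η η', f₁ z η - f₁ z η' = f₁ z (η - η') := by
    intro z hz η η'
    have e := ((hd z hz η).sub (hd z hz η')).unique (f₁' := f₁ z (η - η')) ?_
    · exact e
    · refine (hd z hz (η - η')).congr_of_eventuallyEq (Eventually.of_forall fun w => ?_)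
      simp
  -- The mean value inequality on the convex ball, applied to each `α(·)η`, turns strong
  -- differentiability into operator norm continuity.
  have hlip : ∀ z ∈ U, ∀ w ∈ U, ‖α (φ.symm z) - α (φ.symm w)‖ ≤ C * K * ‖z - w‖ := by
    intro z hz w hw
    have hK0 := hK.1
    refine ContinuousLinearMap.opNorm_le_bound _ (by positivity) fun η => ?_
    have := (convex_ball (φ p) r).norm_image_sub_le_of_norm_hasFDerivWithin_le
      (f := (fun y => α y η) ∘ φ.symm) (f' := fun z => f₁ z η) (C := C * K * ‖η‖)
      (fun u hu => (hd u hu η).hasFDerivWithinAt) (fun u hu => (hball u hu).2 η) hw hz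
    calc _ ≤ C * K * ‖η‖ * ‖z - w‖ := this
      _ = _ := by ring
  -- Joint continuity: split `u.2 = η + (u.2 - η)`. The first term is continuous in `u.1` because
  -- `α(·)η` is `C¹`, the second is at most `C * K * ‖u.2 - η‖`.
  have cf₁ : ∀ u : EuclideanSpace ℝ (Fin N) × H, u.1 ∈ U → ContinuousAt ↿f₁ u := by
    rintro ⟨z, η⟩ hz
    have c1 : ContinuousAt (fun z => f₁ z η) z :=
      ((contDiffOn_chart (hα η) p).continuousOn_fderiv_of_isOpen hopen le_rfl).continuousAt
        (hopen.mem_nhds (hball z hz).1)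
    have c2 : Tendsto (fun u : EuclideanSpace ℝ (Fin N) × H => f₁ u.1 (u.2 - η)) (𝓝 (z, η))
        (𝓝 0) := by
      refine squeeze_zero_norm' (a := fun u => C * K * ‖u.2 - η‖) ?_ ?_
      · have : ∀ᶠ u : EuclideanSpace ℝ (Fin N) × H in 𝓝 (z, η), u.1 ∈ U :=
          continuousAt_fst.eventually (Metric.isOpen_ball.mem_nhds hz)
        filter_upwards [this] with u hu
        exact (hball _ hu).2 _
      · have : Continuous fun u : EuclideanSpace ℝ (Fin N) × H => C * K * ‖u.2 - η‖ := by fun_prop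
        simpa using this.tendsto (z, η)
    have c3 : Tendsto (fun u : EuclideanSpace ℝ (Fin N) × H => f₁ u.1 η) (𝓝 (z, η))
        (𝓝 (f₁ z η)) := Tendsto.comp (g := fun z => f₁ z η) c1 continuousAt_fst
    have c4 := c3.add c2
    rw [add_zero] at c4
    refine c4.congr' ?_
    have : ∀ᶠ u : EuclideanSpace ℝ (Fin N) × H in 𝓝 (z, η), u.1 ∈ U :=
      continuousAt_fst.eventually (Metric.isOpen_ball.mem_nhds hz)
    filter_upwards [this] with u hu
    rw [← hsub _ hu]
    simp [Function.HasUncurry.uncurry]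
  set f₂ : EuclideanSpace ℝ (Fin N) → H → (H →L[ℝ] G) :=
    fun z _ => (α (φ.symm z)).restrictScalars ℝ with hf₂
  have cf₂ : ∀ u : EuclideanSpace ℝ (Fin N) × H, u.1 ∈ U → ContinuousAt ↿f₂ u := by
    rintro ⟨z, η⟩ hz
    have c1 : ContinuousAt (fun z => α (φ.symm z)) z := by
      rw [ContinuousAt, tendsto_iff_norm_sub_tendsto_zero]
      refine squeeze_zero' (g := fun w => C * K * ‖w - z‖) (Eventually.of_forall fun _ =>
        norm_nonneg _) ?_ ?_
      · filter_upwards [Metric.isOpen_ball.mem_nhds hz] with w hw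
        exact hlip w hw z hz
      · have : Continuous fun w : EuclideanSpace ℝ (Fin N) => C * K * ‖w - z‖ := by fun_prop
        simpa using this.tendsto z
    have c2 : ContinuousAt (fun z => (α (φ.symm z)).restrictScalars ℝ) z :=
      (ContinuousLinearMap.continuous_restrictScalars ℝ).continuousAt.comp c1
    exact Tendsto.comp (g := fun z => (α (φ.symm z)).restrictScalars ℝ) c2 continuousAt_fst
  have hUev : ∀ u : EuclideanSpace ℝ (Fin N) × H, u.1 ∈ U →
      ∀ᶠ v in 𝓝 u, v.1 ∈ U := fun u hu =>
    continuousAt_fst.eventually (Metric.isOpen_ball.mem_nhds hu)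
  have hstrict : ∀ u : EuclideanSpace ℝ (Fin N) × H, u.1 ∈ U →
      HasFDerivAt (fun u : EuclideanSpace ℝ (Fin N) × H => α (φ.symm u.1) u.2)
        ((↿f₁ u).coprod (↿f₂ u)) u := by
    intro u hu
    -- Continuous partial derivatives imply total differentiability; `f₁` is the partial derivative
    -- in the chart variable, `f₂` the one in `H`.
    refine (hasStrictFDerivAt_uncurry_coprod (f := fun z η => α (φ.symm z) η) (f₁ := f₁) (f₂ := f₂)
      ?_ ?_ (cf₁ u hu) (cf₂ u hu)).hasFDerivAt
    · filter_upwards [hUev u hu] with v hv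
      exact hd _ hv _
    · refine Eventually.of_forall fun v => ?_
      exact ((α (φ.symm v.1)).restrictScalars ℝ).hasFDerivAt
  have hpU : φ p ∈ U := Metric.mem_ball_self hr
  constructor
  · rw [contDiffAt_one_iff]
    refine ⟨fun u => (↿f₁ u).coprod (↿f₂ u), {u | u.1 ∈ U}, hUev (φ p, ξ) hpU, ?_,
      fun u hu => hstrict u hu⟩
    intro u hu
    refine ContinuousAt.continuousWithinAt ?_
    have e : (fun u => (↿f₁ u).coprod (↿f₂ u)) = fun u : EuclideanSpace ℝ (Fin N) × H =>
      (↿f₁ u).comp (ContinuousLinearMap.fst ℝ _ _) + (↿f₂ u).comp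
        (ContinuousLinearMap.snd ℝ _ _) := by
      funext u
      exact ContinuousLinearMap.ext fun w => rfl
    rw [e]
    exact ((cf₁ u hu).clm_comp continuousAt_const).add ((cf₂ u hu).clm_comp continuousAt_const)
  · have := hstrict (φ p, ξ) hpU
    have e : f₂ (φ p) ξ = (α p).restrictScalars ℝ := by
      simp only [f₂, hφ, extChartAt_to_inv]
    change HasFDerivAt _ ((f₁ (φ p) ξ).coprod (f₂ (φ p) ξ)) _ at this
    rwa [e] at this

/-- The product `x ↦ α(x) s(x)` is `C¹`, with the derivative `dα s + (α ⊗ 1) ds`. -/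
theorem JetBoundedBy.contMDiff_apply {α : M → (H →L[ℂ] G)} (hα : StronglyDiff (N := N) α)
    {K : ℝ} (hK : JetBoundedBy N α K) {s : M → H} (hs : ContMDiff (𝓡 N) 𝓘(ℝ, H) 1 s) :
    ContMDiff (𝓡 N) 𝓘(ℝ, G) 1 (fun x => α x (s x)) ∧
    ∀ x, jet N (fun x => α x (s x)) x = piOp α x (jet N s x) := by
  have main : ∀ p : M, ContDiffAt ℝ 1 ((fun x => α x (s x)) ∘ (extChartAt (𝓡 N) p).symm)
        (extChartAt (𝓡 N) p p) ∧
      jet N (fun x => α x (s x)) p = piOp α p (jet N s p) := by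
    intro p
    obtain ⟨c1, c2⟩ := hK.contDiffAt_apply hα p (s p)
    set φ := extChartAt (𝓡 N) p with hφ
    have hp : φ p ∈ φ.target := mem_extChartAt_target p
    have hsd : ContDiffAt ℝ 1 (s ∘ φ.symm) (φ p) :=
      (contDiffOn_chart hs p).contDiffAt ((isOpen_extChartAt_target p).mem_nhds hp)
    have hinv : φ.symm (φ p) = p := extChartAt_to_inv p
    constructor
    -- In the chart, `αs` is the joint map composed with the graph `z ↦ (z, s(z))`; the chain rule
    -- then gives the product rule.
    · have : ContDiffAt ℝ 1 (fun z => (z, (s ∘ φ.symm) z)) (φ p) := contDiffAt_id.prodMk hsd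
      refine ContDiffAt.comp (φ p) (g := fun u : EuclideanSpace ℝ (Fin N) × H =>
        α (φ.symm u.1) u.2) ?_ this
      simpa [hinv] using c1
    · have e1 := hasFDerivAt_chart hs hp
      have e2 : HasFDerivAt (fun z => (z, (s ∘ φ.symm) z)) _ (φ p) := (hasFDerivAt_id _).prodMk e1
      have e3 := HasFDerivAt.comp (φ p) (g := fun u : EuclideanSpace ℝ (Fin N) × H =>
        α (φ.symm u.1) u.2) (by simpa [hinv] using c2) e2
      have hq := mem_chart_source (EuclideanSpace ℝ (Fin N)) p
      have d1 := deRham_eq_chart (f := fun x => α x (s x)) hq e3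
      have d2 := deRham_eq_chart hq e1
      have d3 := deRham_eq_chart hq (hasFDerivAt_chart (hα (s p)) hp)
      change WithLp.toLp 2 (α p (s p), deRham N (fun x => α x (s x)) p) =
        WithLp.toLp 2 (α p (s p), deRham N (fun x => α x (s p)) p + ampCot (α p) (deRham N s p))
      rw [d1, d2, d3]
      congr 2
  refine ⟨fun p => contMDiffAt_of_chart (main p).1, fun p => (main p).2⟩

theorem JetBoundedBy.apply_mem_C10 {α : M → (H →L[ℂ] G)} (hα : StronglyDiff (N := N) α)
    {K : ℝ} (hK : JetBoundedBy N α K) (s : C10 N M H) : (fun x => α x (s.1 x)) ∈ C10 N M G := by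
  obtain ⟨h1, h2⟩ := hK.contMDiff_apply hα s.2.1
  refine ⟨h1, fun ε hε => ?_⟩
  have hK0 := hK.1
  -- The value and the derivative of `αs` each cost `3 * K` times the jet of `s`; the `+ 1` keeps
  -- the denominator positive when `K = 0`.
  obtain ⟨L, hL, h3⟩ := s.2.2 (ε / (6 * K + 1)) (by positivity)
  refine ⟨L, hL, fun x hx => ?_⟩
  have h4 := h3 x hx
  have h5 := norm_piOp_le hK.1 (hK.2 x) (jet N s.1 x)
  rw [← h2] at h5
  have h6 := WithLp.norm_fst_le _ (jet N (fun x => α x (s.1 x)) x)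
  have h7 := WithLp.norm_snd_le _ (jet N (fun x => α x (s.1 x)) x)
  have h8 := prodLp_norm_le (jet N s.1 x)
  change ‖α x (s.1 x)‖ ≤ _ at h6
  change ‖deRham N (fun x => α x (s.1 x)) x‖ ≤ _ at h7
  change _ ≤ ‖s.1 x‖ + ‖deRham N s.1 x‖ at h8
  rw [lt_div_iff₀ (by positivity)] at h4
  have h9 := mul_le_mul_of_nonneg_left h8 hK.1
  nlinarith [norm_nonneg (s.1 x), norm_nonneg (deRham N s.1 x)]

/-- The operator of pointwise multiplication by `α`. -/
def JetBoundedBy.mulOp {α : M → (H →L[ℂ] G)} (hα : StronglyDiff (N := N) α)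
    {K : ℝ} (hK : JetBoundedBy N α K) : C10 N M H →ₗ[ℂ] C10 N M G where
  toFun s := ⟨fun x => α x (s.1 x), hK.apply_mem_C10 hα s⟩
  map_add' s t := by ext x; simp
  map_smul' c s := by ext x; simp

/-- On jets at `x` the multiplication operator is `π(α)(x)`, so `vecNorm_map_le` applies at each
point with the constant `oneNorm N α`. -/
theorem JetBoundedBy.cbNorm_mulOp_le {α : M → (H →L[ℂ] G)} (hα : StronglyDiff (N := N) α)
    {K : ℝ} (hK : JetBoundedBy N α K) : cbNorm (hK.mulOp hα) ≤ oneNorm N α := by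
  refine iSup_le fun n => iSup₂_le fun ξ hξ => iSup_le fun x => ?_
  have hfin := hK.oneNorm_lt_top.ne
  have e : (ξ.map (hK.mulOp hα)).map (jetAt x) = (ξ.map (jetAt x)).map (piLin hα x) := by
    ext1 i j
    exact (hK.contMDiff_apply hα (ξ i j).2.1).2 x
  rw [e]
  refine (vecNorm_map_le (piLin hα x) (C := (oneNorm N α).toReal) ENNReal.toReal_nonneg
    (fun v => norm_le_mul_of_enorm_le hfin (enorm_piOp_le hα x v)) _).trans ?_
  rw [ENNReal.ofReal_toReal hfin]
  exact mul_le_of_le_one_right zero_le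
    ((le_iSup (fun x : M => vecNorm (ξ.map (jetAt x))) x).trans hξ)

theorem JetBoundedBy.isModuleMorphism_mulOp {α : M → (H →L[ℂ] G)} (hα : StronglyDiff (N := N) α)
    {K : ℝ} (hK : JetBoundedBy N α K) : IsModuleMorphism (C10 N M ℂ) (hK.mulOp hα) := by
  refine ⟨fun s a => ?_, (hK.cbNorm_mulOp_le hα).trans_lt hK.oneNorm_lt_top⟩
  ext x
  exact map_smul (α x) (a.1 x) (s.1 x)

/-- The derivative of the adjoint is bounded when the derivative is. -/
theorem JetBoundedBy.adjoint [CompleteSpace H] [CompleteSpace G] {α : M → (H →L[ℂ] G)}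
    (hα : StarStronglyDiff (N := N) α) {K : ℝ} (hK : JetBoundedBy N α K) :
    JetBoundedBy N (fun x => ContinuousLinearMap.adjoint (α x)) (√N * K + K) := by
  have hK0 := hK.1
  refine ⟨by positivity, fun x η => ⟨?_, ?_⟩⟩
  · refine (ContinuousLinearMap.le_opNorm _ _).trans ?_
    rw [LinearIsometryEquiv.norm_map]
    have := (α x).opNorm_le_bound hK.1 fun ξ => (hK.2 x ξ).1
    gcongr
    nlinarith [mul_nonneg (Real.sqrt_nonneg N) hK0]
  · have hN : 0 ≤ √N * K * ‖η‖ := by positivity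
    refine le_trans ?_ (show √N * (K * ‖η‖) ≤ _ by nlinarith [mul_nonneg hK0 (norm_nonneg η)])
    refine frameVec_le_of_bound (E := H) _ (by positivity) fun v => ?_
    -- Freeze the derivative `w` of `α*η` along `v` and differentiate `⟨w, α(y)*η⟩ = conj ⟨η,
    -- α(y)w⟩` along `v`: this gives `‖w‖² ≤ ‖η‖ ‖u‖` with `‖u‖ ≤ ‖v‖ K ‖w‖`, and one factor `‖w‖`
    -- cancels.
    set w : H := mfderiv (𝓡 N) 𝓘(ℝ, H) (fun y => ContinuousLinearMap.adjoint (α y) η) x v with hw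
    set u : G := mfderiv (𝓡 N) 𝓘(ℝ, G) (fun y => α y w) x v with hu
    have d1 := hasMFDerivAt_clm_comp ((innerSL ℂ w).restrictScalars ℝ) (hα.2 η) x
    have d2 := hasMFDerivAt_clm_comp ((Complex.conjCLE : ℂ →L[ℝ] ℂ).comp
      ((innerSL ℂ η).restrictScalars ℝ)) (hα.1 w) x
    have e : (fun y => ((innerSL ℂ w).restrictScalars ℝ) (ContinuousLinearMap.adjoint (α y) η)) =
        fun y => ((Complex.conjCLE : ℂ →L[ℝ] ℂ).comp ((innerSL ℂ η).restrictScalars ℝ))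
          (α y w) := by
      funext y
      simp [ContinuousLinearMap.adjoint_inner_right]
    rw [e] at d1
    have e2 : inner ℂ w w = (starRingEnd ℂ) (inner ℂ η u) :=
      congrArg (fun L : TangentSpace (𝓡 N) x →L[ℝ] ℂ => L v) (hasMFDerivAt_unique d1 d2)
    have e3 : ‖w‖ * ‖w‖ ≤ ‖η‖ * ‖u‖ := by
      rw [← inner_self_eq_norm_mul_norm (𝕜 := ℂ) w, e2]
      refine (RCLike.re_le_norm _).trans ?_
      rw [RCLike.norm_conj]
      exact norm_inner_le_norm _ _
    have e4 : ‖u‖ ≤ ‖v‖ * (K * ‖w‖) :=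
      (norm_apply_le_frameVec (E := G) _ v).trans
        (mul_le_mul_of_nonneg_left (hK.2 x w).2 (norm_nonneg _))
    change ‖w‖ ≤ _
    rcases (norm_nonneg w).eq_or_lt with h0 | h0
    · rw [← h0]
      positivity
    · refine le_of_mul_le_mul_right ?_ h0
      calc ‖w‖ * ‖w‖ ≤ ‖η‖ * ‖u‖ := e3
        _ ≤ ‖η‖ * (‖v‖ * (K * ‖w‖)) := mul_le_mul_of_nonneg_left e4 (norm_nonneg _)
        _ = _ := by ring

end Multiplication

end OpStarMod

namespace OpStarMod

/-! ### Ekeland's variational principle -/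

section Ekeland

/-- Ekeland's variational principle. -/
theorem exists_forall_lt_add_edist {X : Type*} [EMetricSpace X] [CompleteSpace X] {f : X → ℝ≥0∞}
    (hf : LowerSemicontinuous f) {x₀ : X} (h₀ : f x₀ ≠ ⊤) {c : ℝ≥0∞} (hc0 : c ≠ 0) (hc : c ≠ ⊤) :
    ∃ p, f p ≠ ⊤ ∧ ∀ y, y ≠ p → f p < f y + c * edist p y := by
  -- `S x` holds the points reached from `x` by a descent of slope at least `c`. These sets are
  -- closed, and `y ∈ S x` implies `S y ⊆ S x`.
  set S : X → Set X := fun x => {y | f y + c * edist x y ≤ f x} with hS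
  have hself : ∀ x, x ∈ S x := fun x => by simp [hS]
  have htrans : ∀ x, ∀ y ∈ S x, S y ⊆ S x := by
    intro x y hy z hz
    calc f z + c * edist x z ≤ f z + c * (edist x y + edist y z) := by
          gcongr
          exact edist_triangle _ _ _
      _ = (f z + c * edist y z) + c * edist x y := by ring
      _ ≤ f y + c * edist x y := by gcongr; exact hz
      _ ≤ f x := hy
  have hle : ∀ x, ∀ y ∈ S x, f y ≤ f x := fun x y hy => le_self_add.trans hy
  have hclosed : ∀ x, IsClosed (S x) := fun x =>
    (hf.add ((ENNReal.continuous_const_mul hc).comp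
      (continuous_const.edist continuous_id)).lowerSemicontinuous).isClosed_preimage (f x)
  have hnext : ∀ x, f x ≠ ⊤ → ∀ ε : ℝ≥0∞, ε ≠ 0 → ∃ y ∈ S x, ∀ z ∈ S x, f y ≤ f z + ε := by
    intro x hx ε hε
    have h1 : (⨅ z ∈ S x, f z) ≤ f x := iInf₂_le x (hself x)
    have h2 : (⨅ z ∈ S x, f z) < (⨅ z ∈ S x, f z) + ε :=
      ENNReal.lt_add_right (ne_top_of_le_ne_top hx h1) hε
    obtain ⟨y, hy⟩ := iInf_lt_iff.1 h2
    obtain ⟨hy1, hy2⟩ := iInf_lt_iff.1 hy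
    refine ⟨y, hy1, fun z hz => hy2.le.trans ?_⟩
    gcongr
    exact iInf₂_le z hz
  set ε : ℕ → ℝ≥0∞ := fun n => c * (2⁻¹) ^ n with hε
  have hε0 : ∀ n, ε n ≠ 0 := fun n => mul_ne_zero hc0 (pow_ne_zero _ (by simp))
  -- The `n`-th move goes to a point of `S x` at which `f` is minimal on `S x` up to `c * 2⁻¹ ^ n`.
  choose! g hg1 hg2 using fun n x (hx : f x ≠ ⊤) => hnext x hx (ε n) (hε0 n)
  set u : ℕ → X := fun n => Nat.rec x₀ (fun n x => g n x) n with hu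
  have hu1 : ∀ n, u (n + 1) = g n (u n) := fun n => rfl
  have hfin : ∀ n, f (u n) ≠ ⊤ := by
    intro n
    induction n with
    | zero => exact h₀
    | succ n ih => exact ne_top_of_le_ne_top ih (hle _ _ (by rw [hu1]; exact hg1 n _ ih))
  have hmem : ∀ n, u (n + 1) ∈ S (u n) := fun n => by rw [hu1]; exact hg1 n _ (hfin n)
  have hsub : ∀ n m, n ≤ m → S (u m) ⊆ S (u n) := by
    intro n m hnm
    induction m, hnm using Nat.le_induction with
    | base => exact subset_rfl
    | succ m _ ih => exact (htrans _ _ (hmem m)).trans ih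
  -- From `f z + c * edist ≤ f (u (n + 1)) ≤ f z + ε n`, cancel the finite `f z` and then `c`.
  have hdiam : ∀ n, ∀ z ∈ S (u (n + 1)), edist (u (n + 1)) z ≤ (2⁻¹) ^ n := by
    intro n z hz
    have h1 : f (u (n + 1)) ≤ f z + ε n := by
      have := hg2 n (u n) (hfin n) z (hsub n (n + 1) n.le_succ hz)
      rwa [← hu1] at this
    have h2 : f z + c * edist (u (n + 1)) z ≤ f z + ε n := le_trans hz h1
    have h3 : f z ≠ ⊤ := ne_top_of_le_ne_top (hfin (n + 1)) (hle _ _ hz)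
    have h4 := (ENNReal.add_le_add_iff_left h3).1 h2
    exact (ENNReal.mul_le_mul_iff_right hc0 hc).1 h4
  have hcauchy : CauchySeq fun n => u (n + 1) := by
    refine cauchySeq_of_edist_le_geometric_two 1 ENNReal.one_ne_top fun n => ?_
    have := hdiam n (u (n + 2)) (hmem (n + 1))
    rwa [one_div, ENNReal.inv_pow]
  obtain ⟨p, hp⟩ := cauchySeq_tendsto_of_complete hcauchy
  have hpS : ∀ n, p ∈ S (u n) := fun n => by
    refine (hclosed (u n)).mem_of_tendsto hp ?_
    filter_upwards [eventually_ge_atTop n] with m hm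
    exact hsub n (m + 1) (by omega) (hself _)
  refine ⟨p, ne_top_of_le_ne_top h₀ (hle _ _ (hpS 0)), fun y hy => ?_⟩
  -- A counterexample `y` lies in `S p`, hence in every `S (u (n + 1))`, whose radii shrink to zero;
  -- so `u` also converges to `y`.
  by_contra hcon
  rw [not_lt] at hcon
  refine hy (tendsto_nhds_unique ?_ hp)
  rw [tendsto_iff_edist_tendsto_0]
  refine tendsto_of_tendsto_of_tendsto_of_le_of_le tendsto_const_nhds
    (ENNReal.tendsto_pow_atTop_nhds_zero_of_lt_one (r := 2⁻¹) (by simp)) (fun _ => zero_le)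
    fun n => ?_
  exact hdiam n y (htrans _ _ (hpS (n + 1)) hcon)

end Ekeland

/-! ### A `C¹` substitute for the positive part -/

section SoftPositivePart

/-- A `C¹` approximation of the positive part. -/
theorem exists_soft_posPart {δ : ℝ} (hδ : 0 < δ) : ∃ h h' : ℝ → ℝ, ContDiff ℝ 1 h ∧
    (∀ t, HasDerivAt h (h' t) t) ∧ (∀ t, 0 ≤ h' t ∧ h' t ≤ 1) ∧ (∀ t ≤ 0, h t = 0) ∧
    ∀ t, 0 ≤ h t ∧ t - δ ≤ h t ∧ (0 ≤ t → h t ≤ t) := by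
  -- `k` ramps from 0 to 1 on `[0, δ]`; its primitive is `C¹`, and loses at most `δ` against `t`
  -- because `k = 1` beyond `δ`.
  set k : ℝ → ℝ := fun s => max 0 (min 1 (s / δ)) with hk
  have hkc : Continuous k := by fun_prop
  have hk0 : ∀ s, 0 ≤ k s := fun s => le_max_left _ _
  have hk1 : ∀ s, k s ≤ 1 := fun s => max_le zero_le_one (min_le_left _ _)
  have hkn : ∀ s ≤ 0, k s = 0 := fun s hs =>
    max_eq_left ((min_le_right _ _).trans (div_nonpos_of_nonpos_of_nonneg hs hδ.le))
  have hd : ∀ t, HasDerivAt (fun t => ∫ s in (0 : ℝ)..t, k s) (k t) t := fun t =>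
    intervalIntegral.integral_hasDerivAt_right (hkc.intervalIntegrable _ _)
      (hkc.stronglyMeasurableAtFilter _ _) hkc.continuousAt
  have hneg : ∀ t ≤ 0, ∫ s in (0 : ℝ)..t, k s = 0 := by
    intro t ht
    rw [intervalIntegral.integral_congr (g := fun _ => 0)]
    · simp
    · intro s hs
      rw [Set.uIcc_of_ge ht] at hs
      exact hkn s hs.2
  have hpos : ∀ t, 0 ≤ ∫ s in (0 : ℝ)..t, k s := by
    intro t
    rcases le_total t 0 with ht | ht
    · rw [hneg t ht]
    · exact intervalIntegral.integral_nonneg ht fun s _ => hk0 s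
  refine ⟨fun t => ∫ s in (0 : ℝ)..t, k s, k, ?_, hd, fun t => ⟨hk0 t, hk1 t⟩, hneg, fun t =>
    ⟨hpos t, ?_, fun ht => ?_⟩⟩
  · rw [contDiff_one_iff_deriv]
    refine ⟨fun t => (hd t).differentiableAt, ?_⟩
    rw [show deriv (fun t => ∫ s in (0 : ℝ)..t, k s) = k from funext fun t => (hd t).deriv]
    exact hkc
  · rcases le_total t δ with ht | ht
    · linarith [hpos t]
    · have h1 : ∫ s in (0 : ℝ)..t, k s = (∫ s in (0 : ℝ)..δ, k s) + ∫ s in δ..t, k s :=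
        (intervalIntegral.integral_add_adjacent_intervals (hkc.intervalIntegrable _ _)
          (hkc.intervalIntegrable _ _)).symm
      have h2 : ∫ s in δ..t, k s = ∫ s in δ..t, (1 : ℝ) := by
        refine intervalIntegral.integral_congr fun s hs => ?_
        rw [Set.uIcc_of_le ht] at hs
        have : 1 ≤ s / δ := (one_le_div hδ).2 hs.1
        simp [hk, this]
      rw [intervalIntegral.integral_const, smul_eq_mul, mul_one] at h2
      linarith [hpos δ]
  · calc ∫ s in (0 : ℝ)..t, k s ≤ ∫ _s in (0 : ℝ)..t, (1 : ℝ) :=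
        intervalIntegral.integral_mono_on ht (hkc.intervalIntegrable _ _) (by simp)
          fun s _ => hk1 s
      _ = t := by simp

end SoftPositivePart

/-! ### Compactly supported functions with gradient at most one -/

section Tents

variable {N : ℕ} {M : Type*} [TopologicalSpace M] [ChartedSpace (EuclideanSpace ℝ (Fin N)) M]
  [RiemannianBundle (fun x : M => TangentSpace (𝓡 N) x)]

/-- `u` is differentiable at `y`, with derivative of norm at most `c`. -/
def GradLE (N : ℕ) {M : Type*} [TopologicalSpace M] [ChartedSpace (EuclideanSpace ℝ (Fin N)) M]
    [RiemannianBundle (fun x : M => TangentSpace (𝓡 N) x)] (u : M → ℝ) (c : ℝ) (y : M) : Prop :=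
  ∃ L : TangentSpace (𝓡 N) y →L[ℝ] ℝ, HasMFDerivAt (𝓡 N) 𝓘(ℝ, ℝ) u y L ∧ ∀ v, |L v| ≤ c * ‖v‖

/-- Nonnegative compactly supported `C¹`-functions with derivative of norm at most one. -/
structure IsTent (N : ℕ) {M : Type*} [TopologicalSpace M]
    [ChartedSpace (EuclideanSpace ℝ (Fin N)) M]
    [RiemannianBundle (fun x : M => TangentSpace (𝓡 N) x)] (u : M → ℝ) : Prop where
  contMDiff : ContMDiff (𝓡 N) 𝓘(ℝ, ℝ) 1 u
  hasCompactSupport : HasCompactSupport u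
  nonneg : ∀ y, 0 ≤ u y
  grad : ∀ y, GradLE N u 1 y

theorem GradLE.congr {u v : M → ℝ} {c : ℝ} {y : M} (h : GradLE N u c y) (e : v =ᶠ[𝓝 y] u) :
    GradLE N v c y := by
  obtain ⟨L, h1, h2⟩ := h
  exact ⟨L, h1.congr_of_eventuallyEq e, h2⟩

/-- The derivative is the convex combination `t da + (1 - t) db` with `t = h'(a - b)` in `[0, 1]`,
so the bound 1 survives without loss. -/
theorem GradLE.softMax {a b : M → ℝ} {y : M} (ha : GradLE N a 1 y) (hb : GradLE N b 1 y)
    {h h' : ℝ → ℝ} (hd : ∀ t, HasDerivAt h (h' t) t) (hh : ∀ t, 0 ≤ h' t ∧ h' t ≤ 1) :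
    GradLE N (fun y => b y + h (a y - b y)) 1 y := by
  obtain ⟨A, hA, hA'⟩ := ha
  obtain ⟨B, hB, hB'⟩ := hb
  have h1 : HasMFDerivAt (𝓡 N) 𝓘(ℝ, ℝ) (fun y => a y - b y) y (A - B) := hA.sub hB
  have h2 := (hd (a y - b y)).hasFDerivAt.hasMFDerivAt.comp y h1
  refine ⟨_, hB.add h2, fun v => ?_⟩
  set t := h' (a y - b y)
  have e : (B + (ContinuousLinearMap.toSpanSingleton ℝ t).comp (A - B)) v =
      t * A v + (1 - t) * B v := by
    simp
    ring
  refine (le_of_eq (congrArg abs e)).trans ?_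
  obtain ⟨t0, t1⟩ := hh (a y - b y)
  refine (abs_add_le _ _).trans ?_
  rw [abs_mul, abs_mul, abs_of_nonneg t0, abs_of_nonneg (sub_nonneg.2 t1)]
  nlinarith [mul_le_mul_of_nonneg_left (hA' v) t0,
    mul_le_mul_of_nonneg_left (hB' v) (sub_nonneg.2 t1)]

theorem isTent_zero : IsTent N (fun _ : M => (0 : ℝ)) where
  contMDiff := contMDiff_const
  hasCompactSupport := HasCompactSupport.zero
  nonneg _ := le_rfl
  grad y := ⟨0, hasMFDerivAt_const _ _, fun v => by simp⟩

/-- The soft maximum `b + h(a - b)`: `h ≥ 0` loses nothing against `b`, `h(t) ≥ t - δ` at most `δ`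
against `a`, and `h(0) = 0` keeps the support compact. -/
theorem IsTent.exists_max {a b : M → ℝ} (ha : IsTent N a) (hb : IsTent N b) {δ : ℝ} (hδ : 0 < δ) :
    ∃ u, IsTent N u ∧ ∀ y, a y - δ ≤ u y ∧ b y ≤ u y := by
  obtain ⟨h, h', h1, hd, hh, hz, hb'⟩ := exists_soft_posPart hδ
  refine ⟨fun y => b y + h (a y - b y), ⟨?_, ?_, fun y => ?_, fun y => ?_⟩, fun y => ⟨?_, ?_⟩⟩
  · exact hb.contMDiff.add (h1.contMDiff.comp (ha.contMDiff.sub hb.contMDiff))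
  · refine HasCompactSupport.add hb.hasCompactSupport ?_
    exact (HasCompactSupport.sub ha.hasCompactSupport hb.hasCompactSupport).comp_left (hz 0 le_rfl)
  · exact add_nonneg (hb.nonneg y) (hb' _).1
  · exact (ha.grad y).softMax (hb.grad y) hd hh
  · linarith [(hb' (a y - b y)).2.1]
  · linarith [(hb' (a y - b y)).1]

theorem exists_isTent_forall_lt {S : Set M} (hS : IsCompact S) {a : ℝ}
    (h : ∀ y ∈ S, ∃ u, IsTent N u ∧ a < u y) {b : ℝ} (hba : b < a) :
    ∃ u, IsTent N u ∧ ∀ y ∈ S, b < u y := by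
  -- The induction ranges over all `b < a` because every soft maximum uses up part of the margin.
  refine hS.induction_on (p := fun A => ∀ b < a, ∃ u, IsTent N u ∧ ∀ y ∈ A, b < u y)
    (fun b _ => ⟨_, isTent_zero, fun y hy => hy.elim⟩) ?_ ?_ ?_ b hba
  · intro A B hAB hB b hb
    obtain ⟨u, hu, hu'⟩ := hB b hb
    exact ⟨u, hu, fun y hy => hu' y (hAB hy)⟩
  · intro A B hA hB b hb
    obtain ⟨u, hu, hu'⟩ := hA ((a + b) / 2) (by linarith)
    obtain ⟨v, hv, hv'⟩ := hB ((a + b) / 2) (by linarith)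
    obtain ⟨w, hw, hw'⟩ := hu.exists_max hv (δ := (a - b) / 2) (by linarith)
    refine ⟨w, hw, fun y hy => ?_⟩
    rcases hy with hy | hy
    · linarith [hu' y hy, (hw' y).1]
    · linarith [hv' y hy, (hw' y).2]
  · intro y hy
    obtain ⟨u, hu, hu'⟩ := h y hy
    refine ⟨{z | a < u z}, mem_nhdsWithin_of_mem_nhds
      (hu.contMDiff.continuous.continuousAt.eventually (lt_mem_nhds hu')), fun b hb =>
      ⟨u, hu, fun z hz => hb.trans hz⟩⟩

/-- A tent which is larger than `w` around the boundary of `B` can be raised to `w` inside `B`. -/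
theorem IsTent.exists_glue [T2Space M] {u w : M → ℝ} (hu : IsTent N u) {B K V : Set M}
    (hB : IsOpen B) (hK : IsCompact K) (hBK : B ⊆ K) (hKV : K ⊆ V)
    (hwV : ∀ y ∈ V, ContMDiffAt (𝓡 N) 𝓘(ℝ, ℝ) 1 w y) (hwB : ∀ y ∈ B, GradLE N w 1 y)
    (huw : ∀ y ∈ K \ B, w y < u y) {p : M} (hp : p ∈ B) {δ : ℝ} (hδ : 0 < δ) :
    ∃ v, IsTent N v ∧ w p - δ ≤ v p := by
  classical
  obtain ⟨h, h', h1, hd, hh, hz, hb'⟩ := exists_soft_posPart hδ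
  -- Soft maximum with `w` inside `B`, unchanged outside. The indicator creates no corner: `h`
  -- vanishes near `K \ B`, where `w < u`, and the complement of `K` is an open set disjoint from
  -- `B`.
  set v : M → ℝ := fun y => u y + B.indicator (fun y => h (w y - u y)) y with hv
  have hvB : ∀ y ∈ B, v =ᶠ[𝓝 y] fun y => u y + h (w y - u y) := by
    intro y hy
    filter_upwards [hB.mem_nhds hy] with z hz'
    simp [hv, hz']
  have hvn : ∀ y ∉ B, v =ᶠ[𝓝 y] u := by
    intro y hy
    by_cases hyK : y ∈ K
    · have hc : ContinuousAt (fun z => u z - w z) y :=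
        hu.contMDiff.continuous.continuousAt.sub (hwV y (hKV hyK)).continuousAt
      filter_upwards [hc.eventually (lt_mem_nhds (sub_pos.2 (huw y ⟨hyK, hy⟩)))] with z hz'
      have : h (w z - u z) = 0 := hz _ (by linarith)
      by_cases hzB : z ∈ B <;> simp [hv, hzB, this]
    · filter_upwards [hK.isClosed.isOpen_compl.mem_nhds hyK] with z hz'
      have : z ∉ B := fun h => hz' (hBK h)
      simp [hv, this]
  refine ⟨v, ⟨fun y => ?_, ?_, fun y => ?_, fun y => ?_⟩, ?_⟩
  · by_cases hy : y ∈ B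
    · refine ContMDiffAt.congr_of_eventuallyEq ?_ (hvB y hy)
      exact (hu.contMDiff y).add (h1.contMDiff.contMDiffAt.comp y
        ((hwV y (hKV (hBK hy))).sub (hu.contMDiff y)))
    · exact (hu.contMDiff y).congr_of_eventuallyEq (hvn y hy)
  · refine HasCompactSupport.add hu.hasCompactSupport (HasCompactSupport.intro hK fun y hy => ?_)
    have : y ∉ B := fun h => hy (hBK h)
    simp [this]
  · exact add_nonneg (hu.nonneg y) (Set.indicator_nonneg (fun y _ => (hb' _).1) y)
  · by_cases hy : y ∈ B
    · exact ((hwB y hy).softMax (hu.grad y) hd hh).congr (hvB y hy)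
    · exact (hu.grad y).congr (hvn y hy)
  · have := (hb' (w p - u p)).2.1
    have e : v p = u p + h (w p - u p) := by simp [hv, hp]
    rw [e]
    linarith

end Tents

end OpStarMod

namespace OpStarMod

/-! ### A local cone in a chart -/

section LocalCone

variable {N : ℕ} {M : Type*} [MetricSpace M]
    [ChartedSpace (EuclideanSpace ℝ (Fin N)) M] [IsManifold (𝓡 N) ∞ M]
    [RiemannianBundle (fun x : M => TangentSpace (𝓡 N) x)]
    [IsContMDiffRiemannianBundle (𝓡 N) ∞ (EuclideanSpace ℝ (Fin N))
      (fun x : M => TangentSpace (𝓡 N) x)]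

/-- The trivialization of the tangent bundle at `p`, over the point `p`. -/
def tangentCoord (p : M) : EuclideanSpace ℝ (Fin N) →L[ℝ] TangentSpace (𝓡 N) p :=
  (trivializationAt (EuclideanSpace ℝ (Fin N)) (fun x : M => TangentSpace (𝓡 N) x) p).symmL ℝ p

/-- By continuity of the metric, the norms of `T_yM` and `T_pM` agree up to a factor 2 near `p` when
compared in the trivialization. The constant `C` only relates the norm of `T_pM` to the unrelated
norm of the model space. -/
theorem tangentCoord_bounds (p : M) :
    (∃ C : ℝ, 0 < C ∧ ∀ z : EuclideanSpace ℝ (Fin N), ‖z‖ ≤ C * ‖tangentCoord p z‖) ∧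
    ∀ᶠ y in 𝓝 p, y ∈ (chartAt (EuclideanSpace ℝ (Fin N)) p).source ∧
      (∀ v : TangentSpace (𝓡 N) y, ‖tangentCoord p (mfderiv (𝓡 N)
        𝓘(ℝ, EuclideanSpace ℝ (Fin N)) (extChartAt (𝓡 N) p) y v)‖ ≤ 2 * ‖v‖) ∧
      ∀ z : EuclideanSpace ℝ (Fin N), ‖((trivializationAt (EuclideanSpace ℝ (Fin N))
        (fun x : M => TangentSpace (𝓡 N) x) p).symmL ℝ y z : TangentSpace (𝓡 N) y)‖
        ≤ 2 * ‖tangentCoord p z‖ := by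
  have := isContinuousRiemannianBundle_tangent N M
  set T := trivializationAt (EuclideanSpace ℝ (Fin N)) (fun x : M => TangentSpace (𝓡 N) x) p
    with hT
  have hp : p ∈ T.baseSet := FiberBundle.mem_baseSet_trivializationAt' p
  have hinv : ∀ z, T.continuousLinearMapAt ℝ p (tangentCoord p z) = z := fun z =>
    T.continuousLinearMapAt_symmL hp z
  refine ⟨⟨‖T.continuousLinearMapAt ℝ p‖ + 1, by positivity, fun z => ?_⟩, ?_⟩
  · have := (T.continuousLinearMapAt ℝ p).le_opNorm (tangentCoord p z)
    rw [hinv] at this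
    nlinarith [norm_nonneg (tangentCoord p z)]
  · filter_upwards [chart_source_mem_nhds (EuclideanSpace ℝ (Fin N)) p,
      eventually_norm_symmL_trivializationAt_self_comp_lt (EuclideanSpace ℝ (Fin N))
        (fun x : M => TangentSpace (𝓡 N) x) p one_lt_two,
      eventually_norm_symmL_trivializationAt_comp_self_lt (EuclideanSpace ℝ (Fin N))
        (fun x : M => TangentSpace (𝓡 N) x) p one_lt_two] with y hy h1 h2
    refine ⟨hy, fun v => ?_, fun z => ?_⟩
    · rw [← TangentBundle.continuousLinearMapAt_trivializationAt hy]
      exact ContinuousLinearMap.le_of_opNorm_le _ h1.le v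
    · have := ContinuousLinearMap.le_of_opNorm_le _ h2.le (tangentCoord p z)
      rwa [ContinuousLinearMap.comp_apply, hinv] at this

/-- The straight segment in the chart is a competitor for the Riemannian distance, and the
hypothesis bounds its speed. -/
theorem dist_le_of_segment [IsRiemannianManifold (𝓡 N) M] {p : M}
    {z : EuclideanSpace ℝ (Fin N)}
    (h : ∀ t ∈ Set.Icc (0 : ℝ) 1, extChartAt (𝓡 N) p p + t • z ∈ (extChartAt (𝓡 N) p).target ∧
      ‖((trivializationAt (EuclideanSpace ℝ (Fin N))
        (fun x : M => TangentSpace (𝓡 N) x) p).symmL ℝ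
          ((extChartAt (𝓡 N) p).symm (extChartAt (𝓡 N) p p + t • z)) z :
          TangentSpace (𝓡 N) ((extChartAt (𝓡 N) p).symm (extChartAt (𝓡 N) p p + t • z)))‖
        ≤ 2 * ‖tangentCoord p z‖) :
    dist p ((extChartAt (𝓡 N) p).symm (extChartAt (𝓡 N) p p + z)) ≤ 2 * ‖tangentCoord p z‖ := by
  set φ := extChartAt (𝓡 N) p with hφ
  set η : ℝ → EuclideanSpace ℝ (Fin N) := fun t => φ p + t • z with hη
  set γ : ℝ → M := φ.symm ∘ η with hγ
  have hηs : ContDiff ℝ 1 η := by fun_prop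
  have hηd : ∀ t, HasFDerivAt η ((ContinuousLinearMap.id ℝ ℝ).smulRight z) t := fun t =>
    ((hasFDerivAt_id t).smul_const z).const_add (φ p)
  have hsm : ContMDiffOn 𝓘(ℝ, ℝ) (𝓡 N) 1 γ (Set.Icc 0 1) :=
    (contMDiffOn_extChartAt_symm p).comp hηs.contMDiff.contMDiffOn fun t ht => (h t ht).1
  have h1 : Manifold.riemannianEDist (𝓡 N) p (φ.symm (φ p + z)) ≤ pathELength (𝓡 N) γ 0 1 := by
    refine riemannianEDist_le_pathELength hsm ?_ ?_ zero_le_one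
    · simp [hγ, hη, hφ]
    · simp [hγ, hη]
  rw [← IsRiemannianManifold.out (I := 𝓡 N)] at h1
  have h2 : pathELength (𝓡 N) γ 0 1 ≤ ENNReal.ofReal (2 * ‖tangentCoord p z‖) := by
    rw [pathELength_eq_lintegral_mfderiv_Icc]
    refine (MeasureTheory.setLIntegral_mono' measurableSet_Icc
      (g := fun _ => ENNReal.ofReal (2 * ‖tangentCoord p z‖)) fun t ht => ?_).trans (by simp)
    obtain ⟨ht1, ht2⟩ := h t ht
    have hsrc : φ.symm (η t) ∈ (chartAt (EuclideanSpace ℝ (Fin N)) p).source := by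
      rw [← extChartAt_source (𝓡 N)]
      exact φ.map_target ht1
    have d1 := (mdifferentiableWithinAt_extChartAt_symm (I := 𝓡 N) ht1).hasMFDerivWithinAt
    rw [ModelWithCorners.Boundaryless.range_eq_univ] at d1
    have d2 := (hasMFDerivWithinAt_univ.1 d1).comp t (hηd t).hasMFDerivAt
    rw [TangentBundle.symmL_trivializationAt hsrc, ModelWithCorners.Boundaryless.range_eq_univ]
      at ht2
    have e : φ (φ.symm (φ p + t • z)) = φ p + t • z := φ.right_inv ht1
    -- The base points agree only propositionally; stating the equality in the model space lets them
    -- be substituted.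
    have key : ∀ a b : EuclideanSpace ℝ (Fin N), a = b →
        (show EuclideanSpace ℝ (Fin N) from mfderivWithin 𝓘(ℝ, EuclideanSpace ℝ (Fin N)) (𝓡 N)
          φ.symm Set.univ a ((1 : ℝ) • z)) =
        (show EuclideanSpace ℝ (Fin N) from mfderivWithin 𝓘(ℝ, EuclideanSpace ℝ (Fin N)) (𝓡 N)
          φ.symm Set.univ b z) := by
      rintro a _ rfl
      rw [one_smul]
    rw [d2.mfderiv, ← ofReal_norm]
    refine ENNReal.ofReal_le_ofReal (le_trans (le_of_eq ?_) ht2)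
    exact congrArg (fun u : TangentSpace (𝓡 N) (φ.symm (η t)) => ‖u‖) (key _ _ e.symm)
  rw [edist_dist] at h1
  exact (ENNReal.ofReal_le_ofReal_iff (by positivity)).1 (h1.trans h2)

/-- Around each point there is a function which decreases with slope at most one, and at a definite
rate. -/
theorem exists_local_cone [IsRiemannianManifold (𝓡 N) M] (p : M) :
    ∃ (r : ℝ) (B K V : Set M) (w : M → ℝ), 0 < r ∧ IsOpen B ∧ IsCompact K ∧ p ∈ B ∧ B ⊆ K ∧
      K ⊆ V ∧ (∀ y ∈ V, ContMDiffAt (𝓡 N) 𝓘(ℝ, ℝ) 1 w y) ∧ (∀ y ∈ B, GradLE N w 1 y) ∧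
      w p = 0 ∧ ∀ y ∈ K \ B, w y ≤ -(r / 4) ∧ dist p y ≤ 2 * r := by
  obtain ⟨⟨C, hC0, hC⟩, hev⟩ := tangentCoord_bounds (N := N) p
  set φ := extChartAt (𝓡 N) p with hφ
  set L := tangentCoord (N := N) p with hL
  have hcont : Tendsto φ.symm (𝓝 (φ p)) (𝓝 p) := by
    have := continuousAt_extChartAt_symm (I := 𝓡 N) p
    rwa [ContinuousAt, extChartAt_to_inv] at this
  obtain ⟨ρ, hρ, hball⟩ := Metric.eventually_nhds_iff_ball.1
    ((hcont.eventually hev).and ((isOpen_extChartAt_target p).mem_nhds (mem_extChartAt_target p)))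
  -- Then `C * r = ρ / 2`, so the ellipsoid `‖L z‖ ≤ r` fits in the ball of radius `ρ`.
  set r : ℝ := ρ / (2 * C) with hr
  have hr0 : 0 < r := by positivity
  have hCr : C * r < ρ := by
    rw [hr]
    field_simp
    linarith
  have hsmall : ∀ z : EuclideanSpace ℝ (Fin N), ‖L z‖ ≤ r → φ p + z ∈ Metric.ball (φ p) ρ := by
    intro z hz
    rw [mem_ball_iff_norm, add_sub_cancel_left]
    exact ((hC z).trans (mul_le_mul_of_nonneg_left hz hC0.le)).trans_lt hCr
  have hcomp : IsCompact {z : EuclideanSpace ℝ (Fin N) | ‖L z‖ ≤ r} := by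
    refine Metric.isCompact_of_isClosed_isBounded (isClosed_le (by fun_prop) continuous_const) ?_
    refine (Metric.isBounded_closedBall (x := 0) (r := C * r)).subset fun z hz => ?_
    rw [mem_closedBall_zero_iff]
    exact (hC z).trans (mul_le_mul_of_nonneg_left hz hC0.le)
  set q : M → ℝ := fun y => ‖L (φ y - φ p)‖ with hq
  have hKimg : ∀ y, (∃ z : EuclideanSpace ℝ (Fin N), ‖L z‖ ≤ r ∧ φ.symm (φ p + z) = y) ↔
      y ∈ φ.source ∧ q y ≤ r := by
    intro y
    constructor
    · rintro ⟨z, hz, rfl⟩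
      have ht := (hball _ (hsmall z hz)).2
      refine ⟨φ.map_target ht, ?_⟩
      simpa [hq, φ.right_inv ht] using hz
    · rintro ⟨hy, hy'⟩
      exact ⟨φ y - φ p, hy', by rw [add_sub_cancel, φ.left_inv hy]⟩
  -- The square makes `w` smooth at `p`. Where `q ≤ r` its slope is at most `(2 * r) * 2 / (4 * r) =
  -- 1`, the second 2 coming from the comparison of norms; on `K \ B`, where `q = r`, it equals `-r
  -- / 4`.
  refine ⟨r, {y | y ∈ φ.source ∧ q y < r}, {y | y ∈ φ.source ∧ q y ≤ r}, φ.source,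
    fun y => -(q y ^ 2 / (4 * r)), hr0, ?_, ?_, ?_, fun y hy => ⟨hy.1, hy.2.le⟩, fun y hy => hy.1,
    ?_, ?_, ?_, ?_⟩
  · have : ContinuousOn q φ.source :=
      (L.continuous.comp_continuousOn ((continuousOn_extChartAt p).sub continuousOn_const)).norm
    exact this.isOpen_inter_preimage (isOpen_extChartAt_source p) isOpen_Iio
  · have e : {y | y ∈ φ.source ∧ q y ≤ r} = (fun z => φ.symm (φ p + z)) ''
        {z : EuclideanSpace ℝ (Fin N) | ‖L z‖ ≤ r} := by
      ext y
      exact (hKimg y).symm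
    rw [e]
    refine hcomp.image_of_continuousOn ?_
    refine (continuousOn_extChartAt_symm p).comp (by fun_prop) fun z hz => ?_
    exact (hball _ (hsmall z hz)).2
  · exact ⟨mem_extChartAt_source p, by simpa [hq] using hr0⟩
  · intro y hy
    have h1 : ContDiff ℝ 1 fun z : EuclideanSpace ℝ (Fin N) => -(‖L (z - φ p)‖ ^ 2 / (4 * r)) := by
      have : ContDiff ℝ 1 fun z : EuclideanSpace ℝ (Fin N) => L (z - φ p) := by fun_prop
      exact ((this.norm_sq ℝ).div_const _).neg
    have h2 : ContMDiffAt (𝓡 N) 𝓘(ℝ, EuclideanSpace ℝ (Fin N)) 1 φ y :=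
      contMDiffAt_extChartAt' (by rwa [hφ, extChartAt_source] at hy)
    exact h1.contMDiff.contMDiffAt.comp y h2
  · rintro y ⟨hy, hyr⟩
    obtain ⟨z, hz, rfl⟩ := (hKimg y).2 ⟨hy, hyr.le⟩
    obtain ⟨hy', hgrad, -⟩ := (hball _ (hsmall z hz)).1
    set y := φ.symm (φ p + z) with hydef
    have h1 : HasFDerivAt (fun z : EuclideanSpace ℝ (Fin N) => L (z - φ p)) L (φ y) :=
      L.hasFDerivAt.comp (φ y) ((hasFDerivAt_id (φ y)).sub_const _)
    have h2 := ((h1.norm_sq).const_mul (4 * r)⁻¹).neg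
    have h3 := (mdifferentiableAt_extChartAt (I := 𝓡 N) (x := p) hy').hasMFDerivAt
    have h4 := h2.hasMFDerivAt.comp y h3
    refine ⟨_, h4.congr_of_eventuallyEq (Eventually.of_forall fun x => ?_), fun v => ?_⟩
    · simp [hq, div_eq_inv_mul, hφ]
    · have e : |(4 * r)⁻¹ * (2 * inner ℝ (L (φ y - φ p)) (L (mfderiv (𝓡 N)
          𝓘(ℝ, EuclideanSpace ℝ (Fin N)) φ y v)))| ≤ 1 * ‖v‖ := by
        have e1 := abs_real_inner_le_norm (L (φ y - φ p)) (L (mfderiv (𝓡 N)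
          𝓘(ℝ, EuclideanSpace ℝ (Fin N)) φ y v))
        have e2 := hgrad v
        have e3 : ‖L (φ y - φ p)‖ ≤ r := hyr.le
        rw [abs_mul, abs_mul, abs_of_pos (by positivity : 0 < (4 * r)⁻¹), abs_two]
        calc _ ≤ (4 * r)⁻¹ * (2 * (r * (2 * ‖v‖))) := by
              gcongr
              exact e1.trans (mul_le_mul e3 e2 (norm_nonneg _) hr0.le)
          _ = 1 * ‖v‖ := by
              field_simp
              norm_num
      rw [← abs_neg] at e
      refine le_trans (le_of_eq (congrArg abs ?_)) e
      change -((4 * r)⁻¹ * ((2 : ℕ) • inner ℝ (L (φ y - φ p)) (L (mfderiv (𝓡 N)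
          𝓘(ℝ, EuclideanSpace ℝ (Fin N)) φ y v)))) = _
      rw [two_nsmul, two_mul]
  · simp [hq]
  · rintro y ⟨⟨hy, hyr⟩, hyB⟩
    have hqr : q y = r := le_antisymm hyr (not_lt.1 fun h => hyB ⟨hy, h⟩)
    refine ⟨?_, ?_⟩
    · change -(q y ^ 2 / (4 * r)) ≤ _
      rw [hqr]
      refine le_of_eq ?_
      field_simp
    · obtain ⟨z, hz, rfl⟩ := (hKimg y).2 ⟨hy, hyr⟩
      refine (dist_le_of_segment (z := z) fun t ht => ?_).trans (by linarith)
      have hz' : ‖L (t • z)‖ ≤ r := by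
        rw [map_smul, norm_smul, Real.norm_eq_abs, abs_of_nonneg ht.1]
        exact (mul_le_of_le_one_left (norm_nonneg _) ht.2).trans hz
      have hb := hball _ (hsmall _ hz')
      exact ⟨hb.2, hb.1.2.2 z⟩

end LocalCone

/-! ### Cutoff functions on complete manifolds -/

section Cutoff

variable {N : ℕ} {M : Type*} [MetricSpace M]
    [ChartedSpace (EuclideanSpace ℝ (Fin N)) M] [IsManifold (𝓡 N) ∞ M]
    [RiemannianBundle (fun x : M => TangentSpace (𝓡 N) x)]
    [IsContMDiffRiemannianBundle (𝓡 N) ∞ (EuclideanSpace ℝ (Fin N))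
      (fun x : M => TangentSpace (𝓡 N) x)]
    [IsRiemannianManifold (𝓡 N) M] [CompleteSpace M]

/-- On a complete Riemannian manifold there are arbitrarily high tents. -/
theorem exists_isTent_gt (x : M) (m : ℝ) : ∃ u, IsTent N u ∧ m < u x := by
  by_contra! hcon
  set R : M → ℝ≥0∞ := fun y => ⨆ u : {u : M → ℝ // IsTent N u}, ENNReal.ofReal (u.1 y) with hR
  have hlsc : LowerSemicontinuous R := lowerSemicontinuous_iSup fun u =>
    (ENNReal.continuous_ofReal.comp u.2.contMDiff.continuous).lowerSemicontinuous
  have hx : R x ≠ ⊤ := ne_top_of_le_ne_top ENNReal.ofReal_ne_top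
    (iSup_le fun u => ENNReal.ofReal_le_ofReal (hcon u.1 u.2))
  -- Points of `K \ B` are within `2 * r` of `p`, so slope `1 / 24` lets `R` drop there by at most
  -- `r / 12`, less than the drop `r / 4` of the cone.
  obtain ⟨p, hp, hlt⟩ := exists_forall_lt_add_edist hlsc hx (c := ENNReal.ofReal (1 / 24))
    (by simp) ENNReal.ofReal_ne_top
  obtain ⟨r, B, K, V, w, hr, hB, hK, hpB, hBK, hKV, hwV, hwB, hwp, hS⟩ :=
    exists_local_cone (N := N) p
  set ρ := (R p).toReal with hρ
  have hhigh : ∀ y ∈ K \ B, ∃ u, IsTent N u ∧ ρ - r / 12 < u y := by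
    intro y hy
    rcases lt_or_ge (ρ - r / 12) 0 with hneg | hpos
    · exact ⟨_, isTent_zero, hneg⟩
    have hne : y ≠ p := fun h => hy.2 (h ▸ hpB)
    have h1 := hlt y hne
    have h2 : ENNReal.ofReal (1 / 24) * edist p y ≤ ENNReal.ofReal (r / 12) := by
      rw [edist_dist, ← ENNReal.ofReal_mul (by norm_num)]
      refine ENNReal.ofReal_le_ofReal ?_
      linarith [(hS y hy).2]
    have h3 : ENNReal.ofReal (ρ - r / 12) < R y := by
      by_contra! hle
      have h4 : R p < ENNReal.ofReal (ρ - r / 12) + ENNReal.ofReal (r / 12) :=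
        h1.trans_le (add_le_add hle h2)
      rw [← ENNReal.ofReal_add hpos (by positivity), sub_add_cancel, hρ,
        ENNReal.ofReal_toReal hp] at h4
      exact lt_irrefl _ h4
    obtain ⟨u, hu⟩ := lt_iSup_iff.1 h3
    exact ⟨u.1, u.2, (ENNReal.ofReal_lt_ofReal_iff_of_nonneg hpos).1 hu⟩
  obtain ⟨u, hu, hu'⟩ := exists_isTent_forall_lt (hK.diff hB) hhigh
    (b := ρ - r / 12 - r / 32) (by linarith)
  -- On `K \ B` the raised cone is at most `ρ + r/32 - r/4 < ρ - r/12 - r/32`, hence below `u`. At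
  -- `p` it is `ρ + r/32`, and after the loss `r/64` still exceeds `ρ = R p`.
  obtain ⟨v, hv, hv'⟩ := hu.exists_glue (w := fun y => ρ + r / 32 + w y) hB hK hBK hKV
    (fun y hy => contMDiffAt_const.add (hwV y hy))
    (fun y hy => by
      obtain ⟨L, h1, h2⟩ := hwB y hy
      refine ⟨0 + L, (hasMFDerivAt_const _ _).add h1, fun v => ?_⟩
      have e : (0 : TangentSpace (𝓡 N) y →L[ℝ] ℝ) + L = L := zero_add L
      exact (le_of_eq (congrArg (fun T : TangentSpace (𝓡 N) y →L[ℝ] ℝ => |T v|) e)).trans (h2 v))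
    (fun y hy => by linarith [hu' y hy, (hS y hy).1]) hpB (δ := r / 64) (by linarith)
  have h1 : ENNReal.ofReal (v p) ≤ R p :=
    le_iSup (fun u : {u : M → ℝ // IsTent N u} => ENNReal.ofReal (u.1 p)) ⟨v, hv⟩
  rw [← ENNReal.ofReal_toReal hp, ENNReal.ofReal_le_ofReal_iff ENNReal.toReal_nonneg] at h1
  simp only [hwp] at hv'
  linarith

/-- On a complete Riemannian manifold there are cutoff functions with small derivative. -/
theorem exists_cutoff (x : M) {ε : ℝ} (hε : 0 < ε) : ∃ χ : M → ℝ,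
    ContMDiff (𝓡 N) 𝓘(ℝ, ℝ) 1 χ ∧ HasCompactSupport χ ∧ χ x = 1 ∧
    (∀ y, 0 ≤ χ y ∧ χ y ≤ 1 + ε) ∧ ∀ y, GradLE N χ ε y := by
  obtain ⟨u, hu, hux⟩ := exists_isTent_gt (N := N) x ε⁻¹
  have hm0 : 0 < u x := (inv_pos.2 hε).trans hux
  obtain ⟨h, h', h1, hd, hh, hz, hb⟩ := exists_soft_posPart hε
  -- A soft `min t 1` with slope in `[0, 1]`. Applied to `u` divided by its height `u x > ε⁻¹`, it
  -- has gradient at most `ε`.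
  set τ : ℝ → ℝ := fun t => t - h (t - 1) with hτ
  have hτs : ContDiff ℝ 1 τ := contDiff_id.sub (h1.comp (contDiff_id.sub contDiff_const))
  have hτd : ∀ t, HasDerivAt τ (1 - h' (t - 1)) t := fun t =>
    (hasDerivAt_id t).sub ((hd (t - 1)).comp_sub_const t 1)
  have hsc : ContDiff ℝ 1 fun t : ℝ => τ ((u x)⁻¹ * t) := hτs.comp (by fun_prop)
  refine ⟨fun y => τ ((u x)⁻¹ * u y), hsc.contMDiff.comp hu.contMDiff, ?_, ?_, fun y => ?_,
    fun y => ?_⟩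
  · exact hu.hasCompactSupport.comp_left (g := fun t => τ ((u x)⁻¹ * t))
      (by simp [hτ, hz (-1) (by norm_num)])
  · simp [hτ, inv_mul_cancel₀ hm0.ne', hz 0 le_rfl]
  · have ht : 0 ≤ (u x)⁻¹ * u y := mul_nonneg (inv_nonneg.2 hm0.le) (hu.nonneg y)
    set t := (u x)⁻¹ * u y
    refine ⟨?_, ?_⟩
    · rcases le_total t 1 with h1t | h1t
      · change 0 ≤ t - h (t - 1)
        rw [hz (t - 1) (by linarith)]
        linarith
      · have := (hb (t - 1)).2.2 (by linarith)
        change 0 ≤ t - h (t - 1)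
        linarith
    · have := (hb (t - 1)).2.1
      change t - h (t - 1) ≤ 1 + ε
      linarith
  · obtain ⟨L, hL, hL'⟩ := hu.grad y
    have e := ((hτd ((u x)⁻¹ * u y)).comp (u y) ((hasDerivAt_id (u y)).const_mul (u x)⁻¹))
    have e2 := e.hasFDerivAt.hasMFDerivAt.comp y hL
    refine ⟨_, e2, fun v => ?_⟩
    obtain ⟨t0, t1⟩ := hh ((u x)⁻¹ * u y - 1)
    set t := h' ((u x)⁻¹ * u y - 1)
    have e3 : (ContinuousLinearMap.toSpanSingleton ℝ ((1 - t) * ((u x)⁻¹ * 1))).comp L v =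
        (1 - t) * (u x)⁻¹ * L v := by
      simp
      ring
    refine (le_of_eq (congrArg abs e3)).trans ?_
    have h5 : (u x)⁻¹ ≤ ε := by
      rw [inv_le_comm₀ hm0 hε]
      exact hux.le
    have h6 : 0 ≤ (u x)⁻¹ := by positivity
    rw [abs_mul, abs_mul, abs_of_nonneg (sub_nonneg.2 t1), abs_of_nonneg h6]
    have h7 := hL' v
    rw [one_mul] at h7
    refine mul_le_mul ?_ h7 (abs_nonneg _) hε.le
    nlinarith

end Cutoff

end OpStarMod

namespace OpStarMod

open MatrixNorm HermForm RightAction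

/-! ### Test functions in `C¹₀(M, E)` -/

section Bumps

variable {N : ℕ} {M : Type*} [TopologicalSpace M] [ChartedSpace (EuclideanSpace ℝ (Fin N)) M]
  [RiemannianBundle (fun x : M => TangentSpace (𝓡 N) x)]
  {E : Type*} [NormedAddCommGroup E] [InnerProductSpace ℂ E]

theorem mem_C10_of_hasCompactSupport {f : M → E} (hf : ContMDiff (𝓡 N) 𝓘(ℝ, E) 1 f)
    (hc : HasCompactSupport f) : f ∈ C10 N M E := by
  refine ⟨hf, fun ε hε => ⟨tsupport f, hc, fun x hx => ?_⟩⟩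
  have h0 : f =ᶠ[𝓝 x] fun _ => (0 : E) := notMem_tsupport_iff_eventuallyEq.1 hx
  have h1 : deRham N f x = 0 :=
    deRham_eq ((hasMFDerivAt_const (I := 𝓡 N) (I' := 𝓘(ℝ, E)) (0 : E) x).congr_of_eventuallyEq h0)
  simpa [h0.eq_of_nhds, h1] using hε

theorem contMDiff_smul_const {χ : M → ℝ} (hχ : ContMDiff (𝓡 N) 𝓘(ℝ, ℝ) 1 χ) (ξ : E) :
    ContMDiff (𝓡 N) 𝓘(ℝ, E) 1 (fun y => χ y • ξ) :=
  (ContinuousLinearMap.toSpanSingleton ℝ ξ).contDiff.contMDiff.comp hχ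

/-- The function `y ↦ χ(y) ξ`, for a cutoff function `χ`. -/
def bumpVec {χ : M → ℝ} (hχ : ContMDiff (𝓡 N) 𝓘(ℝ, ℝ) 1 χ) (hc : HasCompactSupport χ) (ξ : E) :
    C10 N M E :=
  ⟨fun y => χ y • ξ, mem_C10_of_hasCompactSupport (contMDiff_smul_const hχ ξ) (hc.smul_right)⟩

theorem norm_deRham_smul_const_le {χ : M → ℝ} {ε : ℝ} (hε : 0 ≤ ε) {y : M} (h : GradLE N χ ε y)
    (ξ : E) : ‖deRham N (fun y => χ y • ξ) y‖ ≤ √N * ε * ‖ξ‖ := by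
  obtain ⟨L, hL, hL'⟩ := h
  have e := (ContinuousLinearMap.toSpanSingleton ℝ ξ).hasMFDerivAt.comp y hL
  have e2 : deRham N (fun y => χ y • ξ) y =
    frameVec (E := E) ((ContinuousLinearMap.toSpanSingleton ℝ ξ).comp L) := deRham_eq e
  rw [e2, mul_assoc]
  refine frameVec_le_of_bound _ (by positivity) fun v => ?_
  have : ‖L v • ξ‖ ≤ ε * ‖v‖ * ‖ξ‖ := by
    rw [norm_smul]
    exact mul_le_mul_of_nonneg_right (hL' v) (norm_nonneg _)
  calc _ = ‖L v • ξ‖ := rfl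
    _ ≤ ε * ‖v‖ * ‖ξ‖ := this
    _ = _ := by ring

variable [IsManifold (𝓡 N) ∞ M] [T2Space M]

variable (N) in
theorem exists_bump (x : M) : ∃ χ : M → ℝ, ContMDiff (𝓡 N) 𝓘(ℝ, ℝ) 1 χ ∧ HasCompactSupport χ ∧
    χ =ᶠ[𝓝 x] fun _ => 1 := by
  obtain ⟨f⟩ : Nonempty (SmoothBumpFunction (𝓡 N) x) := inferInstance
  exact ⟨f, f.contMDiff.of_le (by exact_mod_cast le_top), f.hasCompactSupport, f.eventuallyEq_one⟩

end Bumps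

/-! ### The symbol of an adjointable map -/

section Symbols

variable {N : ℕ} {M : Type*} [MetricSpace M]
    [ChartedSpace (EuclideanSpace ℝ (Fin N)) M] [IsManifold (𝓡 N) ∞ M]
    [RiemannianBundle (fun x : M => TangentSpace (𝓡 N) x)]
  {H G : Type*} [NormedAddCommGroup H] [InnerProductSpace ℂ H]
  [NormedAddCommGroup G] [InnerProductSpace ℂ G]

/-- A map with an adjoint acts pointwise. -/
theorem IsAdjoint.apply_eq_zero {T : C10 N M H →ₗ[ℂ] C10 N M G} {S : C10 N M G →ₗ[ℂ] C10 N M H}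
    (hTS : IsAdjoint T S) {s : C10 N M H} {x : M} (hs : s.1 x = 0) : (T s).1 x = 0 := by
  obtain ⟨χ, h1, h2, h3⟩ := exists_bump N x
  have h := congrFun (hTS s (bumpVec h1 h2 ((T s).1 x))) x
  change inner ℂ ((T s).1 x) (χ x • (T s).1 x) = inner ℂ (s.1 x) _ at h
  rw [h3.eq_of_nhds, one_smul, hs, inner_zero_left] at h
  exact inner_self_eq_zero.1 h

/-- Only the `1 × 1` level of the cb-norm is needed: rescale `s` by `C⁻¹`, which forces the separate
case `C = 0`. -/
theorem norm_jet_apply_le {T : C10 N M H →ₗ[ℂ] C10 N M G} (hT : cbNorm T < ⊤) {s : C10 N M H}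
    {C : ℝ} (hC : 0 ≤ C) (hs : ∀ x, ‖jetAt x s‖ ≤ C) (x : M) :
    ‖jetAt x (T s)‖ ≤ (cbNorm T).toReal * C := by
  rcases hC.eq_or_lt with rfl | hC
  · have h0 : s = 0 := by
      ext y
      exact norm_le_zero_iff.1 ((WithLp.norm_fst_le _ (jetAt y s)).trans (hs y))
    simp [h0]
  · set ξ : Matrix (Fin 1) (Fin 1) (C10 N M H) := fun _ _ => ((C⁻¹ : ℝ) : ℂ) • s with hξ
    have hnorm : ‖((C⁻¹ : ℝ) : ℂ)‖ = C⁻¹ := by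
      rw [Complex.norm_real, Real.norm_eq_abs, abs_of_pos (inv_pos.2 hC)]
    have h1 : mnorm ξ ≤ 1 := by
      refine iSup_le fun y => ?_
      rw [vecNorm_unique, ← ofReal_norm, ENNReal.ofReal_le_one]
      change ‖jetAt y (((C⁻¹ : ℝ) : ℂ) • s)‖ ≤ 1
      rw [map_smul, norm_smul, hnorm, inv_mul_le_one₀ hC]
      exact hs y
    have h2 : mnorm (ξ.map T) ≤ cbNorm T :=
      (le_iSup₂ (f := fun (ξ : Matrix (Fin 1) (Fin 1) (C10 N M H)) (_ : mnorm ξ ≤ 1) =>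
        mnorm (ξ.map T)) ξ h1).trans (le_iSup (fun n : ℕ => ⨆ (ξ : Matrix (Fin n) (Fin n)
          (C10 N M H)) (_ : mnorm ξ ≤ 1), mnorm (ξ.map T)) 1)
    have h3 := (le_iSup (fun y : M => vecNorm ((ξ.map T).map (jetAt y))) x).trans h2
    rw [vecNorm_unique] at h3
    have h4 : ‖jetAt x (T (((C⁻¹ : ℝ) : ℂ) • s))‖ ≤ (cbNorm T).toReal := by
      rw [← toReal_enorm]
      exact ENNReal.toReal_mono hT.ne h3
    rw [map_smul, map_smul, norm_smul, hnorm, inv_mul_le_iff₀ hC] at h4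
    linarith

variable [IsContMDiffRiemannianBundle (𝓡 N) ∞ (EuclideanSpace ℝ (Fin N))
      (fun x : M => TangentSpace (𝓡 N) x)]
    [IsRiemannianManifold (𝓡 N) M] [CompleteSpace M]

variable (N) in
/-- Cutoff functions at `x` bring the norm of `T` to bear on values and derivatives at `x`. -/
theorem exists_cutoff_jet (x : M) {ε : ℝ} (hε : 0 < ε) : ∃ (χ : M → ℝ)
    (h1 : ContMDiff (𝓡 N) 𝓘(ℝ, ℝ) 1 χ) (h2 : HasCompactSupport χ), χ x = 1 ∧ GradLE N χ ε x ∧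
    ∀ (T : C10 N M H →ₗ[ℂ] C10 N M G), cbNorm T < ⊤ → ∀ ξ : H,
      ‖jetAt x (T (bumpVec h1 h2 ξ))‖ ≤ (cbNorm T).toReal * ((1 + ε + √N * ε) * ‖ξ‖) := by
  obtain ⟨χ, h1, h2, h3, h4, h5⟩ := exists_cutoff (N := N) x hε
  refine ⟨χ, h1, h2, h3, h5 x, fun T hT ξ => norm_jet_apply_le hT (by positivity) (fun y => ?_) x⟩
  refine (prodLp_norm_le _).trans ?_
  have e1 : ‖χ y • ξ‖ ≤ (1 + ε) * ‖ξ‖ := by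
    rw [norm_smul, Real.norm_eq_abs, abs_of_nonneg (h4 y).1]
    exact mul_le_mul_of_nonneg_right (h4 y).2 (norm_nonneg _)
  have e2 := norm_deRham_smul_const_le hε.le (h5 y) ξ
  change ‖χ y • ξ‖ + ‖deRham N (fun y => χ y • ξ) y‖ ≤ _
  linarith

/-- At `x` the jet of `T(χξ) = χ · αξ` differs from that of `αξ` only by `(0, dχ ⊗ α(x)ξ)`, which is
`O(ε)`. The constant is exactly the cb-norm because the jets of `χξ` are bounded on all of `M` by
`(1 + O(ε)) ‖ξ‖`. -/
theorem norm_jet_symbol_le {T : C10 N M H →ₗ[ℂ] C10 N M G} (hT : cbNorm T < ⊤)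
    {α : M → (H →L[ℂ] G)} (hα : StronglyDiff (N := N) α)
    (h : ∀ s x, (T s).1 x = α x (s.1 x)) (x : M) (ξ : H) :
    ‖jet N (fun y => α y ξ) x‖ ≤ (cbNorm T).toReal * ‖ξ‖ := by
  set c := (cbNorm T).toReal with hc
  have hc0 : 0 ≤ c := ENNReal.toReal_nonneg
  have key : ∀ ε : ℝ, 0 < ε → ‖jet N (fun y => α y ξ) x‖ ≤
      (1 + √N * ε) * (c * ((1 + ε + √N * ε) * ‖ξ‖)) := by
    intro ε hε
    obtain ⟨χ, h1, h2, h3, h4, h5⟩ := exists_cutoff_jet N (H := H) (G := G) x hε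
    have e1 := h5 T hT ξ
    have hval : (T (bumpVec h1 h2 ξ)).1 = fun y => (χ y • (1 : ℂ)) • α y ξ := by
      funext y
      rw [h]
      change α y (χ y • ξ) = _
      rw [smul_assoc, one_smul, ContinuousLinearMap.map_smul_of_tower]
    have e2 := deRham_smul_fun (contMDiff_smul_const h1 (1 : ℂ)) (hα ξ) x
    rw [← hval, h3, one_smul, one_smul] at e2
    set D : Cot N G := WithLp.toLp 2 (fun i => deRham N (fun y => χ y • (1 : ℂ)) x i • α x ξ)
    have hx : (T (bumpVec h1 h2 ξ)).1 x = α x ξ := by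
      rw [congrFun hval x, h3, one_smul, one_smul]
    have hD : ‖D‖ ≤ √N * ε * ‖α x ξ‖ := by
      have e3 := norm_deRham_smul_const_le hε.le h4 (1 : ℂ)
      rw [norm_one, mul_one] at e3
      have e4 : ‖D‖ = ‖deRham N (fun y => χ y • (1 : ℂ)) x‖ * ‖α x ξ‖ := by
        rw [PiLp.norm_eq_of_L2, PiLp.norm_eq_of_L2, ← Real.sqrt_sq (norm_nonneg (α x ξ)),
          ← Real.sqrt_mul (by positivity), Finset.sum_mul]
        simp [D, norm_smul, mul_pow]
      rw [e4]
      exact mul_le_mul_of_nonneg_right e3 (norm_nonneg _)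
    have e5 : jet N (fun y => α y ξ) x =
        jetAt x (T (bumpVec h1 h2 ξ)) - WithLp.toLp 2 ((0 : G), D) := by
      change WithLp.toLp 2 (α x ξ, deRham N (fun y => α y ξ) x) =
        WithLp.toLp 2 ((T (bumpVec h1 h2 ξ)).1 x, deRham N (T (bumpVec h1 h2 ξ)).1 x) -
          WithLp.toLp 2 ((0 : G), D)
      rw [e2, hx, ← WithLp.toLp_sub, Prod.mk_sub_mk, sub_zero, add_sub_cancel_right]
    have e6 : ‖α x ξ‖ ≤ ‖jetAt x (T (bumpVec h1 h2 ξ))‖ := by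
      rw [← hx]
      exact WithLp.norm_fst_le _ (jetAt x (T (bumpVec h1 h2 ξ)))
    have e7 : ‖(WithLp.toLp 2 ((0 : G), D) : Jet N G)‖ = ‖D‖ := by
      rw [WithLp.prod_norm_eq_of_L2]
      simp
    rw [e5]
    refine (norm_sub_le _ _).trans ?_
    rw [e7]
    have hNε : 0 ≤ √N * ε := by positivity
    nlinarith [mul_le_mul_of_nonneg_left e6 hNε, mul_le_mul_of_nonneg_left e1 hNε]
  have hcont : Continuous fun ε : ℝ => (1 + √N * ε) * (c * ((1 + ε + √N * ε) * ‖ξ‖)) := by fun_prop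
  have hlim := (hcont.tendsto 0).mono_left (nhdsWithin_le_nhds (s := Set.Ioi (0 : ℝ)))
  simp only [mul_zero, add_zero, one_mul] at hlim
  exact ge_of_tendsto hlim (by filter_upwards [self_mem_nhdsWithin] with ε hε using key ε hε)

/-- Split `π(α)(x)` into its two columns `(α, dα)` and `(0, α ⊗ 1)`; each has norm at most the
cb-norm of `T`. -/
theorem oneNorm_le_two_mul_cbNorm {T : C10 N M H →ₗ[ℂ] C10 N M G} (hT : cbNorm T < ⊤)
    {α : M → (H →L[ℂ] G)} (hα : StronglyDiff (N := N) α)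
    (h : ∀ s x, (T s).1 x = α x (s.1 x)) : oneNorm N α ≤ 2 * cbNorm T := by
  refine iSup_le fun x => iSup₂_le fun v hv => ?_
  set c := (cbNorm T).toReal with hc
  have hc0 : 0 ≤ c := ENNReal.toReal_nonneg
  have h1 := norm_jet_symbol_le hT hα h x
  have h2 : ∀ ξ, ‖α x ξ‖ ≤ c * ‖ξ‖ := fun ξ =>
    (WithLp.norm_fst_le _ (jet N (fun y => α y ξ) x)).trans (h1 ξ)
  have h3 := norm_ampCot_le (N := N) (α x) hc0 h2 v.snd
  have e : piOp α x v = jet N (fun y => α y v.fst) x +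
      WithLp.toLp 2 ((0 : G), ampCot (α x) v.snd) := by
    change WithLp.toLp 2 (α x v.fst, strongDeRham α x v.fst + ampCot (α x) v.snd) =
      WithLp.toLp 2 (α x v.fst, strongDeRham α x v.fst) + _
    exact congrArg (fun g : G => (WithLp.toLp 2 (g, strongDeRham α x v.fst +
      ampCot (α x) v.snd) : Jet N G)) (add_zero (α x v.fst)).symm
  have e7 : ‖(WithLp.toLp 2 ((0 : G), ampCot (α x) v.snd) : Jet N G)‖ = ‖ampCot (α x) v.snd‖ := by
    rw [WithLp.prod_norm_eq_of_L2]
    simp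
  have h4 : ‖piOp α x v‖ ≤ 2 * c := by
    rw [e]
    refine (norm_add_le _ _).trans ?_
    rw [e7]
    have n1 := mul_le_mul_of_nonneg_left ((WithLp.norm_fst_le _ v).trans hv) hc0
    have n2 := mul_le_mul_of_nonneg_left ((WithLp.norm_snd_le _ v).trans hv) hc0
    linarith [h1 v.fst]
  rw [← ofReal_norm]
  refine (ENNReal.ofReal_le_ofReal h4).trans (le_of_eq ?_)
  rw [ENNReal.ofReal_mul zero_le_two, ENNReal.ofReal_toReal hT.ne, ENNReal.ofReal_ofNat]

/-- Adjointable bounded maps are given by bounded operators on the values. -/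
theorem exists_pointwise {T : C10 N M H →ₗ[ℂ] C10 N M G} (hT : cbNorm T < ⊤)
    {S : C10 N M G →ₗ[ℂ] C10 N M H} (hTS : IsAdjoint T S) :
    ∃ α : M → (H →L[ℂ] G), ∀ s x, (T s).1 x = α x (s.1 x) := by
  -- Any `ε` would do: only continuity of `α(x)` is needed here, not a sharp bound.
  choose χ h1 h2 h3 _ h5 using fun x : M => exists_cutoff_jet N (H := H) (G := G) x one_pos
  let A : M → (H →ₗ[ℂ] G) := fun x =>
    { toFun := fun ξ => (T (bumpVec (h1 x) (h2 x) ξ)).1 x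
      map_add' := fun ξ η => by
        have : bumpVec (h1 x) (h2 x) (ξ + η) = bumpVec (h1 x) (h2 x) ξ + bumpVec (h1 x) (h2 x) η :=
          Subtype.ext (funext fun y => smul_add _ _ _)
        rw [this, map_add]
        rfl
      map_smul' := fun c ξ => by
        have : bumpVec (h1 x) (h2 x) (c • ξ) = c • bumpVec (h1 x) (h2 x) ξ :=
          Subtype.ext (funext fun y => smul_comm _ _ _)
        rw [this, map_smul]
        rfl }
  refine ⟨fun x => (A x).mkContinuous ((cbNorm T).toReal * (1 + 1 + √N * 1)) fun ξ => ?_,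
    fun s x => ?_⟩
  · rw [mul_assoc]
    exact (WithLp.norm_fst_le _ (jetAt x (T (bumpVec (h1 x) (h2 x) ξ)))).trans (h5 x T hT ξ)
  · have h0 : (s - bumpVec (h1 x) (h2 x) (s.1 x)).1 x = 0 := by
      change s.1 x - χ x x • s.1 x = 0
      rw [h3, one_smul, sub_self]
    have := hTS.apply_eq_zero h0
    rw [map_sub] at this
    exact sub_eq_zero.1 this

/-- Near `p`, `αξ` coincides with `T(χξ)`. This needs a bump equal to 1 on a neighbourhood; the
cutoffs of small slope are known to be 1 only at the point. -/
theorem stronglyDiff_of_pointwise {T : C10 N M H →ₗ[ℂ] C10 N M G} {α : M → (H →L[ℂ] G)}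
    (h : ∀ s x, (T s).1 x = α x (s.1 x)) : StronglyDiff (N := N) α := by
  intro ξ p
  obtain ⟨χ, h1, h2, h3⟩ := exists_bump N p
  refine ((T (bumpVec h1 h2 ξ)).2.1 p).congr_of_eventuallyEq ?_
  filter_upwards [h3] with y hy
  rw [h]
  change α y ξ = α y (χ y • ξ)
  rw [hy, one_smul]

variable [CompleteSpace H] [CompleteSpace G]

/-- `S` has a symbol as well, and the hermitian forms identify it with `α(x)*`; so strong
differentiability of `α*` is that of the symbol of `S`. -/
theorem exists_symbol {T : C10 N M H →ₗ[ℂ] C10 N M G} (hT : cbNorm T < ⊤)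
    {S : C10 N M G →ₗ[ℂ] C10 N M H} (hS : cbNorm S < ⊤) (hTS : IsAdjoint T S) :
    ∃ α : C1b N M H G, ∀ s x, (T s).1 x = α.1 x (s.1 x) := by
  have hST : IsAdjoint S T := by
    intro t s
    funext x
    have := congrArg (starRingEnd ℂ) (congrFun (hTS s t) x)
    change (starRingEnd ℂ) (inner ℂ _ _) = (starRingEnd ℂ) (inner ℂ _ _) at this
    rw [inner_conj_symm, inner_conj_symm] at this
    exact this.symm
  obtain ⟨α, hα⟩ := exists_pointwise hT hTS
  obtain ⟨β, hβ⟩ := exists_pointwise hS hST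
  have hadj : ∀ x, β x = ContinuousLinearMap.adjoint (α x) := by
    intro x
    rw [ContinuousLinearMap.eq_adjoint_iff]
    intro η ξ
    obtain ⟨χ, h1, h2, h3⟩ := exists_bump N x
    have h := congrFun (hST (bumpVec h1 h2 η) (bumpVec h1 h2 ξ)) x
    change inner ℂ ((S (bumpVec h1 h2 η)).1 x) (χ x • ξ) =
      inner ℂ (χ x • η) ((T (bumpVec h1 h2 ξ)).1 x) at h
    rw [hα, hβ] at h
    change inner ℂ (β x (χ x • η)) (χ x • ξ) = inner ℂ (χ x • η) (α x (χ x • ξ)) at h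
    simpa [h3.eq_of_nhds] using h
  have hsd := stronglyDiff_of_pointwise hα
  refine ⟨⟨α, ⟨hsd, ?_⟩, ?_⟩, hα⟩
  · rw [show (fun x => ContinuousLinearMap.adjoint (α x)) = β from funext fun x => (hadj x).symm]
    exact stronglyDiff_of_pointwise hβ
  · rw [supNorm_lt_top_iff_oneNorm_lt_top hsd]
    exact (oneNorm_le_two_mul_cbNorm hT hsd hα).trans_lt
      (ENNReal.mul_lt_top ENNReal.ofNat_lt_top hT)

/-- The adjoint symbol. -/
def C1b.adjoint (α : C1b N M H G) : C1b N M G H :=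
  ⟨fun x => ContinuousLinearMap.adjoint (α.1 x), ⟨α.2.1.2, by simpa using α.2.1.1⟩, by
    obtain ⟨K, hK⟩ := exists_jetBoundedBy_of_supNorm α.2.1.1 α.2.2
    exact (hK.adjoint α.2.1).supNorm_lt_top⟩

/-- The operator of multiplication by a symbol. -/
def C1b.op (α : C1b N M H G) : C10 N M H →ₗ[ℂ] C10 N M G :=
  (exists_jetBoundedBy_of_supNorm α.2.1.1 α.2.2).choose_spec.mulOp α.2.1.1

theorem C1b.op_apply (α : C1b N M H G) (s : C10 N M H) (x : M) :
    (α.op s).1 x = α.1 x (s.1 x) := rfl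

theorem C1b.isModuleMorphism_op (α : C1b N M H G) : IsModuleMorphism (C10 N M ℂ) α.op :=
  JetBoundedBy.isModuleMorphism_mulOp _ _

theorem C1b.isAdjoint_op (α : C1b N M H G) : IsAdjoint α.op α.adjoint.op := by
  intro s t
  funext x
  exact (ContinuousLinearMap.adjoint_inner_right (α.1 x) (s.1 x) (t.1 x)).symm

/-- The morphism given by a symbol. -/
def C1b.toMor (α : C1b N M H G) : Mor (C10 N M ℂ) (C10 N M H) (C10 N M G) :=
  ⟨α.op, α.isModuleMorphism_op, α.adjoint.op, α.adjoint.isModuleMorphism_op, α.isAdjoint_op⟩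

theorem C1b.toMor_bijective : Function.Bijective (C1b.toMor (N := N) (M := M) (H := H) (G := G)) := by
  constructor
  · intro α β hαβ
    refine Subtype.ext (funext fun x => ContinuousLinearMap.ext fun ξ => ?_)
    obtain ⟨χ, h1, h2, h3⟩ := exists_bump N x
    have h := congrArg (fun T : Mor (C10 N M ℂ) (C10 N M H) (C10 N M G) =>
      (T.1 (bumpVec h1 h2 ξ)).1 x) hαβ
    change α.1 x (χ x • ξ) = β.1 x (χ x • ξ) at h
    rwa [h3.eq_of_nhds, one_smul] at h
  · rintro ⟨T, hT, S, hS, hTS⟩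
    obtain ⟨α, hα⟩ := exists_symbol hT.2 hS.2 hTS
    exact ⟨α, Subtype.ext (LinearMap.ext fun s => Subtype.ext (funext fun x => (hα s x).symm))⟩

/-- Uniqueness: test both adjoints against the difference of their values; the form is pointwise
definite. -/
theorem C1b.isAdjoint_iff (α : C1b N M H G) (S : C10 N M G →ₗ[ℂ] C10 N M H) :
    IsAdjoint α.op S ↔ S = α.adjoint.op := by
  constructor
  · intro h
    refine LinearMap.ext fun t => Subtype.ext (funext fun x => ?_)
    have h1 := congrFun (h (S t - α.adjoint.op t) t) x
    rw [α.isAdjoint_op] at h1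
    change inner ℂ ((S t).1 x - (α.adjoint.op t).1 x) ((α.adjoint.op t).1 x) =
      inner ℂ ((S t).1 x - (α.adjoint.op t).1 x) ((S t).1 x) at h1
    rw [eq_comm, ← sub_eq_zero, ← inner_sub_right, inner_self_eq_zero, sub_eq_zero] at h1
    exact h1
  · rintro rfl
    exact α.isAdjoint_op

theorem C1b.cbNorm_op_le (α : C1b N M H G) : cbNorm α.op ≤ oneNorm N α.1 :=
  JetBoundedBy.cbNorm_mulOp_le _ _

theorem C1b.oneNorm_le (α : C1b N M H G) : oneNorm N α.1 ≤ 2 * cbNorm α.op :=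
  oneNorm_le_two_mul_cbNorm α.isModuleMorphism_op.2 α.2.1.1 α.op_apply

end Symbols

end OpStarMod

namespace OpStarMod

open MatrixNorm HermForm RightAction

/-! ### Completeness of `C¹₀(M, E)` -/

section Completeness

variable {N : ℕ} {M : Type*} [TopologicalSpace M] [ChartedSpace (EuclideanSpace ℝ (Fin N)) M]
  [RiemannianBundle (fun x : M => TangentSpace (𝓡 N) x)] [IsManifold (𝓡 N) ∞ M]
  [IsContMDiffRiemannianBundle (𝓡 N) ∞ (EuclideanSpace ℝ (Fin N))
      (fun x : M => TangentSpace (𝓡 N) x)]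
  {E : Type*} [NormedAddCommGroup E] [InnerProductSpace ℂ E]

theorem deRham_sub {f g : M → E} (hf : ContMDiff (𝓡 N) 𝓘(ℝ, E) 1 f)
    (hg : ContMDiff (𝓡 N) 𝓘(ℝ, E) 1 g) (x : M) :
    deRham N (f - g) x = deRham N f x - deRham N g x := by
  rw [deRham_eq ((hasMFDerivAt_of hf x).sub (hasMFDerivAt_of hg x))]
  rfl

/-- Locally uniform limits of `C¹`-maps, with uniform convergence of the jets, are `C¹`. -/
theorem jet_of_tendsto [CompleteSpace E] {u : ℕ → M → E}
    (hu : ∀ n, ContMDiff (𝓡 N) 𝓘(ℝ, E) 1 (u n)) {j : M → Jet N E}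
    (hj : ∀ ε : ℝ, 0 < ε → ∃ n₀, ∀ n ≥ n₀, ∀ x, ‖jet N (u n) x - j x‖ ≤ ε) :
    ContMDiff (𝓡 N) 𝓘(ℝ, E) 1 (fun x => (j x).fst) ∧
      ∀ x, jet N (fun x => (j x).fst) x = j x := by
  set f : M → E := fun x => (j x).fst with hf
  have hval : ∀ x, Tendsto (fun n => jet N (u n) x) atTop (𝓝 (j x)) := fun x => by
    rw [Metric.tendsto_atTop']
    intro ε hε
    obtain ⟨n₀, hn₀⟩ := hj (ε / 2) (half_pos hε)
    refine ⟨n₀, fun n hn => ?_⟩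
    rw [dist_eq_norm]
    exact (hn₀ n hn.le x).trans_lt (half_lt_self hε)
  have hfst : ∀ x, Tendsto (fun n => u n x) atTop (𝓝 (f x)) := fun x =>
    ((WithLp.continuous_fst (p := 2) (α := E) (β := Cot N E)).tendsto (j x)).comp (hval x)
  have hsnd : ∀ x, Tendsto (fun n => deRham N (u n) x) atTop (𝓝 (j x).snd) := fun x =>
    ((WithLp.continuous_snd (p := 2) (α := E) (β := Cot N E)).tendsto (j x)).comp (hval x)
  have main : ∀ p : M, ContDiffAt ℝ 1 (f ∘ (extChartAt (𝓡 N) p).symm) (extChartAt (𝓡 N) p p) ∧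
      deRham N f p = (j p).snd := by
    intro p
    set φ := extChartAt (𝓡 N) p with hφ
    obtain ⟨C, hC0, hC⟩ := frameVec_comparable (N := N) E p
    have hcont : Tendsto φ.symm (𝓝 (φ p)) (𝓝 p) := by
      have := continuousAt_extChartAt_symm (I := 𝓡 N) p
      rwa [ContinuousAt, extChartAt_to_inv] at this
    obtain ⟨r, hr, hball⟩ := Metric.eventually_nhds_iff_ball.1
      ((hcont.eventually hC).and
        ((isOpen_extChartAt_target p).mem_nhds (mem_extChartAt_target p)))
    set U := Metric.ball (φ p) r with hU
    set d : ℕ → EuclideanSpace ℝ (Fin N) → (EuclideanSpace ℝ (Fin N) →L[ℝ] E) :=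
      fun n z => fderiv ℝ (u n ∘ φ.symm) z with hd
    have hdd : ∀ n, ∀ z ∈ U, HasFDerivAt (u n ∘ φ.symm) (d n z) z := fun n z hz =>
      hasFDerivAt_chart (hu n) (hball z hz).2
    -- Chart derivatives are controlled by jets, so they are uniformly Cauchy near `φ p`; the
    -- theorem on derivatives of convergent sequences then applies.
    have hdiff : ∀ n m, ∀ z ∈ U,
        ‖d n z - d m z‖ ≤ C * ‖jet N (u n) (φ.symm z) - jet N (u m) (φ.symm z)‖ := by
      intro n m z hz
      obtain ⟨⟨hzs, hzC⟩, hzt⟩ := hball z hz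
      have e1 := (hdd n z hz).sub (hdd m z hz)
      have e2 : deRham N (u n - u m) (φ.symm z) = _ := deRham_eq_chart hzs (by
        rw [φ.right_inv hzt]
        exact e1)
      have e3 := (hzC (d n z - d m z)).2
      rw [← e2, deRham_sub (hu n) (hu m)] at e3
      refine e3.trans (mul_le_mul_of_nonneg_left ?_ hC0.le)
      exact WithLp.norm_snd_le _ (jet N (u n) (φ.symm z) - jet N (u m) (φ.symm z))
    have hcauchy : UniformCauchySeqOn d atTop U := by
      rw [Metric.uniformCauchySeqOn_iff]
      intro ε hε
      obtain ⟨n₀, hn₀⟩ := hj (ε / (4 * C)) (by positivity)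
      refine ⟨n₀, fun m hm n hn z hz => ?_⟩
      rw [dist_eq_norm]
      refine (hdiff m n z hz).trans_lt ?_
      have e1 := hn₀ m hm (φ.symm z)
      have e2 := hn₀ n hn (φ.symm z)
      rw [norm_sub_rev] at e2
      have e3 := norm_sub_le_norm_sub_add_norm_sub (jet N (u m) (φ.symm z)) (j (φ.symm z))
        (jet N (u n) (φ.symm z))
      calc _ ≤ C * (ε / (4 * C) + ε / (4 * C)) :=
            mul_le_mul_of_nonneg_left (e3.trans (add_le_add e1 e2)) hC0.le
        _ = ε / 2 := by field_simp; norm_num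
        _ < ε := half_lt_self hε
    have hlim : ∀ z ∈ U, ∃ L, Tendsto (fun n => d n z) atTop (𝓝 L) := fun z hz =>
      cauchySeq_tendsto_of_complete (hcauchy.cauchySeq hz)
    choose! D hD using hlim
    have hunif : TendstoUniformlyOn d D atTop U := hcauchy.tendstoUniformlyOn_of_tendsto hD
    have hDd : ∀ z ∈ U, HasFDerivAt (f ∘ φ.symm) (D z) z :=
      fun z hz => hasFDerivAt_of_tendstoUniformlyOn Metric.isOpen_ball hunif
        (fun n z hz => hdd n z hz) (fun z _ => hfst _) hz
    have hDc : ContinuousOn D U := hunif.continuousOn (Frequently.of_forall fun n =>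
      ((contDiffOn_chart (hu n) p).continuousOn_fderiv_of_isOpen (isOpen_extChartAt_target p)
        le_rfl).mono fun z hz => (hball z hz).2)
    have hpU : φ p ∈ U := Metric.mem_ball_self hr
    refine ⟨contDiffAt_one_iff.2 ⟨D, U, Metric.isOpen_ball.mem_nhds hpU, hDc, hDd⟩, ?_⟩
    have hps := mem_chart_source (EuclideanSpace ℝ (Fin N)) p
    have e1 := deRham_eq_chart hps (hDd _ hpU)
    ext i
    refine tendsto_nhds_unique (f := fun n => deRham N (u n) p i) (l := atTop) ?_
      (((PiLp.continuous_apply 2 (fun _ : Fin N => E) i).tendsto _).comp (hsnd p))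
    rw [e1]
    have e2 : ∀ n, deRham N (u n) p i = d n (φ p) (mfderiv (𝓡 N)
        𝓘(ℝ, EuclideanSpace ℝ (Fin N)) φ p (frame N p i)) := fun n => by
      rw [deRham_eq_chart hps (hdd n _ hpU)]
      rfl
    simp_rw [e2]
    exact ((ContinuousLinearMap.apply ℝ E _).continuous.tendsto _).comp (hD _ hpU)
  refine ⟨fun p => contMDiffAt_of_chart (main p).1, fun x => ?_⟩
  change WithLp.toLp 2 ((j x).fst, deRham N f x) = j x
  rw [(main x).2]
  rfl

/-- `C¹₀(M, E)` is complete. -/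
theorem C10_complete [CompleteSpace E] {u : ℕ → C10 N M E}
    (hu : ∀ ε : ℝ, 0 < ε → ∃ n₀, ∀ n ≥ n₀, ∀ m ≥ n₀, ∀ x, ‖jetAt x (u n) - jetAt x (u m)‖ ≤ ε) :
    ∃ s : C10 N M E, ∀ x, Tendsto (fun n => jetAt x (u n)) atTop (𝓝 (jetAt x s)) := by
  have hlim : ∀ x, ∃ w, Tendsto (fun n => jetAt x (u n)) atTop (𝓝 w) := fun x => by
    refine cauchySeq_tendsto_of_complete (Metric.cauchySeq_iff.2 fun ε hε => ?_)
    obtain ⟨n₀, hn₀⟩ := hu (ε / 2) (half_pos hε)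
    refine ⟨n₀, fun m hm n hn => ?_⟩
    rw [dist_eq_norm]
    exact (hn₀ m hm n hn x).trans_lt (half_lt_self hε)
  choose j hj using hlim
  have hunif : ∀ ε : ℝ, 0 < ε → ∃ n₀, ∀ n ≥ n₀, ∀ x, ‖jet N (u n).1 x - j x‖ ≤ ε := by
    intro ε hε
    obtain ⟨n₀, hn₀⟩ := hu ε hε
    refine ⟨n₀, fun n hn x => ?_⟩
    refine le_of_tendsto ((tendsto_const_nhds (x := jet N (u n).1 x)).sub (hj x)).norm ?_
    filter_upwards [eventually_ge_atTop n₀] with m hm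
    exact hn₀ n hn m hm x
  obtain ⟨h1, h2⟩ := jet_of_tendsto (fun n => (u n).2.1) hunif
  refine ⟨⟨fun x => (j x).fst, h1, fun ε hε => ?_⟩, fun x => ?_⟩
  · obtain ⟨n₀, hn₀⟩ := hunif (ε / 4) (by positivity)
    obtain ⟨K, hK, hK'⟩ := (u n₀).2.2 (ε / 2) (by positivity)
    refine ⟨K, hK, fun x hx => ?_⟩
    have e0 := hn₀ n₀ le_rfl x
    rw [← h2 x] at e0
    have e1 := hK' x hx
    have e2 := (WithLp.norm_fst_le _ (jet N (u n₀).1 x - jet N (fun x => (j x).fst) x)).trans e0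
    have e3 := (WithLp.norm_snd_le _ (jet N (u n₀).1 x - jet N (fun x => (j x).fst) x)).trans e0
    change ‖(u n₀).1 x - (j x).fst‖ ≤ _ at e2
    change ‖deRham N (u n₀).1 x - deRham N (fun x => (j x).fst) x‖ ≤ _ at e3
    have e4 := norm_sub_norm_le (j x).fst ((u n₀).1 x)
    have e5 := norm_sub_norm_le (deRham N (fun x => (j x).fst) x) (deRham N (u n₀).1 x)
    rw [norm_sub_rev] at e4 e5
    change ‖(j x).fst‖ + ‖deRham N (fun x => (j x).fst) x‖ < ε
    linarith
  · have := hj x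
    rwa [← h2 x] at this

end Completeness

/-! ### Constant operators acting on jets -/

section ConstantOperators

variable {N : ℕ} {M : Type*} [TopologicalSpace M] [ChartedSpace (EuclideanSpace ℝ (Fin N)) M]
  [RiemannianBundle (fun x : M => TangentSpace (𝓡 N) x)] [IsManifold (𝓡 N) ∞ M]
  [IsContMDiffRiemannianBundle (𝓡 N) ∞ (EuclideanSpace ℝ (Fin N))
      (fun x : M => TangentSpace (𝓡 N) x)]
  {H G : Type*} [NormedAddCommGroup H] [InnerProductSpace ℂ H]
  [NormedAddCommGroup G] [InnerProductSpace ℂ G]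

theorem strongDeRham_const (L : H →L[ℂ] G) (x : M) (ξ : H) :
    strongDeRham (N := N) (fun _ : M => L) x ξ = 0 :=
  deRham_eq (hasMFDerivAt_const (I := 𝓡 N) (I' := 𝓘(ℝ, G)) (L ξ) x)

theorem stronglyDiff_const (L : H →L[ℂ] G) : StronglyDiff (N := N) (fun _ : M => L) :=
  fun _ => contMDiff_const

theorem jetBoundedBy_const (L : H →L[ℂ] G) : JetBoundedBy N (fun _ : M => L) ‖L‖ := by
  refine ⟨norm_nonneg _, fun x ξ => ⟨L.le_opNorm ξ, ?_⟩⟩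
  rw [strongDeRham_const, norm_zero]
  positivity

/-- Composition with a bounded operator. -/
def C10.mapCLM (L : H →L[ℂ] G) : C10 N M H →ₗ[ℂ] C10 N M G :=
  (jetBoundedBy_const L).mulOp (stronglyDiff_const L)

/-- The action of a bounded operator on jets. -/
def jetMap (N : ℕ) (L : H →L[ℂ] G) : Jet N H →ₗ[ℂ] Jet N G where
  toFun w := WithLp.toLp 2 (L w.fst, ampCot L w.snd)
  map_add' u v := by
    have h2 := (ampCotLin (N := N) L).map_add u.snd v.snd
    change ampCot L (u.snd + v.snd) = ampCot L u.snd + ampCot L v.snd at h2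
    rw [WithLp.add_fst, WithLp.add_snd, map_add, h2]
    rfl
  map_smul' c v := by
    have h2 := (ampCotLin (N := N) L).map_smul c v.snd
    change ampCot L (c • v.snd) = c • ampCot L v.snd at h2
    rw [WithLp.smul_fst, WithLp.smul_snd, map_smul, h2]
    rfl

theorem jetAt_mapCLM (L : H →L[ℂ] G) (s : C10 N M H) (x : M) :
    jetAt x (C10.mapCLM L s) = jetMap N L (jetAt x s) := by
  refine (((jetBoundedBy_const L).contMDiff_apply (stronglyDiff_const L) s.2.1).2 x).trans ?_
  change WithLp.toLp 2 (L (s.1 x), strongDeRham (fun _ : M => L) x (s.1 x) +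
    ampCot L (deRham N s.1 x)) = WithLp.toLp 2 (L (s.1 x), ampCot L (deRham N s.1 x))
  rw [strongDeRham_const, zero_add]

theorem norm_jetMap_le (L : H →L[ℂ] G) {C : ℝ} (hC : 0 ≤ C) (hL : ∀ v, ‖L v‖ ≤ C * ‖v‖)
    (w : Jet N H) : ‖jetMap N L w‖ ≤ C * ‖w‖ := by
  rw [WithLp.prod_norm_eq_of_L2, WithLp.prod_norm_eq_of_L2]
  nth_rewrite 1 [← Real.sqrt_sq hC]
  rw [← Real.sqrt_mul (by positivity)]
  refine Real.sqrt_le_sqrt ?_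
  rw [mul_add, ← mul_pow, ← mul_pow]
  exact add_le_add (pow_le_pow_left₀ (norm_nonneg _) (hL _) 2)
    (pow_le_pow_left₀ (norm_nonneg _) (norm_ampCot_le L hC hL _) 2)

/-- On a finite-dimensional domain the operator norm is controlled by the values on a basis, so
strong convergence becomes norm convergence. -/
theorem tendsto_comp_zero {F : Type*} [NormedAddCommGroup F] [NormedSpace ℝ F]
    [FiniteDimensional ℝ F] {R : ℕ → H →L[ℂ] G}
    (h0 : ∀ v, Tendsto (fun n => R n v) atTop (𝓝 0)) (L : F →L[ℝ] H) : Tendsto (fun n => ((R n).restrictScalars ℝ).comp L) atTop (𝓝 0) := by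
  obtain ⟨C, hC0, hC⟩ := (Module.finBasis ℝ F).exists_opNorm_le (F := G)
  rw [Metric.tendsto_atTop']
  intro ε hε
  have hev : ∀ᶠ n in atTop, ∀ i, ‖R n (L (Module.finBasis ℝ F i))‖ < ε / (2 * C) := by
    rw [eventually_all]
    intro i
    have := (h0 (L (Module.finBasis ℝ F i))).norm
    rw [norm_zero] at this
    exact this.eventually (gt_mem_nhds (by positivity))
  obtain ⟨n₀, hn₀⟩ := eventually_atTop.1 hev
  refine ⟨n₀, fun n hn => ?_⟩
  rw [dist_zero_right]
  have := hC (u := ((R n).restrictScalars ℝ).comp L) (M := ε / (2 * C)) (by positivity)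
    fun i => (hn₀ n hn.le i).le
  refine this.trans_lt ?_
  have e : C * (ε / (2 * C)) = ε / 2 := by field_simp
  rw [e]
  exact half_lt_self hε

/-- A bounded sequence of operators which converges strongly to zero converges to zero uniformly on
the jets of a function in `C¹₀(M, H)`. -/
theorem exists_forall_norm_jetMap_le {R : ℕ → H →L[ℂ] G} (hR : ∀ n v, ‖R n v‖ ≤ ‖v‖)
    (h0 : ∀ v, Tendsto (fun n => R n v) atTop (𝓝 0)) (s : C10 N M H) {ε : ℝ} (hε : 0 < ε) :
    ∃ n₀, ∀ n ≥ n₀, ∀ x, ‖jetMap N (R n) (jetAt x s)‖ ≤ ε := by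
  obtain ⟨K, hK, hK'⟩ := s.2.2 ε hε
  have hloc : ∀ p ∈ K, ∃ t ∈ 𝓝[K] p, ∃ n₀, ∀ n ≥ n₀, ∀ x ∈ t,
      ‖jetMap N (R n) (jetAt x s)‖ ≤ ε := by
    intro p _
    set φ := extChartAt (𝓡 N) p with hφ
    obtain ⟨C, hC0, hC⟩ := frameVec_comparable (N := N) G p
    -- The value costs `2 * δ` and the derivative `C * (2 * δ)`. One `δ` is for the estimate at `p`,
    -- the other for moving from `p` to `x`, which the contractions `R n` allow uniformly in `n`.
    set δ := ε / (2 + 2 * C) with hδ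
    have hδ0 : 0 < δ := by positivity
    set D := fderiv ℝ (s.1 ∘ φ.symm) with hD
    have hDc : ContinuousAt (fun x => D (φ x)) p := by
      have h1 : ContinuousAt D (φ p) :=
        ((contDiffOn_chart s.2.1 p).continuousOn_fderiv_of_isOpen (isOpen_extChartAt_target p)
          le_rfl).continuousAt ((isOpen_extChartAt_target p).mem_nhds (mem_extChartAt_target p))
      exact ContinuousAt.comp (f := φ) h1 (continuousAt_extChartAt p)
    have hsc : ContinuousAt s.1 p := s.2.1.continuous.continuousAt
    have l1 := (tendsto_comp_zero h0 (D (φ p))).norm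
    have l2 := (h0 (s.1 p)).norm
    rw [norm_zero] at l1 l2
    obtain ⟨n₀, hn₀⟩ := eventually_atTop.1
      ((l1.eventually (gt_mem_nhds hδ0)).and (l2.eventually (gt_mem_nhds hδ0)))
    have hev : ∀ᶠ x in 𝓝 p, ∀ n ≥ n₀, ‖jetMap N (R n) (jetAt x s)‖ ≤ ε := by
      filter_upwards [hC, Metric.continuousAt_iff'.1 hDc δ hδ0, Metric.continuousAt_iff'.1 hsc δ hδ0]
        with x hx h1 h2 n hn
      rw [dist_eq_norm] at h1 h2
      obtain ⟨hxs, hxC⟩ := hx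
      have hxt : φ x ∈ φ.target := φ.map_source (by rwa [hφ, extChartAt_source])
      have e1 : ‖R n (s.1 x)‖ ≤ 2 * δ := by
        have a1 := hR n (s.1 x - s.1 p)
        have a2 := (hn₀ n hn).2
        have a3 : R n (s.1 x) = R n (s.1 x - s.1 p) + R n (s.1 p) := by rw [← map_add, sub_add_cancel]
        rw [a3]
        refine (norm_add_le _ _).trans ?_
        linarith
      have e2 : ‖((R n).restrictScalars ℝ).comp (D (φ x))‖ ≤ 2 * δ := by
        have a3 : ((R n).restrictScalars ℝ).comp (D (φ x)) =
            ((R n).restrictScalars ℝ).comp (D (φ x) - D (φ p)) +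
              ((R n).restrictScalars ℝ).comp (D (φ p)) := by
          rw [← ContinuousLinearMap.comp_add, sub_add_cancel]
        have a1 : ‖((R n).restrictScalars ℝ).comp (D (φ x) - D (φ p))‖ ≤ δ := by
          refine ContinuousLinearMap.opNorm_le_bound _ hδ0.le fun v => ?_
          refine (hR n _).trans ?_
          exact ContinuousLinearMap.le_of_opNorm_le _ h1.le v
        rw [a3]
        refine (norm_add_le _ _).trans ?_
        linarith [(hn₀ n hn).1]
      have e3 : deRham N (fun y => R n (s.1 y)) x = _ := deRham_eq_chart hxs
        (((R n).restrictScalars ℝ).hasFDerivAt.comp (φ x) (hasFDerivAt_chart s.2.1 hxt))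
      have e4 := (hxC (((R n).restrictScalars ℝ).comp (D (φ x)))).1
      rw [← e3] at e4
      rw [← jetAt_mapCLM]
      refine (prodLp_norm_le _).trans ?_
      change ‖R n (s.1 x)‖ + ‖deRham N (fun y => R n (s.1 y)) x‖ ≤ ε
      have e5 := mul_le_mul_of_nonneg_left e2 hC0.le
      have e6 : (2 + 2 * C) * δ = ε := by
        rw [hδ]
        field_simp
      linarith
    exact ⟨_, mem_nhdsWithin_of_mem_nhds hev, n₀, fun n hn x hx => hx n hn⟩
  obtain ⟨n₀, hn₀⟩ : ∃ n₀, ∀ n ≥ n₀, ∀ x ∈ K, ‖jetMap N (R n) (jetAt x s)‖ ≤ ε := by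
    refine hK.induction_on (p := fun t => ∃ n₀, ∀ n ≥ n₀, ∀ x ∈ t,
      ‖jetMap N (R n) (jetAt x s)‖ ≤ ε) ⟨0, fun _ _ y hy => hy.elim⟩ ?_ ?_ hloc
    · rintro a b hab ⟨n₀, h⟩
      exact ⟨n₀, fun n hn y hy => h n hn y (hab hy)⟩
    · rintro a b ⟨n₀, h⟩ ⟨m₀, h'⟩
      refine ⟨max n₀ m₀, fun n hn y hy => ?_⟩
      rcases hy with hy | hy
      · exact h n ((le_max_left _ _).trans hn) y hy
      · exact h' n ((le_max_right _ _).trans hn) y hy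
  refine ⟨n₀, fun n hn x => ?_⟩
  by_cases hx : x ∈ K
  · exact hn₀ n hn x hx
  · refine (norm_jetMap_le (R n) zero_le_one (fun v => by rw [one_mul]; exact hR n v) _).trans ?_
    rw [one_mul]
    exact (prodLp_norm_le _).trans (hK' x hx).le

end ConstantOperators

end OpStarMod

namespace OpStarMod

open MatrixNorm HermForm RightAction

/-! ### Parseval's identity for jets -/

section HilbertBases

variable {H : Type*} [NormedAddCommGroup H] [InnerProductSpace ℂ H] (e : HilbertBasis ℕ ℂ H)

theorem hasSum_norm_inner_sq (v : H) : HasSum (fun k => ‖(inner ℂ (e k) v : ℂ)‖ ^ 2) (‖v‖ ^ 2) := by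
  have h := Complex.hasSum_re (e.hasSum_inner_mul_inner v v)
  have h1 : (inner ℂ v v : ℂ).re = ‖v‖ ^ 2 := inner_self_eq_norm_sq (𝕜 := ℂ) v
  rw [h1] at h
  have h2 : ∀ k, (inner ℂ v (e k) * inner ℂ (e k) v : ℂ).re = ‖(inner ℂ (e k) v : ℂ)‖ ^ 2 :=
    fun k => by
      rw [← inner_conj_symm, RCLike.conj_mul]
      norm_cast
  simpa only [h2] using h

/-- The projection onto the orthogonal complement of the first `n` basis vectors. -/
def basisTail (n : ℕ) : H →L[ℂ] H :=
  ContinuousLinearMap.id ℂ H -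
    ∑ k ∈ Finset.range n, (ContinuousLinearMap.toSpanSingleton ℂ (e k)).comp (innerSL ℂ (e k))

theorem basisTail_apply (n : ℕ) (v : H) :
    basisTail e n v = v - ∑ k ∈ Finset.range n, (inner ℂ (e k) v : ℂ) • e k := by
  simp [basisTail]

theorem innerSL_comp_toSpanSingleton (k i : ℕ) :
    (innerSL ℂ (e k)).comp (ContinuousLinearMap.toSpanSingleton ℂ (e i)) =
      if k = i then ContinuousLinearMap.id ℂ ℂ else 0 := by
  ext
  have := orthonormal_iff_ite.1 e.orthonormal k i
  simp only [ContinuousLinearMap.comp_apply, ContinuousLinearMap.toSpanSingleton_apply, one_smul,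
    innerSL_apply_apply, this]
  split_ifs <;> simp

theorem innerSL_comp_basisTail (n k : ℕ) :
    (innerSL ℂ (e k)).comp (basisTail e n) = if n ≤ k then innerSL ℂ (e k) else 0 := by
  ext v
  have h := orthonormal_iff_ite.1 e.orthonormal
  simp only [ContinuousLinearMap.comp_apply, innerSL_apply_apply, basisTail_apply, inner_sub_right,
    inner_sum, inner_smul_right, h, mul_ite, mul_one, mul_zero, Finset.sum_ite_eq,
    Finset.mem_range]
  by_cases hk : n ≤ k
  · simp [hk, not_lt.2 hk]
  · simp [hk, not_le.1 hk]

/-- Compare the Parseval sums term by term: the tail keeps a coordinate or kills it. -/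
theorem norm_basisTail_le (n : ℕ) (v : H) : ‖basisTail e n v‖ ≤ ‖v‖ := by
  refine abs_le_of_sq_le_sq' ?_ (norm_nonneg _) |>.2
  refine hasSum_le (fun k => ?_) (hasSum_norm_inner_sq e (basisTail e n v))
    (hasSum_norm_inner_sq e v)
  have h : inner ℂ (e k) (basisTail e n v) = (if n ≤ k then innerSL ℂ (e k) else 0) v := by
    rw [← innerSL_comp_basisTail]
    rfl
  rw [h]
  split_ifs with hk
  · rfl
  · simp

theorem tendsto_basisTail (v : H) : Tendsto (fun n => basisTail e n v) atTop (𝓝 0) := by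
  have h := (e.hasSum_repr v).tendsto_sum_nat
  simp_rw [e.repr_apply_apply] at h
  simp_rw [basisTail_apply]
  simpa using h.const_sub v

theorem hasSum_norm_jetMap_sq {N : ℕ} (w : Jet N H) :
    HasSum (fun k => ‖jetMap N (innerSL ℂ (e k)) w‖ ^ 2) (‖w‖ ^ 2) := by
  have h1 := hasSum_norm_inner_sq e w.fst
  have h2 : HasSum (fun k => ∑ i, ‖(inner ℂ (e k) (w.snd i) : ℂ)‖ ^ 2) (∑ i, ‖w.snd i‖ ^ 2) :=
    hasSum_sum fun i _ => hasSum_norm_inner_sq e (w.snd i)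
  have h3 : ‖w‖ ^ 2 = ‖w.fst‖ ^ 2 + ∑ i, ‖w.snd i‖ ^ 2 := by
    rw [WithLp.prod_norm_sq_eq_of_L2, PiLp.norm_sq_eq_of_L2]
  have h4 : ∀ k, ‖jetMap N (innerSL ℂ (e k)) w‖ ^ 2 =
      ‖(inner ℂ (e k) w.fst : ℂ)‖ ^ 2 + ∑ i, ‖(inner ℂ (e k) (w.snd i) : ℂ)‖ ^ 2 := fun k => by
    rw [WithLp.prod_norm_sq_eq_of_L2, PiLp.norm_sq_eq_of_L2]
    rfl
  rw [h3]
  simp_rw [h4]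
  exact h1.add h2

theorem vecNorm_col {V : Type*} [NormedAddCommGroup V] [InnerProductSpace ℂ V] {m : ℕ}
    (ξ : Matrix (Fin m) Unit V) : vecNorm ξ = ENNReal.ofReal √(∑ i, ‖ξ i ()‖ ^ 2) := by
  have key : ∀ v : EuclideanSpace ℂ Unit, ‖matOp ξ v‖ = ‖v‖ * √(∑ i, ‖ξ i ()‖ ^ 2) := fun v => by
    rw [PiLp.norm_eq_of_L2, EuclideanSpace.norm_eq, ← Real.sqrt_mul (by positivity)]
    simp [matOp, norm_smul, mul_pow, Finset.mul_sum]
  refine le_antisymm (iSup₂_le fun v hv => ?_) ?_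
  · rw [← ofReal_norm, key]
    exact ENNReal.ofReal_le_ofReal (mul_le_of_le_one_left (Real.sqrt_nonneg _) hv)
  · have h1 : ‖(EuclideanSpace.single () 1 : EuclideanSpace ℂ Unit)‖ = 1 := by simp
    refine le_trans (le_of_eq ?_) (le_iSup₂
      (f := fun (v : EuclideanSpace ℂ Unit) (_ : ‖v‖ ≤ 1) => ‖matOp ξ v‖ₑ)
      (EuclideanSpace.single () 1) h1.le)
    rw [← ofReal_norm, key, h1, one_mul]

/-- The norm of a matrix of jets is the supremum of the norms of the truncated coordinate
matrices. -/
theorem iSup_vecNorm_coord {N : ℕ} {ι κ : Type} [Fintype ι] [Fintype κ]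
    (ξ : Matrix ι κ (Jet N H)) :
    ⨆ n : ℕ, vecNorm (fun (p : ι × Fin n) j => jetMap N (innerSL ℂ (e p.2)) (ξ p.1 j)) =
      vecNorm ξ := by
  -- For fixed `v` the truncated matrix produces a partial sum of the Parseval series of `ξ v`, so
  -- truncations never exceed the full norm and converge to it.
  have key : ∀ (n : ℕ) (v : EuclideanSpace ℂ κ),
      ‖matOp (fun (p : ι × Fin n) j => jetMap N (innerSL ℂ (e p.2)) (ξ p.1 j)) v‖ =
        √(∑ i, ∑ k ∈ Finset.range n, ‖jetMap N (innerSL ℂ (e k)) (matOp ξ v i)‖ ^ 2) := by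
    intro n v
    rw [PiLp.norm_eq_of_L2, Fintype.sum_prod_type]
    congr 1
    refine Finset.sum_congr rfl fun i _ => ?_
    rw [← Fin.sum_univ_eq_sum_range
      (fun k => ‖jetMap N (innerSL ℂ (e k)) (matOp ξ v i)‖ ^ 2) n]
    refine Finset.sum_congr rfl fun k _ => ?_
    simp [matOp, map_sum]
  refine le_antisymm (iSup_le fun n => iSup₂_le fun v hv => ?_) (iSup₂_le fun v hv => ?_)
  · refine le_trans ?_ (le_iSup₂ (f := fun (v : EuclideanSpace ℂ κ) (_ : ‖v‖ ≤ 1) =>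
      ‖matOp ξ v‖ₑ) v hv)
    rw [← ofReal_norm, ← ofReal_norm, key, PiLp.norm_eq_of_L2]
    refine ENNReal.ofReal_le_ofReal (Real.sqrt_le_sqrt (Finset.sum_le_sum fun i _ => ?_))
    exact sum_le_hasSum _ (fun _ _ => by positivity) (hasSum_norm_jetMap_sq e _)
  · have hlim : Tendsto (fun n : ℕ => ENNReal.ofReal √(∑ i, ∑ k ∈ Finset.range n,
        ‖jetMap N (innerSL ℂ (e k)) (matOp ξ v i)‖ ^ 2)) atTop (𝓝 ‖matOp ξ v‖ₑ) := by
      rw [← ofReal_norm, PiLp.norm_eq_of_L2]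
      refine (ENNReal.continuous_ofReal.tendsto _).comp ((Real.continuous_sqrt.tendsto _).comp ?_)
      exact tendsto_finsetSum _ fun i _ => (hasSum_norm_jetMap_sq e _).tendsto_sum_nat
    refine le_of_tendsto' hlim fun n => ?_
    rw [← key, ofReal_norm]
    exact (le_iSup₂ (f := fun (v : EuclideanSpace ℂ κ) (_ : ‖v‖ ≤ 1) =>
      ‖matOp (fun (p : ι × Fin n) j => jetMap N (innerSL ℂ (e p.2)) (ξ p.1 j)) v‖ₑ) v hv).trans
      (le_iSup (fun n : ℕ => vecNorm (fun (p : ι × Fin n) j =>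
        jetMap N (innerSL ℂ (e p.2)) (ξ p.1 j))) n)

end HilbertBases

/-! ### Conjugation by a unitary complete isometry -/

section Conjugation

variable {A X Y B : Type*}
    [AddCommGroup X] [Module ℂ X] [MatrixNorm X] [RightAction A X] [HermForm X B]
    [AddCommGroup Y] [Module ℂ Y] [MatrixNorm Y] [RightAction A Y] [HermForm Y B]

theorem IsCompleteIsometry.symm {U : X ≃ₗ[ℂ] Y} (hU : IsCompleteIsometry U.toLinearMap) :
    IsCompleteIsometry U.symm.toLinearMap := by
  intro n ξ
  refine (hU n (ξ.map U.symm)).symm.trans (congrArg mnorm ?_)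
  ext i j
  exact U.apply_symm_apply _

theorem isModuleMorphism_conj (U : X ≃ₗ[ℂ] Y)
    (hU : IsCompleteIsometry U.toLinearMap)
    (hact : ∀ (s : X) (a : A), U (act s a) = act (U s) a) {T : X →ₗ[ℂ] X}
    (hT : IsModuleMorphism A T) :
    IsModuleMorphism A (U.toLinearMap ∘ₗ T ∘ₗ U.symm.toLinearMap) := by
  have hact' : ∀ (t : Y) (a : A), U.symm (act t a) = act (U.symm t) a := fun t a => by
    rw [LinearEquiv.symm_apply_eq, hact, LinearEquiv.apply_symm_apply]
  refine ⟨fun t a => ?_, lt_of_le_of_lt ?_ hT.2⟩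
  · change U (T (U.symm (act t a))) = act (U (T (U.symm t))) a
    rw [hact', hT.1, hact]
  · refine iSup_le fun n => iSup₂_le fun ξ hξ => ?_
    have h1 : mnorm (ξ.map U.symm) ≤ 1 := (hU.symm n ξ).trans_le hξ
    have h2 : mnorm (ξ.map (U.toLinearMap ∘ₗ T ∘ₗ U.symm.toLinearMap)) =
        mnorm ((ξ.map U.symm).map T) := hU n ((ξ.map U.symm).map T)
    rw [h2]
    exact (le_iSup₂ (f := fun (ξ : Matrix (Fin n) (Fin n) X) (_ : mnorm ξ ≤ 1) =>
      mnorm (ξ.map T)) _ h1).trans (le_iSup (fun n : ℕ => ⨆ (ξ : Matrix (Fin n) (Fin n) X)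
        (_ : mnorm ξ ≤ 1), mnorm (ξ.map T)) n)

/-- Conjugation of morphisms by a unitary complete isometry. -/
def Mor.conj (U : X ≃ₗ[ℂ] Y)
    (hU : IsCompleteIsometry U.toLinearMap)
    (hact : ∀ (s : X) (a : A), U (act s a) = act (U s) a)
    (hform : ∀ s t : X, form (U s) (U t) = form s t) (T : Mor A X X) : Mor A Y Y :=
  ⟨U.toLinearMap ∘ₗ T.1 ∘ₗ U.symm.toLinearMap, isModuleMorphism_conj U hU hact T.2.1, by
    obtain ⟨S, hS, hTS⟩ := T.2.2
    refine ⟨U.toLinearMap ∘ₗ S ∘ₗ U.symm.toLinearMap, isModuleMorphism_conj U hU hact hS,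
      fun s t => ?_⟩
    change form (U (T.1 (U.symm s))) t = form s (U (S (U.symm t)))
    conv_lhs => rw [← U.apply_symm_apply t, hform, hTS, ← hform, U.apply_symm_apply]⟩

theorem Mor.conj_bijective (U : X ≃ₗ[ℂ] Y)
    (hU : IsCompleteIsometry U.toLinearMap)
    (hact : ∀ (s : X) (a : A), U (act s a) = act (U s) a)
    (hform : ∀ s t : X, form (U s) (U t) = form s t) :
    Function.Bijective (Mor.conj U hU hact hform) := by
  have hact' : ∀ (t : Y) (a : A), U.symm (act t a) = act (U.symm t) a := fun t a => by
    rw [LinearEquiv.symm_apply_eq, hact, LinearEquiv.apply_symm_apply]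
  have hform' : ∀ s t : Y, form (U.symm s) (U.symm t) = form s t := fun s t => by
    rw [← hform, U.apply_symm_apply, U.apply_symm_apply]
  refine Function.bijective_iff_has_inverse.2 ⟨Mor.conj U.symm hU.symm hact' hform', ?_, ?_⟩
  · intro T
    refine Subtype.ext (LinearMap.ext fun s => ?_)
    change U.symm (U (T.1 (U.symm (U s)))) = T.1 s
    rw [U.symm_apply_apply, U.symm_apply_apply]
  · intro T
    refine Subtype.ext (LinearMap.ext fun s => ?_)
    change U (U.symm (T.1 (U (U.symm s)))) = T.1 s
    rw [U.apply_symm_apply, U.apply_symm_apply]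

end Conjugation

/-! ### The standard module in coordinates -/

section StandardModule

variable {N : ℕ} {M : Type*} [TopologicalSpace M] [ChartedSpace (EuclideanSpace ℝ (Fin N)) M]
  [RiemannianBundle (fun x : M => TangentSpace (𝓡 N) x)] [IsManifold (𝓡 N) ∞ M]
  [IsContMDiffRiemannianBundle (𝓡 N) ∞ (EuclideanSpace ℝ (Fin N))
      (fun x : M => TangentSpace (𝓡 N) x)]
  {H : Type*} [NormedAddCommGroup H] [InnerProductSpace ℂ H] (e : HilbertBasis ℕ ℂ H)

theorem vecNorm_segCol (f : ℕ → C10 N M ℂ) (n m : ℕ) (x : M) :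
    vecNorm ((segCol f n m).map (jetAt x)) =
      ENNReal.ofReal √(∑ k ∈ Finset.range m, if n ≤ k then ‖jetAt x (f k)‖ ^ 2 else 0) := by
  rw [vecNorm_col, ← Fin.sum_univ_eq_sum_range
    (fun k => if n ≤ k then ‖jetAt x (f k)‖ ^ 2 else 0) m]
  congr 2
  refine Finset.sum_congr rfl fun k _ => ?_
  by_cases hk : n ≤ (k : ℕ) <;> simp [segCol, hk]

/-- The coordinates of a function in `C¹₀(M, H)` with respect to a Hilbert basis of `H`. -/
def coordSeq : C10 N M H →ₗ[ℂ] (ℕ → C10 N M ℂ) :=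
  LinearMap.pi fun k => C10.mapCLM (innerSL ℂ (e k))

theorem coordSeq_apply (s : C10 N M H) (k : ℕ) (x : M) :
    (coordSeq e s k).1 x = inner ℂ (e k) (s.1 x) := rfl

theorem jetAt_coordSeq (s : C10 N M H) (k : ℕ) (x : M) :
    jetAt x (coordSeq e s k) = jetMap N (innerSL ℂ (e k)) (jetAt x s) := jetAt_mapCLM _ _ _

theorem jetMap_basisTail (n k : ℕ) (w : Jet N H) :
    jetMap N (innerSL ℂ (e k)) (jetMap N (basisTail e n) w) =
      if n ≤ k then jetMap N (innerSL ℂ (e k)) w else 0 := by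
  change jetMap N ((innerSL ℂ (e k)).comp (basisTail e n)) w = _
  rw [innerSL_comp_basisTail]
  split_ifs <;> rfl

/-- The coordinates from `n` on are those of the tail projection of `s`, whose jets tend to zero
uniformly on `M`. -/
theorem coordSeq_mem (s : C10 N M H) : coordSeq e s ∈ StdSeq (C10 N M ℂ) := by
  intro ε hε
  obtain ⟨δ, hδ0, hδ⟩ : ∃ δ : ℝ, 0 < δ ∧ ENNReal.ofReal δ ≤ ε := by
    rcases eq_or_ne ε ⊤ with rfl | h
    · exact ⟨1, one_pos, le_top⟩
    · exact ⟨ε.toReal, ENNReal.toReal_pos hε.ne' h, ENNReal.ofReal_toReal_le⟩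
  obtain ⟨n₀, hn₀⟩ := exists_forall_norm_jetMap_le (norm_basisTail_le e) (tendsto_basisTail e) s hδ0
  refine ⟨n₀, fun n m hn _ => iSup_le fun x => le_trans ?_ hδ⟩
  rw [vecNorm_segCol]
  refine ENNReal.ofReal_le_ofReal ((Real.sqrt_le_left hδ0.le).2 ?_)
  refine le_trans ?_ (pow_le_pow_left₀ (norm_nonneg _) (hn₀ n hn x) 2)
  refine le_trans (le_of_eq (Finset.sum_congr rfl fun k _ => ?_)) (sum_le_hasSum (Finset.range m)
    (fun _ _ => by positivity) (hasSum_norm_jetMap_sq e (jetMap N (basisTail e n) (jetAt x s))))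
  rw [jetMap_basisTail, jetAt_coordSeq]
  split_ifs <;> simp

theorem coordSeq_injective : Function.Injective (coordSeq (N := N) (M := M) e) := by
  intro s t hst
  refine Subtype.ext (funext fun x => ?_)
  refine e.repr.injective (lp.ext (funext fun k => ?_))
  rw [e.repr_apply_apply, e.repr_apply_apply, ← coordSeq_apply, ← coordSeq_apply, hst]

/-- The function with finitely many prescribed coordinates. -/
def partialSynth (f : ℕ → C10 N M ℂ) (n : ℕ) : C10 N M H :=
  ∑ k ∈ Finset.range n, C10.mapCLM (ContinuousLinearMap.toSpanSingleton ℂ (e k)) (f k)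

theorem jetMap_partialSynth (f : ℕ → C10 N M ℂ) (n k : ℕ) (x : M) :
    jetMap N (innerSL ℂ (e k)) (jetAt x (partialSynth e f n)) =
      if k < n then jetAt x (f k) else 0 := by
  rw [partialSynth, map_sum, map_sum]
  have h : ∀ i, jetMap N (innerSL ℂ (e k)) (jetAt x (C10.mapCLM
      (ContinuousLinearMap.toSpanSingleton ℂ (e i)) (f i))) =
      if k = i then jetAt x (f i) else 0 := by
    intro i
    rw [jetAt_mapCLM]
    change jetMap N ((innerSL ℂ (e k)).comp (ContinuousLinearMap.toSpanSingleton ℂ (e i)))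
      (jetAt x (f i)) = _
    rw [innerSL_comp_toSpanSingleton]
    split_ifs <;> rfl
  simp_rw [h]
  simp

/-- By Parseval, the difference of two partial sums has the norm of a segment of `f`, so the Cauchy
condition defining `StdSeq` is that of the partial sums in `C¹₀(M, H)`. -/
theorem norm_partialSynth_sub (f : ℕ → C10 N M ℂ) {n m : ℕ} (hnm : n ≤ m) (x : M) :
    ‖jetAt x (partialSynth e f m) - jetAt x (partialSynth e f n)‖ =
      √(∑ k ∈ Finset.range m, if n ≤ k then ‖jetAt x (f k)‖ ^ 2 else 0) := by
  have h : ∀ k, ‖jetMap N (innerSL ℂ (e k))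
      (jetAt x (partialSynth e f m) - jetAt x (partialSynth e f n))‖ ^ 2 =
      if k ∈ Finset.range m then (if n ≤ k then ‖jetAt x (f k)‖ ^ 2 else 0) else 0 := by
    intro k
    rw [map_sub, jetMap_partialSynth, jetMap_partialSynth]
    simp only [Finset.mem_range]
    by_cases h1 : k < m <;> by_cases h2 : n ≤ k
    · simp [h1, h2, not_lt.2 h2]
    · simp [h1, h2, not_le.1 h2]
    · simp [h1, not_lt.2 h2]
    · exact absurd ((not_le.1 h2).trans_le hnm) h1
  have h1 := hasSum_norm_jetMap_sq e
    (jetAt x (partialSynth e f m) - jetAt x (partialSynth e f n))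
  have h2 : HasSum (fun k => ‖jetMap N (innerSL ℂ (e k))
      (jetAt x (partialSynth e f m) - jetAt x (partialSynth e f n))‖ ^ 2) _ :=
    hasSum_sum_of_ne_finset_zero (s := Finset.range m) fun k hk => by rw [h, if_neg hk]
  rw [eq_comm, Real.sqrt_eq_iff_eq_sq (Finset.sum_nonneg fun k _ => by split_ifs <;> positivity)
    (norm_nonneg _), h1.unique h2]
  exact Finset.sum_congr rfl fun k hk => by rw [h, if_pos hk]

theorem exists_coordSeq_eq [CompleteSpace H] (f : StdSeq (C10 N M ℂ)) :
    ∃ s : C10 N M H, coordSeq e s = f.1 := by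
  obtain ⟨s, hs⟩ := C10_complete (u := partialSynth e f.1) fun ε hε => by
    obtain ⟨n₀, hn₀⟩ := f.2 (ENNReal.ofReal ε) (ENNReal.ofReal_pos.2 hε)
    have key : ∀ n ≥ n₀, ∀ m ≥ n, ∀ x,
        ‖jetAt x (partialSynth e f.1 m) - jetAt x (partialSynth e f.1 n)‖ ≤ ε := by
      intro n hn m hm x
      rw [norm_partialSynth_sub e f.1 hm]
      have := (le_iSup (fun x : M => vecNorm ((segCol f.1 n m).map (jetAt x))) x).trans
        (hn₀ n m hn hm)
      rwa [vecNorm_segCol, ENNReal.ofReal_le_ofReal_iff hε.le] at this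
    refine ⟨n₀, fun n hn m hm x => ?_⟩
    rcases le_total n m with h | h
    · rw [norm_sub_rev]
      exact key n hn m h x
    · exact key m hm n h x
  refine ⟨s, funext fun k => Subtype.ext (funext fun x => ?_)⟩
  have h1 : Tendsto (fun n => (partialSynth e f.1 n).1 x) atTop (𝓝 (s.1 x)) :=
    ((WithLp.continuous_fst (p := 2) (α := H) (β := Cot N H)).tendsto (jetAt x s)).comp (hs x)
  have h2 := ((innerSL ℂ (e k)).continuous.tendsto _).comp h1
  refine tendsto_nhds_unique h2 (tendsto_const_nhds.congr' ?_)
  -- The `k`-th coordinate of the partial sums is constant once `n > k`, so it passes to the limit.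
  filter_upwards [eventually_gt_atTop k] with n hn
  have h3 := jetMap_partialSynth e f.1 n k x
  rw [if_pos hn] at h3
  exact (congrArg WithLp.fst h3).symm

variable [CompleteSpace H]

/-- The coordinates with respect to a Hilbert basis identify `C¹₀(M, H)` with the standard module. -/
def coordEquiv : C10 N M H ≃ₗ[ℂ] StdSeq (C10 N M ℂ) :=
  LinearEquiv.ofBijective ((coordSeq e).codRestrict _ (coordSeq_mem e))
    ⟨fun _ _ h => coordSeq_injective e (congrArg Subtype.val h), fun f => by
      obtain ⟨s, hs⟩ := exists_coordSeq_eq e f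
      exact ⟨s, Subtype.ext hs⟩⟩

/-- Exchange the suprema over truncations and over points; at each point the claim is
`iSup_vecNorm_coord`. -/
theorem isCompleteIsometry_coordEquiv : IsCompleteIsometry (X := C10 N M H)
    (Y := StdSeq (C10 N M ℂ)) (coordEquiv e).toLinearMap := by
  intro n ξ
  change (⨆ n : ℕ, ⨆ x : M, vecNorm ((blockCol n ((ξ.map (coordEquiv e)).map
    (fun f => (f : ℕ → C10 N M ℂ)))).map (jetAt x))) = ⨆ x : M, vecNorm (ξ.map (jetAt x))
  rw [iSup_comm]
  refine iSup_congr fun x => ?_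
  rw [← iSup_vecNorm_coord e (ξ.map (jetAt x))]
  refine iSup_congr fun n => congrArg vecNorm ?_
  ext1 p j
  exact jetAt_coordSeq e (ξ p.1 j) p.2 x

theorem form_coordEquiv (s t : C10 N M H) :
    form (coordEquiv e s) (coordEquiv e t) = form s t := by
  funext x
  change ∑' k, (starRingEnd ℂ) (inner ℂ (e k) (s.1 x)) * inner ℂ (e k) (t.1 x) =
    inner ℂ (s.1 x) (t.1 x)
  simp_rw [inner_conj_symm]
  exact e.tsum_inner_mul_inner _ _

theorem act_coordEquiv (s : C10 N M H) (a : C10 N M ℂ) :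
    coordEquiv e (act s a) = act (coordEquiv e s) a := by
  refine Subtype.ext (funext fun k => Subtype.ext (funext fun x => ?_))
  exact inner_smul_right _ _ _

theorem hasSum_coordEquiv (s : C10 N M H) (x : M) :
    HasSum (fun k => ((coordEquiv e s).1 k).1 x • e k) (s.1 x) := by
  have h := e.hasSum_repr (s.1 x)
  simp_rw [e.repr_apply_apply] at h
  exact h

end StandardModule

/-! ### Endomorphisms of the standard module -/

section Endomorphisms

variable {N : ℕ} {M : Type*} [MetricSpace M]
    [ChartedSpace (EuclideanSpace ℝ (Fin N)) M] [IsManifold (𝓡 N) ∞ M]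
    [RiemannianBundle (fun x : M => TangentSpace (𝓡 N) x)]
    [IsContMDiffRiemannianBundle (𝓡 N) ∞ (EuclideanSpace ℝ (Fin N))
      (fun x : M => TangentSpace (𝓡 N) x)]
    [IsRiemannianManifold (𝓡 N) M] [CompleteSpace M]
  {H : Type*} [NormedAddCommGroup H] [InnerProductSpace ℂ H] [CompleteSpace H]
  (e : HilbertBasis ℕ ℂ H)

/-- Endomorphisms of `C¹₀(M, H)` in the coordinates of a Hilbert basis. -/
def coordConj (T : Mor (C10 N M ℂ) (C10 N M H) (C10 N M H)) :
    Mor (C10 N M ℂ) (StdSeq (C10 N M ℂ)) (StdSeq (C10 N M ℂ)) :=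
  Mor.conj (A := C10 N M ℂ) (X := C10 N M H) (Y := StdSeq (C10 N M ℂ)) (B := M → ℂ)
    (coordEquiv e) (isCompleteIsometry_coordEquiv e) (act_coordEquiv e) (form_coordEquiv e) T

theorem coordConj_bijective : Function.Bijective (coordConj (N := N) (M := M) e) :=
  Mor.conj_bijective _ _ _ _

/-- The endomorphism of the standard module given by a symbol. -/
def C1b.toStdMor (α : C1b N M H H) :
    Mor (C10 N M ℂ) (StdSeq (C10 N M ℂ)) (StdSeq (C10 N M ℂ)) := coordConj e α.toMor

theorem C1b.toStdMor_apply (α : C1b N M H H) (f : StdSeq (C10 N M ℂ)) (x : M) :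
    ((coordEquiv e).symm ((C1b.toStdMor e α).1 f)).1 x = α.1 x (((coordEquiv e).symm f).1 x) := by
  have h : (C1b.toStdMor e α).1 f = coordEquiv e (α.op ((coordEquiv e).symm f)) := rfl
  rw [h, LinearEquiv.symm_apply_apply]
  rfl

theorem C1b.toStdMor_bijective : Function.Bijective (C1b.toStdMor (N := N) (M := M) e) :=
  (coordConj_bijective e).comp C1b.toMor_bijective

end Endomorphisms

end OpStarMod

end

open OpStarMod OpStarMod.HermForm OpStarMod.RightAction in
theorem propositionp (N : ℕ) (M : Type*) [MetricSpace M]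
    [ChartedSpace (EuclideanSpace ℝ (Fin N)) M] [IsManifold (𝓡 N) ∞ M]
    [RiemannianBundle (fun x : M => TangentSpace (𝓡 N) x)]
    [IsContMDiffRiemannianBundle (𝓡 N) ∞ (EuclideanSpace ℝ (Fin N))
      (fun x : M => TangentSpace (𝓡 N) x)]
    [IsRiemannianManifold (𝓡 N) M] [SecondCountableTopology M] [ConnectedSpace M]
    [CompleteSpace M]
    (H G : Type*) [NormedAddCommGroup H] [InnerProductSpace ℂ H] [CompleteSpace H]
    [TopologicalSpace.SeparableSpace H]
    [NormedAddCommGroup G] [InnerProductSpace ℂ G] [CompleteSpace G]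
    [TopologicalSpace.SeparableSpace G] :
    -- the two ways to bound `α` and its derivative agree
    (∀ α : M → (H →L[ℂ] G), StarStronglyDiff (N := N) α →
      (supNorm N α < ⊤ ↔ oneNorm N α < ⊤)) ∧
    -- the bijection `Φ`, its compatibility with adjoints, and the norm estimates
    (∃ Φ : C1b N M H G → Mor (C10 N M ℂ) (C10 N M H) (C10 N M G),
      (∀ (α : C1b N M H G) (s : C10 N M H) (x : M), ((Φ α).1 s).1 x = α.1 x (s.1 x)) ∧
      Function.Bijective Φ ∧
      (∀ α : C1b N M H G, ∃ β : C1b N M G H,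
        (∀ x : M, β.1 x = ContinuousLinearMap.adjoint (α.1 x)) ∧
        ∃ S : Mor (C10 N M ℂ) (C10 N M G) (C10 N M H),
          (∀ (t : C10 N M G) (x : M), (S.1 t).1 x = β.1 x (t.1 x)) ∧
          ∀ S' : C10 N M G →ₗ[ℂ] C10 N M H, IsAdjoint (Φ α).1 S' ↔ S' = S.1) ∧
      (∀ α : C1b N M H G,
        cbNorm (Φ α).1 ≤ oneNorm N α.1 ∧ oneNorm N α.1 ≤ 2 * cbNorm (Φ α).1)) ∧
    -- the endomorphisms of the standard module, which is unitarily and completely isometrically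
    -- identified with `C¹₀(M, H)` by an orthonormal basis of `H`
    (∀ e : HilbertBasis ℕ ℂ H, ∃ B : StdSeq (C10 N M ℂ) ≃ₗ[ℂ] C10 N M H,
      (∀ (f : StdSeq (C10 N M ℂ)) (x : M),
        HasSum (fun k : ℕ => (f.1 k).1 x • e k) ((B f).1 x)) ∧
      (∀ (f : StdSeq (C10 N M ℂ)) (a : C10 N M ℂ), B (act f a) = act (B f) a) ∧
      (∀ f g : StdSeq (C10 N M ℂ), form (B f) (B g) = form f g) ∧
      IsCompleteIsometry (X := StdSeq (C10 N M ℂ)) (Y := C10 N M H) B.toLinearMap ∧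
      ∃ Ψ : C1b N M H H → Mor (C10 N M ℂ) (StdSeq (C10 N M ℂ)) (StdSeq (C10 N M ℂ)),
        (∀ (α : C1b N M H H) (f : StdSeq (C10 N M ℂ)) (x : M),
          (B ((Ψ α).1 f)).1 x = α.1 x ((B f).1 x)) ∧
        Function.Bijective Ψ) := by
  refine ⟨fun α hα => supNorm_lt_top_iff_oneNorm_lt_top hα.1,
    ⟨C1b.toMor, fun α s x => rfl, C1b.toMor_bijective, fun α => ⟨α.adjoint, fun x => rfl,
      α.adjoint.toMor, fun t x => rfl, fun S' => α.isAdjoint_iff S'⟩,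
      fun α => ⟨α.cbNorm_op_le, α.oneNorm_le⟩⟩, fun e => ?_⟩
  -- The synthesis map is the inverse of the coordinate map, so each property is transported from
  -- `coordEquiv`.
  refine ⟨(coordEquiv e).symm, fun f x => ?_, fun f a => ?_, fun f g => ?_,
    (isCompleteIsometry_coordEquiv e).symm,
    C1b.toStdMor e, C1b.toStdMor_apply e, C1b.toStdMor_bijective e⟩
  · have h := hasSum_coordEquiv e ((coordEquiv e).symm f) x
    rwa [LinearEquiv.apply_symm_apply] at h
  · rw [LinearEquiv.symm_apply_eq, act_coordEquiv, LinearEquiv.apply_symm_apply]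
  · rw [← form_coordEquiv e, LinearEquiv.apply_symm_apply, LinearEquiv.apply_symm_apply]
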